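/- Let $R,a>0$, $\Omega=\{x\in\mathbb R^3: r<R,\ |x_3|<a\}$ with $r=\sqrt{x_1^2+x_2^2}$, $z=x_3$, let $S_1=\{r=R,|z|<a\}$, $S_2=\{r<R,|z|=a\}$, $S=S_1\cup S_2$ with outward unit normal $\bar n$, and $\Omega^T=\Omega\times(0,T)$. For $k\in\{0,1\}$ let $$\|u\|_{V_2^k(\Omega^T)}=\|u\|_{L_\infty(0,T;H^k(\Omega))}+\|\nabla u\|_{L_2(0,T;H^k(\Omega))},\qquad \|u\|_{H^k(\Omega)}^2=\sum_{|\alpha|\le k}\int_\Omega|D_x^\alpha u|^2\,dx ,$$ with weak derivatives in the Cartesian variables and, for vector fields, the sum of the squares over the Cartesian components; $V_2^k(\Omega^T)$ is the space of measurable functions with finite norm. There is a constant $c$, depending only on $R$ and $a$, such that the following holds for every $T>0$. Let $v:\Omega^T\to\mathbb R^3$ be measurable and such that for almost every $t\in(0,T)$ the field $v(\cdot,t)$ belongs to $H^2(\Omega)$, is axially symmetric (its cylindrical components $v_r,v_\varphi,v_z$ do not depend on the angle $\varphi$), satisfies $\operatorname{div}v=0$ in $\Omega$ and, in the sense of traces,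 the slip boundary conditions $$v\cdot\bar n=0,\qquad \bar n\cdot\mathbb D(v)\cdot\bar\tau=0\quad\text{on }S\text{ for all tangent vectors }\bar\tau,\qquad \mathbb D(v)=\nabla v+\nabla v^T .$$ (In particular $v$ may be an axially symmetric solution in $W_2^{2,1}(\Omega^T)$ of the Navier–Stokes equations with these boundary conditions.) Let $\chi=v_{r,z}-v_{z,r}$ and let $v'=(v_r,v_z)$ be the meridional velocity, that is the vector field $v'=v_r\bar e_r+v_z\bar e_z$. If $\chi/r\in V_2^0(\Omega^T)$, then $v'\in V_2^1(\Omega^T)$ and $$\|v'\|_{V_2^1(\Omega^T)}\le c\,\Big\|\frac{\chi}{r}\Big\|_{V_2^0(\Omega^T)} .$$ -/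

import Mathlib

open MeasureTheory Set
open scoped ENNReal NNReal ContDiff

noncomputable section

/-- Three-dimensional Euclidean space; the coordinates `x 0, x 1, x 2` are `x₁, x₂, x₃`. -/
abbrev E3 := EuclideanSpace ℝ (Fin 3)

/-! ### Cylindrical coordinates and the cylinder -/

/-- Distance `r` to the `x₃`-axis. -/
def cylR (x : E3) : ℝ := Real.sqrt (x 0 ^ 2 + x 1 ^ 2)

/-- The unit vector `e_r = (cos φ, sin φ, 0)` (with value `0` on the axis, a null set). -/
def eR (x : E3) : E3 := !₂[x 0 / cylR x, x 1 / cylR x, 0]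

/-- The unit vector `e_φ = (-sin φ, cos φ, 0)` (with value `0` on the axis, a null set). -/
def ePhi (x : E3) : E3 := !₂[-(x 1) / cylR x, x 0 / cylR x, 0]

/-- The unit vector `e_z = (0, 0, 1)`. -/
def eZ : E3 := !₂[0, 0, 1]

/-- The cylindrical components `v_r`, `v_φ`, `v_z` of a vector field. -/
def compR (u : E3 → E3) (x : E3) : ℝ := inner ℝ (u x) (eR x)

def compPhi (u : E3 → E3) (x : E3) : ℝ := inner ℝ (u x) (ePhi x)

def compZ (u : E3 → E3) (x : E3) : ℝ := inner ℝ (u x) eZ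

/-- The meridional field `v' = (v_r, v_z)`, that is `v_r e_r + v_z e_z`. -/
def meridional (u : E3 → E3) (x : E3) : E3 := compR u x • eR x + compZ u x • eZ

/-- Rotation by the angle `θ` about the `x₃`-axis. -/
def rotZ (θ : ℝ) (x : E3) : E3 :=
  !₂[Real.cos θ * x 0 - Real.sin θ * x 1, Real.sin θ * x 0 + Real.cos θ * x 1, x 2]

/-- The open cylinder `Ω = {r < R, |x₃| < a}`. -/
def cyl (R a : ℝ) : Set E3 := {x | cylR x < R ∧ |x 2| < a}

/-- The lateral part `S₁` of the boundary of the cylinder. -/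
def cylS1 (R a : ℝ) : Set E3 := {x | cylR x = R ∧ |x 2| < a}

/-- The top and the bottom `S₂` of the cylinder. -/
def cylS2 (R a : ℝ) : Set E3 := {x | cylR x < R ∧ |x 2| = a}

/-! ### Weak derivatives and Sobolev norms -/

/-- The classical partial derivative `∂ φ / ∂ x_i`. -/
def pd (i : Fin 3) (φ : E3 → ℝ) (x : E3) : ℝ := fderiv ℝ φ x (EuclideanSpace.single i 1)

/-- The classical derivative `D^α φ` for a multi-index `α`. -/
def multiDeriv (α : Fin 3 → ℕ) (φ : E3 → ℝ) : E3 → ℝ :=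
  (pd 0)^[α 0] ((pd 1)^[α 1] ((pd 2)^[α 2] φ))

/-- `g` is the weak derivative `D^α u` in the open set `Ω`. -/
def IsWeakDeriv (Ω : Set E3) (α : Fin 3 → ℕ) (u g : E3 → ℝ) : Prop :=
  LocallyIntegrableOn u Ω volume ∧ LocallyIntegrableOn g Ω volume ∧
    ∀ φ : E3 → ℝ, ContDiff ℝ ∞ φ → HasCompactSupport φ → tsupport φ ⊆ Ω →
      ∫ x in Ω, u x * multiDeriv α φ x = (-1) ^ (∑ i, α i) * ∫ x in Ω, g x * φ x

/-- `g` is the weak partial derivative `∂ u / ∂ x_i` in `Ω`. -/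
def IsWeakPartial (Ω : Set E3) (i : Fin 3) (u g : E3 → ℝ) : Prop :=
  IsWeakDeriv Ω (Pi.single i 1) u g

/-- The multi-indices `α` with `|α| ≤ k`. -/
def multiIndices (k : ℕ) : Finset (Fin 3 → ℕ) :=
  (Fintype.piFinset fun _ => Finset.range (k + 1)).filter fun α => ∑ i, α i ≤ k

/-- `‖u‖²_{H^k(Ω)} = ∑_{|α| ≤ k} ∫_Ω |D^α u|²`. Weak derivatives are unique up to null sets, so the
infimum runs over equal values; it is `∞` if some weak derivative does not exist. -/
def hNormSq (k : ℕ) (Ω : Set E3) (u : E3 → ℝ) : ℝ≥0∞ :=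
  ⨅ (D : (Fin 3 → ℕ) → E3 → ℝ) (_ : ∀ α ∈ multiIndices k, IsWeakDeriv Ω α u (D α)),
    ∑ α ∈ multiIndices k, ∫⁻ x in Ω, ‖D α x‖ₑ ^ 2

/-- `‖∇u‖²_{H^k(Ω)}`, with value `∞` if the weak gradient does not exist. -/
def gradHNormSq (k : ℕ) (Ω : Set E3) (u : E3 → ℝ) : ℝ≥0∞ :=
  ⨅ (G : Fin 3 → E3 → ℝ) (_ : ∀ i, IsWeakPartial Ω i u (G i)), ∑ i, hNormSq k Ω (G i)

/-- The norm `‖u‖_{L_∞(0,T;H^k(Ω))} + ‖∇u‖_{L_2(0,T;H^k(Ω))}` of `V_2^k(Ω^T)`, for a function `u`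
of `(t, x)` with the scalar components `u j`, `j : ι`. -/
def vNorm {ι : Type} [Fintype ι] (k : ℕ) (Ω : Set E3) (T : ℝ) (u : ι → ℝ → E3 → ℝ) : ℝ≥0∞ :=
  essSup (fun t => (∑ j, hNormSq k Ω (u j t)) ^ (1 / 2 : ℝ)) (volume.restrict (Ioo 0 T)) +
    (∫⁻ t in Ioo 0 T, ∑ j, gradHNormSq k Ω (u j t)) ^ (1 / 2 : ℝ)

/-- Measurability of a function of `(t, x)` on `Ω^T = (0,T) × Ω`. -/
def MeasOn (Ω : Set E3) (T : ℝ) (w : ℝ → E3 → ℝ) : Prop :=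
  AEStronglyMeasurable (fun p : ℝ × E3 => w p.1 p.2) (volume.restrict (Ioo 0 T ×ˢ Ω))

/-- `u ∈ V_2^k(Ω^T)`. -/
def MemV {ι : Type} [Fintype ι] (k : ℕ) (Ω : Set E3) (T : ℝ) (u : ι → ℝ → E3 → ℝ) : Prop :=
  (∀ j, MeasOn Ω T (u j)) ∧ vNorm k Ω T u < ⊤

/-! ### Axially symmetric solenoidal fields with slip boundary conditions -/

/-- `u_r`, `u_φ` and `u_z` do not depend on `φ`. -/
def IsAxisymmetric (Ω : Set E3) (u : E3 → E3) : Prop :=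
  ∀ θ : ℝ, ∀ᵐ x ∂(volume.restrict Ω), compR u (rotZ θ x) = compR u x ∧
    compPhi u (rotZ θ x) = compPhi u x ∧ compZ u (rotZ θ x) = compZ u x

/-- `J i j` is the weak derivative `∂ u_i / ∂ x_j`. -/
def IsWeakJacobian (Ω : Set E3) (u : E3 → E3) (J : Fin 3 → Fin 3 → E3 → ℝ) : Prop :=
  ∀ i j, IsWeakPartial Ω j (fun x => u x i) (J i j)

/-- `div u = 0` in `Ω`. -/
def IsDivFree (Ω : Set E3) (u : E3 → E3) : Prop :=
  ∃ J, IsWeakJacobian Ω u J ∧ ∀ᵐ x ∂(volume.restrict Ω), ∑ i, J i i x = 0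

/-- `u · n = 0` on the boundary of `Ω`, in the sense of traces: by the divergence theorem the
integral below is the integral of `(u · n) φ` over the boundary. -/
def IsImpermeable (Ω : Set E3) (u : E3 → E3) : Prop :=
  ∃ J, IsWeakJacobian Ω u J ∧
    ∀ φ : E3 → ℝ, ContDiff ℝ ∞ φ → HasCompactSupport φ →
      ∫ x in Ω, (∑ i, (u x i * pd i φ x + J i i x * φ x)) = 0

/-- `w · n = 0` on `S₁ ∪ S₂`. -/
def IsTangential (R a : ℝ) (w : E3 → E3) : Prop :=
  (∀ x ∈ cylS1 R a, compR w x = 0) ∧ (∀ x ∈ cylS2 R a, compZ w x = 0)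

/-- `n · 𝔻(u) · τ = 0` on the boundary of the cylinder for all tangent vectors `τ`, where
`𝔻(u) = ∇u + (∇u)ᵀ`, in the sense of traces: by the divergence theorem the integral below is the
integral of `n · 𝔻(u) · w` over the boundary. Here `J i j = ∂_j u_i` and
`K i j = ∂_j 𝔻(u)_{ij}`. -/
def IsSlip (R a : ℝ) (u : E3 → E3) : Prop :=
  ∃ J K : Fin 3 → Fin 3 → E3 → ℝ, IsWeakJacobian (cyl R a) u J ∧
    (∀ i j, IsWeakPartial (cyl R a) j (fun x => J i j x + J j i x) (K i j)) ∧
    ∀ w : E3 → E3, ContDiff ℝ ∞ w → HasCompactSupport w → IsTangential R a w →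
      ∫ x in cyl R a, (∑ i, ∑ j,
        ((J i j x + J j i x) * pd j (fun y => w y i) x + K i j x * w x i)) = 0

/-- An axially symmetric divergence-free `H²` velocity field in the cylinder that satisfies the
slip boundary conditions. -/
structure IsSlipVelocity (R a : ℝ) (u : E3 → E3) : Prop where
  axisymmetric : IsAxisymmetric (cyl R a) u
  memH2 : ∀ i, hNormSq 2 (cyl R a) (fun x => u x i) < ⊤
  divFree : IsDivFree (cyl R a) u
  impermeable : IsImpermeable (cyl R a) u
  slip : IsSlip R a u

/-- `χ = u_{r,z} - u_{z,r}` in `Ω`, with weak derivatives; here `∂_r = e_r · ∇`. -/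
def IsAngularVorticity (Ω : Set E3) (u : E3 → E3) (χ : E3 → ℝ) : Prop :=
  ∃ (A : E3 → ℝ) (G : Fin 3 → E3 → ℝ), IsWeakPartial Ω 2 (compR u) A ∧
    (∀ i, IsWeakPartial Ω i (compZ u) (G i)) ∧
    ∀ᵐ x ∂(volume.restrict Ω), χ x = A x - ∑ i, eR x i * G i x

end

open Filter Topology

/-! ### Geometry of the cylinder -/

/-! Fix a time, let w be the meridional part of the velocity, with horizontal part w_h = (w 0, w 1)
and axial component w_z = w 2, and put g = χ/r. In Cartesian components the vertical vorticity of w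
vanishes and ∂_z w_i − ∂_i w_z = x_i g for the two horizontal i. The theorem is therefore a div-curl
estimate at fixed time: the H¹ norm of w is bounded by the L² norm of g, and the H¹ norm of ∇w by
the L² norm of ∇g, with constants depending only on R and a. Taking the essential supremum and the
integral in time then gives the claim.

Cartesian components keep the singular coefficients 1/r out of the estimates. The field w is the
average of the velocity and of its mirror image in a plane through the axis; this shows at once that
w is in H², solenoidal, tangential on the boundary, and has ∂_z w_h = 0 at the ends
(`IsSlipVelocity.exists_meridionalField`). No trace is constructed: a boundary condition is the
absence of a boundary term in an integration by parts against smooth functions, and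
`pairing_eq_zero_of_test` extends such identities from smooth functions to H¹.

Two facts carry the estimates. (1) If the angular derivative of α is −mβ with m ≥ 0, then the
integral of ∂₀α ∂₁β − ∂₁α ∂₀β is formally a boundary term on S₁ of favourable sign, so the
horizontal gradients of (α, β) are controlled by the horizontal divergence and curl
(`integral_horizontal_gradient_le`). This applies to w_h and ∂_z w_h with m = 1, and to the
trace-free horizontal strain with m = 2. (2) ∂_z w is orthogonal in L² to ∇w_z, and ∂_z²w is
orthogonal to ∇∂_z w_z (`MeridionalField.integral_cross`,
`MeridionalField.integral_hess_axial_sq_le`).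

At first order, (1) and (2) give ‖∇w‖ ≤ R‖g‖. At second order, (2) gives ‖∇∂_z w_z‖ ≤ R‖∂_z g‖, then
(1) controls the mixed and the purely horizontal derivatives, and the differentiated vorticity
relation yields the rest. Lower-order terms are absorbed by a Poincaré inequality along the axis for
w_z and g, which vanish at the ends, and by the fact that w_h is, up to a quarter turn, its own
angular derivative. -/

theorem continuous_coord (i : Fin 3) : Continuous fun x : E3 => x i := by fun_prop

theorem contDiff_coord (i : Fin 3) : ContDiff ℝ ∞ fun x : E3 => x i := by fun_prop

theorem continuous_cylR : Continuous cylR := by unfold cylR; fun_prop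

theorem cylR_nonneg (x : E3) : 0 ≤ cylR x := Real.sqrt_nonneg _

theorem cylR_sq (x : E3) : cylR x ^ 2 = x 0 ^ 2 + x 1 ^ 2 := Real.sq_sqrt (by positivity)

theorem isOpen_cyl (R a : ℝ) : IsOpen (cyl R a) :=
  (isOpen_lt continuous_cylR continuous_const).inter
    (isOpen_lt (continuous_coord 2).abs continuous_const)

theorem measurableSet_cyl (R a : ℝ) : MeasurableSet (cyl R a) := (isOpen_cyl R a).measurableSet

theorem abs_coord_zero_le (x : E3) : |x 0| ≤ cylR x := by
  apply Real.abs_le_sqrt; nlinarith [sq_nonneg (x 1)]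

theorem abs_coord_one_le (x : E3) : |x 1| ≤ cylR x := by
  apply Real.abs_le_sqrt; nlinarith [sq_nonneg (x 0)]

theorem norm_sq_eq (x : E3) : ‖x‖ ^ 2 = cylR x ^ 2 + x 2 ^ 2 := by
  rw [EuclideanSpace.norm_sq_eq, cylR_sq, Fin.sum_univ_three]
  simp

theorem cyl_subset_closedBall (R a : ℝ) : cyl R a ⊆ Metric.closedBall 0 (R + a) := by
  intro x hx
  obtain ⟨h1, h2⟩ := hx
  rw [mem_closedBall_zero_iff]
  have h0 := cylR_nonneg x
  have ha : 0 ≤ |x 2| := abs_nonneg _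
  apply abs_le_of_sq_le_sq' _ (by linarith) |>.2
  rw [norm_sq_eq, ← sq_abs (x 2)]
  nlinarith

theorem isBounded_cyl (R a : ℝ) : Bornology.IsBounded (cyl R a) :=
  Metric.isBounded_closedBall.subset (cyl_subset_closedBall R a)

instance isFiniteMeasure_cyl (R a : ℝ) : IsFiniteMeasure (volume.restrict (cyl R a)) :=
  isFiniteMeasure_restrict.2 (isBounded_cyl R a).measure_lt_top.ne

theorem ae_mem_cyl (R a : ℝ) : ∀ᵐ x ∂volume.restrict (cyl R a), x ∈ cyl R a :=
  ae_restrict_mem (measurableSet_cyl R a)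

/-! ### Partial derivatives of smooth functions -/

theorem contDiff_pd {φ : E3 → ℝ} (hφ : ContDiff ℝ ∞ φ) (i : Fin 3) : ContDiff ℝ ∞ (pd i φ) :=
  (hφ.fderiv_right (m := ∞) le_rfl).clm_apply contDiff_const

theorem pd_mul {φ ψ : E3 → ℝ} (hφ : ContDiff ℝ ∞ φ) (hψ : ContDiff ℝ ∞ ψ) (i : Fin 3) (x : E3) :
    pd i (fun y => φ y * ψ y) x = φ x * pd i ψ x + ψ x * pd i φ x := by
  have h1 := (hφ.differentiable (by simp)) x
  have h2 := (hψ.differentiable (by simp)) x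
  simp [pd, fderiv_fun_mul h1 h2]

theorem pd_comm {φ : E3 → ℝ} (hφ : ContDiff ℝ ∞ φ) (i j : Fin 3) (x : E3) :
    pd i (pd j φ) x = pd j (pd i φ) x := by
  have hs : IsSymmSndFDerivAt ℝ φ x := by
    apply hφ.contDiffAt.isSymmSndFDerivAt
    simp only [minSmoothness_of_isRCLikeNormedField]
    exact WithTop.coe_le_coe.2 le_top
  have hd : DifferentiableAt ℝ (fderiv ℝ φ) x :=
    ((hφ.fderiv_right (m := ∞) le_rfl).differentiable (by simp)) x
  have key : ∀ k l : Fin 3, pd k (pd l φ) x =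
      fderiv ℝ (fderiv ℝ φ) x (EuclideanSpace.single k 1) (EuclideanSpace.single l 1) := by
    intro k l
    unfold pd
    rw [fderiv_clm_apply hd (by fun_prop)]
    simp
  rw [key, key]
  exact hs.eq _ _

theorem pd_coord (i j : Fin 3) (x : E3) : pd i (fun y => y j) x = if j = i then 1 else 0 := by
  have : HasFDerivAt (fun y : E3 => y j) (EuclideanSpace.proj (𝕜 := ℝ) j : E3 →L[ℝ] ℝ) x :=
    (EuclideanSpace.proj (𝕜 := ℝ) j : E3 →L[ℝ] ℝ).hasFDerivAt
  simp [pd, this.fderiv]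

/-- Smooth functions with compact support. -/
def IsTest (φ : E3 → ℝ) : Prop := ContDiff ℝ ∞ φ ∧ HasCompactSupport φ

theorem IsTest.pd {φ : E3 → ℝ} (hφ : IsTest φ) (i : Fin 3) : IsTest (pd i φ) := by
  refine ⟨contDiff_pd hφ.1 i, ?_⟩
  have := hφ.2.fderiv_apply (𝕜 := ℝ) (v := EuclideanSpace.single i 1)
  exact this

theorem IsTest.smooth_mul {φ η : E3 → ℝ} (hφ : IsTest φ) (hη : ContDiff ℝ ∞ η) :
    IsTest fun x => η x * φ x :=
  ⟨hη.mul hφ.1, hφ.2.mul_left⟩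

theorem IsTest.add {φ ψ : E3 → ℝ} (hφ : IsTest φ) (hψ : IsTest ψ) : IsTest fun x => φ x + ψ x :=
  ⟨hφ.1.add hψ.1, hφ.2.add hψ.2⟩

theorem tsupport_pd_subset (φ : E3 → ℝ) (i : Fin 3) : tsupport (pd i φ) ⊆ tsupport φ :=
  tsupport_fderiv_apply_subset ℝ _

theorem IsTest.memLp {φ : E3 → ℝ} (hφ : IsTest φ) (R a : ℝ) :
    MemLp φ 2 (volume.restrict (cyl R a)) :=
  (hφ.1.continuous.memLp_of_hasCompactSupport hφ.2 (μ := volume)).restrict _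

/-! ### Cutoff functions -/

/-- A radial cutoff, supported in the interior of the infinite cylinder `r < R`. -/
noncomputable def cutR (R : ℝ) (n : ℕ) (x : E3) : ℝ :=
  Real.smoothTransition (n * (R ^ 2 - (x 0 ^ 2 + x 1 ^ 2)) - 1)

/-- An axial cutoff, supported in the interior of the slab `|x₃| < a`. -/
noncomputable def cutZ (a : ℝ) (n : ℕ) (x : E3) : ℝ :=
  Real.smoothTransition (n * (a ^ 2 - x 2 ^ 2) - 1)

theorem contDiff_cutR (R : ℝ) (n : ℕ) : ContDiff ℝ ∞ (cutR R n) :=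
  Real.smoothTransition.contDiff.comp (by fun_prop)

theorem contDiff_cutZ (a : ℝ) (n : ℕ) : ContDiff ℝ ∞ (cutZ a n) :=
  Real.smoothTransition.contDiff.comp (by fun_prop)

theorem abs_smoothTransition_le (t : ℝ) : |Real.smoothTransition t| ≤ 1 := by
  rw [abs_of_nonneg (Real.smoothTransition.nonneg t)]; exact Real.smoothTransition.le_one t

theorem abs_cutR_le (R : ℝ) (n : ℕ) (x : E3) : |cutR R n x| ≤ 1 := abs_smoothTransition_le _

theorem abs_cutZ_le (a : ℝ) (n : ℕ) (x : E3) : |cutZ a n x| ≤ 1 := abs_smoothTransition_le _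

theorem tendsto_smoothTransition {t : ℝ} (ht : 0 < t) :
    Tendsto (fun n : ℕ => Real.smoothTransition (n * t - 1)) atTop (𝓝 1) := by
  apply tendsto_const_nhds.congr'
  have h : Tendsto (fun n : ℕ => (n : ℝ) * t) atTop atTop :=
    tendsto_natCast_atTop_atTop.atTop_mul_const ht
  filter_upwards [h.eventually_ge_atTop 2] with n hn
  exact (Real.smoothTransition.one_of_one_le (by linarith)).symm

theorem mem_cyl_sq {R a : ℝ} {x : E3} (hx : x ∈ cyl R a) :
    0 < R ^ 2 - (x 0 ^ 2 + x 1 ^ 2) ∧ 0 < a ^ 2 - x 2 ^ 2 := by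
  obtain ⟨h1, h2⟩ := hx
  have h0 := cylR_nonneg x
  have h3 := cylR_sq x
  have h4 : 0 ≤ |x 2| := abs_nonneg _
  have h5 := sq_abs (x 2)
  constructor <;> nlinarith

theorem tendsto_cutR {R a : ℝ} {x : E3} (hx : x ∈ cyl R a) :
    Tendsto (fun n => cutR R n x) atTop (𝓝 1) := tendsto_smoothTransition (mem_cyl_sq hx).1

theorem tendsto_cutZ {R a : ℝ} {x : E3} (hx : x ∈ cyl R a) :
    Tendsto (fun n => cutZ a n x) atTop (𝓝 1) := tendsto_smoothTransition (mem_cyl_sq hx).2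

/-- The product is supported in r² ≤ R² − 1/n, z² ≤ a² − 1/m, a closed set inside the open cylinder;
for n = 0 or m = 0 the product is identically zero. -/
theorem tsupport_cut_subset {R a : ℝ} (hR : 0 < R) (ha : 0 < a) (φ : E3 → ℝ) (n m : ℕ) :
    tsupport (fun x => cutZ a m x * (cutR R n x * φ x)) ⊆ cyl R a := by
  have hc : IsClosed {x : E3 | 1 ≤ (n : ℝ) * (R ^ 2 - (x 0 ^ 2 + x 1 ^ 2)) ∧
      1 ≤ (m : ℝ) * (a ^ 2 - x 2 ^ 2)} := by
    apply IsClosed.and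
    · exact isClosed_le continuous_const (by fun_prop)
    · exact isClosed_le continuous_const (by fun_prop)
  refine (closure_minimal ?_ hc).trans ?_
  · intro x hx
    by_contra hcon
    apply hx
    simp only [mem_ofPred_eq, not_and_or, not_le] at hcon
    rcases hcon with h | h
    · simp [cutR, Real.smoothTransition.zero_of_nonpos
        (show (n : ℝ) * (R ^ 2 - (x 0 ^ 2 + x 1 ^ 2)) - 1 ≤ 0 by linarith)]
    · simp [cutZ, Real.smoothTransition.zero_of_nonpos
        (show (m : ℝ) * (a ^ 2 - x 2 ^ 2) - 1 ≤ 0 by linarith)]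
  · rintro x ⟨h1, h2⟩
    have p1 : 0 < R ^ 2 - (x 0 ^ 2 + x 1 ^ 2) := by
      by_contra h
      have : (n : ℝ) * (R ^ 2 - (x 0 ^ 2 + x 1 ^ 2)) ≤ 0 :=
        mul_nonpos_of_nonneg_of_nonpos (by positivity) (not_lt.1 h)
      linarith
    have p2 : 0 < a ^ 2 - x 2 ^ 2 := by
      by_contra h
      have : (m : ℝ) * (a ^ 2 - x 2 ^ 2) ≤ 0 :=
        mul_nonpos_of_nonneg_of_nonpos (by positivity) (not_lt.1 h)
      linarith
    exact ⟨(Real.sqrt_lt' hR).2 (by linarith), abs_lt_of_sq_lt_sq (by linarith) ha.le⟩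

theorem pd_eq_zero_of_update {η : E3 → ℝ} (i : Fin 3)
    (h : ∀ (x : E3) (t : ℝ), η (x + t • EuclideanSpace.single i 1) = η x) (x : E3) :
    pd i η x = 0 := by
  by_cases hd : DifferentiableAt ℝ η x
  · have h1 := hd.hasFDerivAt.hasLineDerivAt (EuclideanSpace.single i (1 : ℝ))
    have h2 : HasLineDerivAt ℝ η 0 x (EuclideanSpace.single i (1 : ℝ)) := by
      unfold HasLineDerivAt
      simp only [h]
      exact hasDerivAt_const _ _
    exact h1.unique h2
  · simp [pd, fderiv_zero_of_not_differentiableAt hd]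

theorem pd_two_cutR (R : ℝ) (n : ℕ) (x : E3) : pd 2 (cutR R n) x = 0 :=
  pd_eq_zero_of_update 2 (fun x t => by simp [cutR]) x

theorem pd_zero_cutZ (a : ℝ) (n : ℕ) (x : E3) : pd 0 (cutZ a n) x = 0 :=
  pd_eq_zero_of_update 0 (fun x t => by simp [cutZ]) x

theorem pd_one_cutZ (a : ℝ) (n : ℕ) (x : E3) : pd 1 (cutZ a n) x = 0 :=
  pd_eq_zero_of_update 1 (fun x t => by simp [cutZ]) x

theorem tendsto_integral_mul_of_le_one {μ : Measure E3} {F : E3 → ℝ} {c : ℕ → E3 → ℝ} {c' : E3 → ℝ}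
    (hF : Integrable F μ) (hc : ∀ n, AEStronglyMeasurable (c n) μ) (hb : ∀ n x, |c n x| ≤ 1)
    (hlim : ∀ᵐ x ∂μ, Tendsto (fun n => c n x) atTop (𝓝 (c' x))) :
    Tendsto (fun n => ∫ x, c n x * F x ∂μ) atTop (𝓝 (∫ x, c' x * F x ∂μ)) := by
  apply tendsto_integral_of_dominated_convergence (fun x => |F x|)
  · exact fun n => (hc n).mul hF.1
  · exact hF.abs
  · intro n
    filter_upwards with x
    rw [Real.norm_eq_abs, abs_mul]
    exact mul_le_of_le_one_left (abs_nonneg _) (hb n x)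
  · filter_upwards [hlim] with x hx
    exact hx.mul_const _

/-- The cutoffs are bounded by 1 and tend to 1 in the open cylinder, so dominated convergence
removes them, provided no derivative falls on them. -/
theorem integral_eq_zero_of_cutR {R a : ℝ} {F : E3 → ℝ}
    (hF : Integrable F (volume.restrict (cyl R a)))
    (h : ∀ n, ∫ x in cyl R a, cutR R n x * F x = 0) : ∫ x in cyl R a, F x = 0 := by
  have := tendsto_integral_mul_of_le_one (c := cutR R) (c' := fun _ => 1) hF
    (fun n => (contDiff_cutR R n).continuous.aestronglyMeasurable) (abs_cutR_le R)
    ((ae_mem_cyl R a).mono fun x hx => tendsto_cutR hx)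
  simp only [h, one_mul] at this
  exact tendsto_nhds_unique this tendsto_const_nhds

theorem integral_eq_zero_of_cutZ {R a : ℝ} {F : E3 → ℝ}
    (hF : Integrable F (volume.restrict (cyl R a)))
    (h : ∀ n, ∫ x in cyl R a, cutZ a n x * F x = 0) : ∫ x in cyl R a, F x = 0 := by
  have := tendsto_integral_mul_of_le_one (c := cutZ a) (c' := fun _ => 1) hF
    (fun n => (contDiff_cutZ a n).continuous.aestronglyMeasurable) (abs_cutZ_le a)
    ((ae_mem_cyl R a).mono fun x hx => tendsto_cutZ hx)
  simp only [h, one_mul] at this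
  exact tendsto_nhds_unique this tendsto_const_nhds

/-! ### Weak partial derivatives in `L²` of the cylinder -/

/-- `f` and `g` are square integrable in the cylinder and `g = ∂ᵢ f` weakly. -/
def HasPd (R a : ℝ) (i : Fin 3) (f g : E3 → ℝ) : Prop :=
  MemLp f 2 (volume.restrict (cyl R a)) ∧ MemLp g 2 (volume.restrict (cyl R a)) ∧
    ∀ φ : E3 → ℝ, IsTest φ → tsupport φ ⊆ cyl R a →
      ∫ x in cyl R a, (f x * pd i φ x + g x * φ x) = 0

/-- `f` and `g` are square integrable in the cylinder, `g = ∂₃ f` weakly and `f` vanishes at the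
top and at the bottom. -/
def VanishesAtEnds (R a : ℝ) (f g : E3 → ℝ) : Prop :=
  MemLp f 2 (volume.restrict (cyl R a)) ∧ MemLp g 2 (volume.restrict (cyl R a)) ∧
    ∀ φ : E3 → ℝ, IsTest φ → ∫ x in cyl R a, (f x * pd 2 φ x + g x * φ x) = 0

theorem integrable_mul_of_memLp {μ : Measure E3} {f g : E3 → ℝ} (hf : MemLp f 2 μ)
    (hg : MemLp g 2 μ) : Integrable (fun x => f x * g x) μ := hf.integrable_mul hg

theorem memLp_bdd_mul {μ : Measure E3} {f m : E3 → ℝ} (hf : MemLp f 2 μ)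
    (hm : AEStronglyMeasurable m μ) {C : ℝ} (hC : ∀ᵐ x ∂μ, |m x| ≤ C) :
    MemLp (fun x => m x * f x) 2 μ := by
  refine MemLp.of_le_mul (c := C) hf (hm.mul hf.1) ?_
  filter_upwards [hC] with x hx
  rw [norm_mul]
  exact mul_le_mul_of_nonneg_right hx (norm_nonneg _)

theorem ae_abs_coord_le (R a : ℝ) (j : Fin 3) :
    ∀ᵐ x ∂volume.restrict (cyl R a), |x j| ≤ |R + a| := by
  filter_upwards [ae_mem_cyl R a] with x hx
  have h := mem_closedBall_zero_iff.1 (cyl_subset_closedBall R a hx)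
  exact ((PiLp.norm_apply_le x j).trans h).trans (le_abs_self _)

theorem MemLp.coord_mul {R a : ℝ} {f : E3 → ℝ} (hf : MemLp f 2 (volume.restrict (cyl R a)))
    (j : Fin 3) : MemLp (fun x => x j * f x) 2 (volume.restrict (cyl R a)) :=
  memLp_bdd_mul hf (continuous_coord j).aestronglyMeasurable (ae_abs_coord_le R a j)

theorem integral_eq_zero_of_ae_eq_add {μ : Measure E3} {F G H : E3 → ℝ} (hF : Integrable F μ)
    (hG : Integrable G μ) (hF0 : ∫ x, F x ∂μ = 0) (hG0 : ∫ x, G x ∂μ = 0)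
    (h : ∀ᵐ x ∂μ, H x = F x + G x) : ∫ x, H x ∂μ = 0 := by
  rw [integral_congr_ae h, integral_add hF hG, hF0, hG0, add_zero]

theorem integral_eq_zero_of_ae_eq_sub {μ : Measure E3} {F G H : E3 → ℝ} (hF : Integrable F μ)
    (hG : Integrable G μ) (hF0 : ∫ x, F x ∂μ = 0) (hG0 : ∫ x, G x ∂μ = 0)
    (h : ∀ᵐ x ∂μ, H x = F x - G x) : ∫ x, H x ∂μ = 0 := by
  rw [integral_congr_ae h, integral_sub hF hG, hF0, hG0, sub_zero]

theorem integrable_pairing {R a : ℝ} {f g φ ψ : E3 → ℝ}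
    (hf : MemLp f 2 (volume.restrict (cyl R a))) (hg : MemLp g 2 (volume.restrict (cyl R a)))
    (hφ : IsTest φ) (hψ : IsTest ψ) :
    Integrable (fun x => f x * φ x + g x * ψ x) (volume.restrict (cyl R a)) :=
  (integrable_mul_of_memLp hf (hφ.memLp R a)).add (integrable_mul_of_memLp hg (hψ.memLp R a))

section

variable {R a : ℝ} {i j k : Fin 3} {f g f' g' : E3 → ℝ}

theorem HasPd.memLp_deriv (h : HasPd R a i f g) : MemLp g 2 (volume.restrict (cyl R a)) := h.2.1

theorem ae_eq_zero_of_integral_test {h : E3 → ℝ} (hh : MemLp h 2 (volume.restrict (cyl R a)))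
    (H : ∀ φ : E3 → ℝ, IsTest φ → tsupport φ ⊆ cyl R a → ∫ x in cyl R a, h x * φ x = 0) :
    ∀ᵐ x ∂volume.restrict (cyl R a), h x = 0 := by
  have hint : IntegrableOn h (cyl R a) := hh.integrable (by norm_num)
  rw [ae_restrict_iff' (measurableSet_cyl R a)]
  refine (isOpen_cyl R a).ae_eq_zero_of_integral_contDiff_smul_eq_zero
    hint.locallyIntegrableOn fun φ h1 h2 h3 => ?_
  rw [← H φ ⟨h1, h2⟩ h3, ← integral_indicator (measurableSet_cyl R a)]
  congr 1
  ext x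
  by_cases hx : x ∈ cyl R a
  · simp [hx, mul_comm]
  · have : φ x = 0 := by
      by_contra hne
      exact hx (h3 (subset_tsupport _ hne))
    simp [hx, this]

theorem HasPd.unique (h : HasPd R a i f g) (h' : HasPd R a i f g') :
    ∀ᵐ x ∂volume.restrict (cyl R a), g x = g' x := by
  have := ae_eq_zero_of_integral_test (h := fun x => g x - g' x) (h.memLp_deriv.sub h'.memLp_deriv) ?_
  · filter_upwards [this] with x hx using sub_eq_zero.1 hx
  · intro φ hφ hs
    refine integral_eq_zero_of_ae_eq_sub (integrable_pairing h.1 h.2.1 (hφ.pd i) hφ)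
      (integrable_pairing h'.1 h'.2.1 (hφ.pd i) hφ) (h.2.2 φ hφ hs) (h'.2.2 φ hφ hs) ?_
    filter_upwards with x
    ring

theorem HasPd.congr (h : HasPd R a i f g) (hf : ∀ᵐ x ∂volume.restrict (cyl R a), f x = f' x)
    (hg : ∀ᵐ x ∂volume.restrict (cyl R a), g x = g' x) : HasPd R a i f' g' := by
  refine ⟨(memLp_congr_ae hf).1 h.1, (memLp_congr_ae hg).1 h.2.1, fun φ hφ hs => ?_⟩
  rw [← h.2.2 φ hφ hs]
  apply integral_congr_ae
  filter_upwards [hf, hg] with x h1 h2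
  rw [h1, h2]

theorem HasPd.unique_of_ae_eq (h : HasPd R a i f g) (h' : HasPd R a i f' g')
    (hf : ∀ᵐ x ∂volume.restrict (cyl R a), f x = f' x) :
    ∀ᵐ x ∂volume.restrict (cyl R a), g x = g' x :=
  (h.congr hf (by simp)).unique h'

theorem HasPd.add (h : HasPd R a i f g) (h' : HasPd R a i f' g') :
    HasPd R a i (fun x => f x + f' x) (fun x => g x + g' x) := by
  refine ⟨h.1.add h'.1, h.2.1.add h'.2.1, fun φ hφ hs => ?_⟩
  refine integral_eq_zero_of_ae_eq_add (integrable_pairing h.1 h.2.1 (hφ.pd i) hφ)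
      (integrable_pairing h'.1 h'.2.1 (hφ.pd i) hφ) (h.2.2 φ hφ hs) (h'.2.2 φ hφ hs) ?_
  filter_upwards with x
  ring

theorem HasPd.const_mul (h : HasPd R a i f g) (c : ℝ) :
    HasPd R a i (fun x => c * f x) (fun x => c * g x) := by
  refine ⟨h.1.const_mul c, h.2.1.const_mul c, fun φ hφ hs => ?_⟩
  simp only [mul_assoc, ← mul_add]
  rw [integral_const_mul, h.2.2 φ hφ hs, mul_zero]

theorem HasPd.neg (h : HasPd R a i f g) : HasPd R a i (fun x => -f x) (fun x => -g x) := by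
  simpa using h.const_mul (-1)

theorem HasPd.sub (h : HasPd R a i f g) (h' : HasPd R a i f' g') :
    HasPd R a i (fun x => f x - f' x) (fun x => g x - g' x) := by
  simpa [sub_eq_add_neg] using h.add h'.neg

theorem HasPd.zero : HasPd R a i (fun _ => 0) (fun _ => 0) := by
  refine ⟨by simp, by simp, fun φ _ _ => by simp⟩

theorem HasPd.coord_mul (h : HasPd R a i f g) (j : Fin 3) :
    HasPd R a i (fun x => x j * f x) (fun x => x j * g x + (if j = i then 1 else 0) * f x) := by
  refine ⟨MemLp.coord_mul h.1 j, (MemLp.coord_mul h.2.1 j).add (h.1.const_mul _),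
    fun φ hφ hs => ?_⟩
  refine Eq.trans ?_
    (h.2.2 _ (hφ.smooth_mul (contDiff_coord j)) ((tsupport_mul_subset_right).trans hs))
  congr 1
  ext x
  rw [pd_mul (contDiff_coord j) hφ.1, pd_coord]
  ring

/-- Weak partial derivatives commute. -/
theorem HasPd.comm (hi : HasPd R a i f g) (hj : HasPd R a j f f') (hij : HasPd R a j g g') :
    HasPd R a i f' g' := by
  refine ⟨hj.2.1, hij.2.1, fun φ hφ hs => ?_⟩
  have e1 := hi.2.2 _ (hφ.pd j) ((tsupport_pd_subset _ _).trans hs)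
  have e2 := hj.2.2 _ (hφ.pd i) ((tsupport_pd_subset _ _).trans hs)
  have e3 := hij.2.2 _ hφ hs
  have i1 := integrable_pairing hi.1 hi.2.1 ((hφ.pd j).pd i) (hφ.pd j)
  have i2 := integrable_pairing hj.1 hj.2.1 ((hφ.pd i).pd j) (hφ.pd i)
  have i3 := integrable_pairing hij.1 hij.2.1 (hφ.pd j) hφ
  have e4 : ∫ x in cyl R a, ((f x * pd j (pd i φ) x + f' x * pd i φ x) +
      (g x * pd j φ x + g' x * φ x)) = 0 := by rw [integral_add i2 i3, e2, e3, add_zero]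
  refine integral_eq_zero_of_ae_eq_sub (i2.add i3) i1 e4 e1 ?_
  filter_upwards with x
  simp only [Pi.add_apply, pd_comm hφ.1 i j x]
  ring

theorem pd_cutZ_mul {φ : E3 → ℝ} (hφ : ContDiff ℝ ∞ φ) (hi : i ≠ 2) (n : ℕ) (x : E3) :
    pd i (fun y => cutZ a n y * φ y) x = cutZ a n x * pd i φ x := by
  rw [pd_mul (contDiff_cutZ a n) hφ]
  have : pd i (cutZ a n) x = 0 := by
    fin_cases i
    · exact pd_zero_cutZ a n x
    · exact pd_one_cutZ a n x
    · exact absurd rfl hi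
  rw [this]; ring

theorem pd_cutR_mul {φ : E3 → ℝ} (hφ : ContDiff ℝ ∞ φ) (n : ℕ) (x : E3) :
    pd 2 (fun y => cutR R n y * φ y) x = cutR R n x * pd 2 φ x := by
  rw [pd_mul (contDiff_cutR R n) hφ, pd_two_cutR]; ring

/-- Horizontal integration by parts needs no cutoff in the axial direction. -/
theorem HasPd.integral_cutR (hR : 0 < R) (ha : 0 < a) (h : HasPd R a i f g) (hi : i ≠ 2)
    {φ : E3 → ℝ} (hφ : IsTest φ) (n : ℕ) :
    ∫ x in cyl R a, (f x * pd i (fun y => cutR R n y * φ y) x + g x * (cutR R n x * φ x)) = 0 := by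
  have hψ : IsTest fun y => cutR R n y * φ y := hφ.smooth_mul (contDiff_cutR R n)
  refine integral_eq_zero_of_cutZ (integrable_pairing h.1 h.2.1 (hψ.pd i) hψ) fun m => ?_
  rw [← h.2.2 _ (hψ.smooth_mul (contDiff_cutZ a m)) (tsupport_cut_subset hR ha φ n m)]
  congr 1
  ext x
  rw [pd_cutZ_mul hψ.1 hi]
  ring

/-- Axial integration by parts needs no cutoff in the horizontal directions. -/
theorem HasPd.integral_cutZ (hR : 0 < R) (ha : 0 < a) (h : HasPd R a 2 f g)
    {φ : E3 → ℝ} (hφ : IsTest φ) (n : ℕ) :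
    ∫ x in cyl R a, (f x * pd 2 (fun y => cutZ a n y * φ y) x + g x * (cutZ a n x * φ x)) = 0 := by
  have hψ : IsTest fun y => cutZ a n y * φ y := hφ.smooth_mul (contDiff_cutZ a n)
  refine integral_eq_zero_of_cutR (integrable_pairing h.1 h.2.1 (hψ.pd 2) hψ) fun m => ?_
  have hs := tsupport_cut_subset hR ha φ m n
  have he : (fun x => cutZ a n x * (cutR R m x * φ x)) =
      fun x => cutR R m x * (cutZ a n x * φ x) := by ext x; ring
  rw [he] at hs
  rw [← h.2.2 _ (hψ.smooth_mul (contDiff_cutR R m)) hs]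
  congr 1
  ext x
  rw [pd_cutR_mul hψ.1]
  ring

theorem VanishesAtEnds.congr (h : VanishesAtEnds R a f g)
    (hf : ∀ᵐ x ∂volume.restrict (cyl R a), f x = f' x)
    (hg : ∀ᵐ x ∂volume.restrict (cyl R a), g x = g' x) : VanishesAtEnds R a f' g' := by
  refine ⟨(memLp_congr_ae hf).1 h.1, (memLp_congr_ae hg).1 h.2.1, fun φ hφ => ?_⟩
  rw [← h.2.2 φ hφ]
  apply integral_congr_ae
  filter_upwards [hf, hg] with x h1 h2
  rw [h1, h2]

theorem VanishesAtEnds.add (h : VanishesAtEnds R a f g) (h' : VanishesAtEnds R a f' g') :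
    VanishesAtEnds R a (fun x => f x + f' x) (fun x => g x + g' x) := by
  refine ⟨h.1.add h'.1, h.2.1.add h'.2.1, fun φ hφ => ?_⟩
  refine integral_eq_zero_of_ae_eq_add (integrable_pairing h.1 h.2.1 (hφ.pd 2) hφ)
      (integrable_pairing h'.1 h'.2.1 (hφ.pd 2) hφ) (h.2.2 φ hφ) (h'.2.2 φ hφ) ?_
  filter_upwards with x
  ring

theorem VanishesAtEnds.const_mul (h : VanishesAtEnds R a f g) (c : ℝ) :
    VanishesAtEnds R a (fun x => c * f x) (fun x => c * g x) := by
  refine ⟨h.1.const_mul c, h.2.1.const_mul c, fun φ hφ => ?_⟩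
  simp only [mul_assoc, ← mul_add]
  rw [integral_const_mul, h.2.2 φ hφ, mul_zero]

theorem VanishesAtEnds.sub (h : VanishesAtEnds R a f g) (h' : VanishesAtEnds R a f' g') :
    VanishesAtEnds R a (fun x => f x - f' x) (fun x => g x - g' x) := by
  simpa [sub_eq_add_neg] using h.add (h'.const_mul (-1))

/-- Horizontal derivatives of a function that vanishes at the ends vanish at the ends. -/
theorem VanishesAtEnds.horizontal_deriv (hR : 0 < R) (ha : 0 < a) (h : VanishesAtEnds R a f g) (hi : i ≠ 2)
    (hf : HasPd R a i f f') (hg : HasPd R a i g g') : VanishesAtEnds R a f' g' := by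
  refine ⟨hf.2.1, hg.2.1, fun φ hφ => ?_⟩
  refine integral_eq_zero_of_cutR (integrable_pairing hf.2.1 hg.2.1 (hφ.pd 2) hφ) fun n => ?_
  have hψ : IsTest fun y => cutR R n y * φ y := hφ.smooth_mul (contDiff_cutR R n)
  have hψ2 : IsTest fun y => cutR R n y * pd 2 φ y :=
    (hφ.pd 2).smooth_mul (contDiff_cutR R n)
  have e1 := hf.integral_cutR hR ha hi (hφ.pd 2) n
  have e2 := hg.integral_cutR hR ha hi hφ n
  -- The axial relation is tested with ∂_i(ηφ), η = `cutR R n`; then `e1` and `e2` move ∂_i onto f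
  -- and g. The lateral cutoff suffices for this because i is horizontal.
  have e3 := h.2.2 _ (hψ.pd i)
  have i1 := integrable_pairing hf.1 hf.2.1 (hψ2.pd i) hψ2
  have i2 := integrable_pairing hg.1 hg.2.1 (hψ.pd i) hψ
  have i3 := integrable_pairing h.1 h.2.1 ((hψ.pd i).pd 2) (hψ.pd i)
  have e4 := integral_add i1 i2
  rw [e1, e2, add_zero] at e4
  refine integral_eq_zero_of_ae_eq_sub (i1.add i2) i3 e4 e3 ?_
  filter_upwards with x
  have hc : pd 2 (fun y => cutR R n y * φ y) = fun y => cutR R n y * pd 2 φ y :=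
    funext fun y => pd_cutR_mul hφ.1 n y
  simp only [Pi.add_apply, pd_comm hψ.1 2 i x, hc]
  ring

end

open scoped Convolution

/-! ### Weak density of smooth functions in `H¹` of the cylinder -/

theorem abs_integral_mul_le {μ : Measure E3} {f g : E3 → ℝ} (hf : MemLp f 2 μ) (hg : MemLp g 2 μ) :
    |∫ x, f x * g x ∂μ| ≤ √(∫ x, f x ^ 2 ∂μ) * √(∫ x, g x ^ 2 ∂μ) := by
  have h := integral_mul_le_Lp_mul_Lq_of_nonneg (μ := μ) (f := fun x => |f x|) (g := fun x => |g x|)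
    (p := 2) (q := 2) ⟨by norm_num, by norm_num, by norm_num⟩ (by filter_upwards with x; positivity)
    (by filter_upwards with x; positivity) (by simpa using hf.norm) (by simpa using hg.norm)
  simp only [Real.rpow_two, sq_abs, ← Real.sqrt_eq_rpow, ← abs_mul] at h
  exact (abs_integral_le_integral_abs).trans h

theorem integrable_sq_of_memLp {μ : Measure E3} {f : E3 → ℝ} (hf : MemLp f 2 μ) :
    Integrable (fun x => f x ^ 2) μ := hf.integrable_sq

/-- Jensen's inequality for the probability density `b.normed`: the variance of f about its mean c
is nonnegative. -/
theorem sq_mollify_le (b : ContDiffBump (0 : E3)) {f : E3 → ℝ} (hf : MemLp f 2 volume) (y : E3) :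
    (b.normed volume ⋆[ContinuousLinearMap.lsmul ℝ ℝ, volume] f) y ^ 2 ≤
      (b.normed volume ⋆[ContinuousLinearMap.lsmul ℝ ℝ, volume] fun x => f x ^ 2) y := by
  have hl : LocallyIntegrable f volume := hf.locallyIntegrable (by norm_num)
  have hl2 : LocallyIntegrable (fun x => f x ^ 2) volume := hf.integrable_sq.locallyIntegrable
  have e1 := (b.hasCompactSupport_normed (μ := volume)).convolutionExists_left
    (ContinuousLinearMap.lsmul ℝ ℝ) b.continuous_normed hl y
  have e2 := (b.hasCompactSupport_normed (μ := volume)).convolutionExists_left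
    (ContinuousLinearMap.lsmul ℝ ℝ) b.continuous_normed hl2 y
  unfold ConvolutionExistsAt at e1 e2
  simp only [ContinuousLinearMap.lsmul_apply, smul_eq_mul] at e1 e2
  simp only [convolution_lsmul, smul_eq_mul]
  set c := ∫ t, b.normed volume t * f (y - t) with hc
  have h0 : 0 ≤ ∫ t, b.normed volume t * (f (y - t) - c) ^ 2 :=
    integral_nonneg fun t => mul_nonneg (b.nonneg_normed t) (sq_nonneg _)
  have h1 : ∫ t, b.normed volume t * (f (y - t) - c) ^ 2 =
      (∫ t, b.normed volume t * f (y - t) ^ 2) - 2 * c * c + c ^ 2 * 1 := by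
    have h2 : ∀ t, b.normed volume t * (f (y - t) - c) ^ 2 =
        (b.normed volume t * f (y - t) ^ 2 - 2 * c * (b.normed volume t * f (y - t))) +
          c ^ 2 * b.normed volume t := fun t => by ring
    simp only [h2]
    have e3 : Integrable (fun t => b.normed volume t * f (y - t) ^ 2 -
        2 * c * (b.normed volume t * f (y - t))) volume := e2.sub (e1.const_mul _)
    rw [integral_add e3 (b.integrable_normed.const_mul _),
      integral_sub e2 (e1.const_mul _), integral_const_mul, integral_const_mul, b.integral_normed]
  nlinarith

theorem integral_sq_mollify_le (b : ContDiffBump (0 : E3)) {f : E3 → ℝ} (hf : MemLp f 2 volume)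
    {l : ℝ} (hl : 1 / 2 ≤ l) :
    MemLp (fun x => (b.normed volume ⋆[ContinuousLinearMap.lsmul ℝ ℝ, volume] f) (l • x)) 2 volume ∧
    ∫ x, (b.normed volume ⋆[ContinuousLinearMap.lsmul ℝ ℝ, volume] f) (l • x) ^ 2 ≤
      8 * ∫ x, f x ^ 2 := by
  have hl0 : l ≠ 0 := by linarith
  have hlf : LocallyIntegrable f volume := hf.locallyIntegrable (by norm_num)
  have hcont : Continuous (b.normed volume ⋆[ContinuousLinearMap.lsmul ℝ ℝ, volume] f) :=
    (b.hasCompactSupport_normed (μ := volume)).continuous_convolution_left _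
      b.continuous_normed hlf
  have hint : Integrable
      (b.normed volume ⋆[ContinuousLinearMap.lsmul ℝ ℝ, volume] fun x => f x ^ 2) volume :=
    (b.integrable_normed).integrable_convolution _ hf.integrable_sq
  have hint' := hint.comp_smul hl0
  have hcont' : Continuous fun x : E3 =>
      (b.normed volume ⋆[ContinuousLinearMap.lsmul ℝ ℝ, volume] f) (l • x) :=
    hcont.comp (continuous_const_smul l)
  have hsq : Integrable (fun x : E3 =>
      (b.normed volume ⋆[ContinuousLinearMap.lsmul ℝ ℝ, volume] f) (l • x) ^ 2) volume := by
    refine hint'.mono' (hcont'.pow 2).aestronglyMeasurable ?_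
    filter_upwards with x
    rw [Real.norm_eq_abs, abs_of_nonneg (sq_nonneg _)]
    exact sq_mollify_le b hf _
  refine ⟨(memLp_two_iff_integrable_sq hcont'.aestronglyMeasurable).2 hsq, ?_⟩
  refine (integral_mono hsq hint' fun x => sq_mollify_le b hf _).trans ?_
  have h1 := Measure.integral_comp_smul volume
    (b.normed volume ⋆[ContinuousLinearMap.lsmul ℝ ℝ, volume] fun x => f x ^ 2) l
  rw [h1, integral_convolution _ b.integrable_normed hf.integrable_sq, b.integral_normed]
  simp only [finrank_euclideanSpace, Fintype.card_fin, ContinuousLinearMap.lsmul_apply,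
    smul_eq_mul, one_mul]
  -- The dilation x ↦ l • x contributes l⁻³ in dimension three, and l⁻³ ≤ 8 for l ≥ 1/2.
  apply mul_le_mul_of_nonneg_right _ (integral_nonneg fun x => sq_nonneg _)
  rw [abs_of_pos (by positivity)]
  rw [inv_le_comm₀ (by positivity) (by norm_num)]
  calc (8 : ℝ)⁻¹ = (1 / 2) ^ 3 := by norm_num
    _ ≤ l ^ 3 := by gcongr

theorem abs_mollify_le (b : ContDiffBump (0 : E3)) {k : E3 → ℝ} {C : ℝ} (hC : ∀ x, |k x| ≤ C)
    (y : E3) : |(b.normed volume ⋆[ContinuousLinearMap.lsmul ℝ ℝ, volume] k) y| ≤ C := by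
  rw [convolution_lsmul, ← Real.norm_eq_abs]
  refine (norm_integral_le_of_norm_le (b.integrable_normed.mul_const C) ?_).trans ?_
  · filter_upwards with t
    rw [norm_smul, Real.norm_eq_abs, abs_of_nonneg (b.nonneg_normed t)]
    exact mul_le_mul_of_nonneg_left (hC _) (b.nonneg_normed t)
  · rw [integral_mul_const, b.integral_normed, one_mul]

theorem tendsto_integral_mollify_of_continuous {b : ℕ → ContDiffBump (0 : E3)} {l : ℕ → ℝ}
    (hb : Tendsto (fun n => (b n).rOut) atTop (𝓝 0)) (hl : Tendsto l atTop (𝓝 1))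
    {k G : E3 → ℝ} (hk : Continuous k) (hks : HasCompactSupport k) (hG : Integrable G volume) :
    Tendsto (fun n => ∫ x, G x *
      ((b n).normed volume ⋆[ContinuousLinearMap.lsmul ℝ ℝ, volume] k) (l n • x)) atTop
      (𝓝 (∫ x, G x * k x)) := by
  obtain ⟨C, hC⟩ := hks.exists_bound_of_continuous hk
  have hlk : LocallyIntegrable k volume := hk.locallyIntegrable
  apply tendsto_integral_of_dominated_convergence (fun x => |G x| * C)
  · intro n
    refine hG.1.mul (Continuous.aestronglyMeasurable ?_)
    exact (((b n).hasCompactSupport_normed (μ := volume)).continuous_convolution_left _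
      (b n).continuous_normed hlk).comp (continuous_const_smul _)
  · exact hG.abs.mul_const C
  · intro n
    filter_upwards with x
    rw [norm_mul]
    exact mul_le_mul_of_nonneg_left (abs_mollify_le (b n) hC _) (norm_nonneg _)
  · filter_upwards with x
    refine Tendsto.const_mul _ ?_
    refine ContDiffBump.convolution_tendsto_right hb
      (Eventually.of_forall fun _ => hk.aestronglyMeasurable) ((hk.tendsto x).comp tendsto_snd) ?_
    simpa using hl.smul_const x

/-- Weak convergence of the dilated mollifications is enough for passing to the limit in pairings.
It holds for continuous compactly supported functions by dominated convergence, and extends to L² by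
density because the operators are uniformly bounded. -/
theorem tendsto_integral_mollify {b : ℕ → ContDiffBump (0 : E3)} {l : ℕ → ℝ}
    (hb : Tendsto (fun n => (b n).rOut) atTop (𝓝 0))
    (hl : Tendsto l atTop (𝓝 1)) (hl2 : ∀ n, 1 / 2 ≤ l n)
    {f G : E3 → ℝ} (hf : MemLp f 2 volume) (hG : MemLp G 2 volume) (hG1 : Integrable G volume) :
    Tendsto (fun n => ∫ x, G x *
      ((b n).normed volume ⋆[ContinuousLinearMap.lsmul ℝ ℝ, volume] f) (l n • x)) atTop
      (𝓝 (∫ x, G x * f x)) := by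
  set N := √(∫ x, G x ^ 2) with hN
  have hN0 : 0 ≤ N := Real.sqrt_nonneg _
  rw [Metric.tendsto_atTop]
  intro ε hε
  -- Replacing f by k costs at most Nδ in the limit and √8·Nδ ≤ 3Nδ in the mollified integral, hence
  -- the factor 4.
  set δ := ε / (2 * (4 * N + 1)) with hδ
  have hδ0 : 0 < δ := by positivity
  obtain ⟨k, hks, hk1, hkc, hkm⟩ := hf.exists_hasCompactSupport_eLpNorm_sub_le (by norm_num)
    (ε := ENNReal.ofReal δ) (by simpa using hδ0)
  have hD : MemLp (f - k) 2 volume := hf.sub hkm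
  have hDn : √(∫ x, (f - k) x ^ 2) ≤ δ := by
    rw [hD.eLpNorm_eq_integral_rpow_norm (by norm_num) (by norm_num)] at hk1
    have := (ENNReal.ofReal_le_ofReal_iff hδ0.le).1 hk1
    simpa [Real.sqrt_eq_rpow] using this
  have hlim := tendsto_integral_mollify_of_continuous hb hl hkc hks hG1
  rw [Metric.tendsto_atTop] at hlim
  obtain ⟨n0, hn0⟩ := hlim (ε / 2) (by positivity)
  refine ⟨n0, fun n hn => ?_⟩
  have h1 := hn0 n hn
  rw [Real.dist_eq] at h1 ⊢
  have hlD : LocallyIntegrable (f - k) volume := hD.locallyIntegrable (by norm_num)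
  have hlk : LocallyIntegrable k volume := hkm.locallyIntegrable (by norm_num)
  obtain ⟨m1, m2⟩ := integral_sq_mollify_le (b n) hD (hl2 n)
  obtain ⟨m3, -⟩ := integral_sq_mollify_le (b n) hkm (hl2 n)
  have hsplit : ∀ y, ((b n).normed volume ⋆[ContinuousLinearMap.lsmul ℝ ℝ, volume] f) y =
      ((b n).normed volume ⋆[ContinuousLinearMap.lsmul ℝ ℝ, volume] (f - k)) y +
      ((b n).normed volume ⋆[ContinuousLinearMap.lsmul ℝ ℝ, volume] k) y := by
    intro y
    have e1 := ((b n).hasCompactSupport_normed (μ := volume)).convolutionExists_left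
      (ContinuousLinearMap.lsmul ℝ ℝ) (b n).continuous_normed hlD
    have e2 := ((b n).hasCompactSupport_normed (μ := volume)).convolutionExists_left
      (ContinuousLinearMap.lsmul ℝ ℝ) (b n).continuous_normed hlk
    rw [← Pi.add_apply, ← e1.distrib_add e2, sub_add_cancel]
  have i1 : Integrable (fun x => G x * ((b n).normed volume
      ⋆[ContinuousLinearMap.lsmul ℝ ℝ, volume] (f - k)) (l n • x)) volume :=
    integrable_mul_of_memLp hG m1
  have i2 : Integrable (fun x => G x * ((b n).normed volume
      ⋆[ContinuousLinearMap.lsmul ℝ ℝ, volume] k) (l n • x)) volume :=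
    integrable_mul_of_memLp hG m3
  have i3 : Integrable (fun x => G x * (f - k) x) volume := integrable_mul_of_memLp hG hD
  have i4 : Integrable (fun x => G x * k x) volume := integrable_mul_of_memLp hG hkm
  have s1 : ∫ x, G x * f x = (∫ x, G x * (f - k) x) + ∫ x, G x * k x := by
    rw [← integral_add i3 i4]
    congr 1
    ext x
    simp only [Pi.sub_apply]
    ring
  have b1 := abs_integral_mul_le hG m1
  have b2 := abs_integral_mul_le hG hD
  have b3 : √(∫ x, ((b n).normed volume ⋆[ContinuousLinearMap.lsmul ℝ ℝ, volume] (f - k))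
      (l n • x) ^ 2) ≤ 3 * δ := by
    apply Real.sqrt_le_iff.2 ⟨by positivity, m2.trans ?_⟩
    have := (Real.sqrt_le_iff.1 hDn).2
    nlinarith [sq_nonneg δ]
  rw [← hN] at b1 b2
  have b4 := b1.trans (mul_le_mul_of_nonneg_left b3 hN0)
  have b5 := b2.trans (mul_le_mul_of_nonneg_left hDn hN0)
  have hδε : 4 * N * δ < ε / 2 := by
    have : (4 * N + 1) * δ = ε / 2 := by rw [hδ]; field_simp
    nlinarith
  simp only [hsplit, mul_add]
  rw [integral_add i1 i2, s1]
  rw [abs_le] at b4 b5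
  rw [abs_lt] at h1 ⊢
  constructor <;> linarith [h1.1, h1.2, b4.1, b4.2, b5.1, b5.2]

section

variable {R a : ℝ} {i : Fin 3} {f g : E3 → ℝ}

theorem memLp_indicator_cyl (hf : MemLp f 2 (volume.restrict (cyl R a))) :
    MemLp ((cyl R a).indicator f) 2 volume :=
  (memLp_indicator_iff_restrict (measurableSet_cyl R a)).2 hf

theorem hasCompactSupport_indicator_cyl (f : E3 → ℝ) :
    HasCompactSupport ((cyl R a).indicator f) := by
  refine HasCompactSupport.intro (isCompact_closedBall (0 : E3) (R + a)) fun x hx => ?_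
  exact indicator_of_notMem (fun h => hx (cyl_subset_closedBall R a h)) _

theorem pd_comp_smul (φ : E3 → ℝ) (i : Fin 3) (l : ℝ) (x : E3) :
    pd i (fun t => φ (l • t)) x = l * pd i φ (l • x) := by
  simp [pd, fderiv_comp_smul]

theorem pd_comp_const_sub (φ : E3 → ℝ) (i : Fin 3) (y x : E3) :
    pd i (fun t => φ (y - t)) x = -pd i φ (y - x) := by
  have h : (fun t => φ (y - t)) = fun t => (fun s => φ (s + y)) ((-1 : ℝ) • t) := by
    ext t
    simp [neg_add_eq_sub]
  rw [h]
  refine (pd_comp_smul (fun s => φ (s + y)) i (-1) x).trans ?_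
  unfold pd
  rw [fderiv_comp_add_right]
  simp [neg_add_eq_sub]

/-- The function t ↦ b(y − t) is supported in the ball of radius `b.rOut` about y. When this ball
lies in the cylinder it is an admissible test function, so the jump of the zero extension is not
seen. -/
theorem pd_mollify (b : ContDiffBump (0 : E3)) (h : HasPd R a i f g) {y : E3}
    (hy : Metric.closedBall y b.rOut ⊆ cyl R a) :
    pd i (b.normed volume ⋆[ContinuousLinearMap.lsmul ℝ ℝ, volume] (cyl R a).indicator f) y =
      (b.normed volume ⋆[ContinuousLinearMap.lsmul ℝ ℝ, volume] (cyl R a).indicator g) y := by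
  have hl : LocallyIntegrable ((cyl R a).indicator f) volume :=
    (memLp_indicator_cyl h.1).locallyIntegrable (by norm_num)
  have hbs := b.hasCompactSupport_normed (μ := (volume : Measure E3))
  have hbc : ContDiff ℝ ∞ (b.normed (volume : Measure E3)) := b.contDiff_normed
  have hD := hbs.hasFDerivAt_convolution_left (ContinuousLinearMap.lsmul ℝ ℝ)
    (hbc.of_le (by exact_mod_cast le_top)) hl y
  have hex := (hbs.fderiv (𝕜 := ℝ)).convolutionExists_left
    ((ContinuousLinearMap.lsmul ℝ ℝ).precompL E3)
    ((hbc.fderiv_right (m := ∞) le_rfl).continuous) hl y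
  have hψ : IsTest fun t => b.normed volume (y - t) := by
    refine ⟨hbc.comp (contDiff_const.sub contDiff_id), ?_⟩
    exact hbs.comp_homeomorph (Homeomorph.subLeft y)
  have hψs : tsupport (fun t => b.normed volume (y - t)) ⊆ cyl R a := by
    refine (closure_minimal ?_ Metric.isClosed_closedBall).trans hy
    intro t ht
    have : y - t ∈ Function.support (b.normed volume) := ht
    rw [b.support_normed_eq, mem_ball_zero_iff] at this
    rw [Metric.mem_closedBall, dist_comm, dist_eq_norm]
    exact this.le
  have key := h.2.2 _ hψ hψs
  rw [integral_add (integrable_mul_of_memLp h.1 ((hψ.pd i).memLp R a))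
    (integrable_mul_of_memLp h.2.1 (hψ.memLp R a))] at key
  have e1 : pd i (b.normed volume ⋆[ContinuousLinearMap.lsmul ℝ ℝ, volume]
      (cyl R a).indicator f) y = ∫ t in cyl R a, f t * pd i (b.normed volume) (y - t) := by
    rw [pd, hD.fderiv, convolution_def, ContinuousLinearMap.integral_apply hex,
      ← integral_sub_left_eq_self _ volume y, ← integral_indicator (measurableSet_cyl R a)]
    congr 1
    ext t
    simp only [sub_sub_cancel, ContinuousLinearMap.precompL_apply,
      ContinuousLinearMap.lsmul_apply, smul_eq_mul, pd]
    by_cases ht : t ∈ cyl R a <;> simp [ht, mul_comm]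
  have e2 : (b.normed volume ⋆[ContinuousLinearMap.lsmul ℝ ℝ, volume]
      (cyl R a).indicator g) y = ∫ t in cyl R a, g t * b.normed volume (y - t) := by
    rw [convolution_lsmul_swap, ← integral_indicator (measurableSet_cyl R a)]
    congr 1
    ext t
    by_cases ht : t ∈ cyl R a <;> simp [ht, mul_comm]
  simp only [pd_comp_const_sub, mul_neg, integral_neg] at key
  rw [e1, e2]
  linarith

/-- The cylinder is star-shaped about the origin: its contraction by l stays at distance at least (1
− l) min(R, a) from the boundary. -/
theorem closedBall_smul_subset_cyl (hR : 0 < R) (ha : 0 < a) {l ε : ℝ} (hl0 : 0 ≤ l) (hl1 : l < 1)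
    (hε : ε ≤ (1 - l) * min R a / 2) {x : E3} (hx : x ∈ cyl R a) :
    Metric.closedBall (l • x) ε ⊆ cyl R a := by
  intro s hs
  rw [Metric.mem_closedBall, dist_eq_norm] at hs
  obtain ⟨h1, h2⟩ := hx
  have hm : 0 < min R a := lt_min hR ha
  have hd : s = l • x + (s - l • x) := by abel
  set d := s - l • x with hdd
  have hdz : |d 2| ≤ ε := (PiLp.norm_apply_le d 2).trans hs
  have hdr : cylR d ≤ ε := by
    refine le_trans ?_ hs
    apply abs_le_of_sq_le_sq' _ (norm_nonneg _) |>.2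
    rw [norm_sq_eq]
    nlinarith [sq_nonneg (d 2)]
  have hmul : (1 - l) * min R a ≤ (1 - l) * R :=
    mul_le_mul_of_nonneg_left (min_le_left _ _) (by linarith)
  have hmul' : (1 - l) * min R a ≤ (1 - l) * a :=
    mul_le_mul_of_nonneg_left (min_le_right _ _) (by linarith)
  have hpos : 0 < (1 - l) * min R a := mul_pos (by linarith) hm
  have hs0 : s 0 = l * x 0 + d 0 := by rw [hd]; simp
  have hs1 : s 1 = l * x 1 + d 1 := by rw [hd]; simp
  have hs2 : s 2 = l * x 2 + d 2 := by rw [hd]; simp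
  have hx0 := cylR_nonneg x
  have hd0 := cylR_nonneg d
  constructor
  · have : cylR s ≤ l * cylR x + cylR d := by
      apply Real.sqrt_le_iff.2 ⟨by positivity, ?_⟩
      have hxs := cylR_sq x
      have hds := cylR_sq d
      have hcs : x 0 * d 0 + x 1 * d 1 ≤ cylR x * cylR d := by
        apply abs_le_of_sq_le_sq' _ (by positivity) |>.2
        rw [mul_pow, hxs, hds]
        nlinarith [sq_nonneg (x 0 * d 1 - x 1 * d 0)]
      rw [hs0, hs1]
      have hxl : l ^ 2 * cylR x ^ 2 = l ^ 2 * (x 0 ^ 2 + x 1 ^ 2) := by rw [hxs]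
      nlinarith [mul_le_mul_of_nonneg_left hcs hl0]
    nlinarith
  · rw [hs2]
    have := abs_add_le (l * x 2) (d 2)
    rw [abs_mul, abs_of_nonneg hl0] at this
    nlinarith

/-- A pairing with a function and its gradient that vanishes on smooth functions vanishes on
the whole of `H¹` of the cylinder. -/
theorem pairing_eq_zero_of_test (hR : 0 < R) (ha : 0 < a) {f' : Fin 3 → E3 → ℝ}
    (hf : ∀ i, HasPd R a i f (f' i)) {F : E3 → ℝ} {G : Fin 3 → E3 → ℝ}
    (hF : MemLp F 2 (volume.restrict (cyl R a)))
    (hG : ∀ i, MemLp (G i) 2 (volume.restrict (cyl R a)))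
    (H : ∀ φ, IsTest φ → ∫ x in cyl R a, (F x * φ x + ∑ i, G i x * pd i φ x) = 0) :
    ∫ x in cyl R a, (F x * f x + ∑ i, G i x * f' i x) = 0 := by
  set Ω := cyl R a with hΩ
  have hm : 0 < min R a := lt_min hR ha
  -- The approximants are (b_n ∗ f)(l_n x), with f extended by zero. Contracting the argument before
  -- mollifying makes them smooth up to the boundary, and the mollification radius is half the
  -- available distance.
  set l : ℕ → ℝ := fun n => 1 - 1 / ((n : ℝ) + 2) with hl
  have hn2 : ∀ n : ℕ, (0 : ℝ) < n + 2 := fun n => by positivity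
  have hl2 : ∀ n, 1 / 2 ≤ l n := by
    intro n
    have : 1 / ((n : ℝ) + 2) ≤ 1 / 2 := one_div_le_one_div_of_le (by norm_num) (by linarith [n.cast_nonneg (α := ℝ)])
    simp only [hl]; linarith
  have hl1 : ∀ n, l n < 1 := by
    intro n
    have : 0 < 1 / ((n : ℝ) + 2) := by positivity
    simp only [hl]; linarith
  have hlt : Tendsto l atTop (𝓝 1) := by
    have h1 : Tendsto (fun n : ℕ => 1 / ((n : ℝ) + 2)) atTop (𝓝 0) :=
      Tendsto.div_atTop tendsto_const_nhds
        (tendsto_atTop_add_const_right _ _ tendsto_natCast_atTop_atTop)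
    simpa [hl] using h1.const_sub 1
  have hε0 : ∀ n, 0 < (1 - l n) * min R a / 2 := fun n => by
    have := hl1 n
    have : 0 < 1 - l n := by linarith
    positivity
  set b : ℕ → ContDiffBump (0 : E3) := fun n =>
    { rIn := (1 - l n) * min R a / 2 / 2
      rOut := (1 - l n) * min R a / 2
      rIn_pos := half_pos (hε0 n)
      rIn_lt_rOut := half_lt_self (hε0 n) } with hbdef
  have hb : Tendsto (fun n => (b n).rOut) atTop (𝓝 0) := by
    have := ((hlt.const_sub 1).mul_const (min R a)).div_const 2
    simpa [hbdef] using this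
  have hlim : ∀ {p G : E3 → ℝ}, MemLp p 2 (volume.restrict Ω) → MemLp G 2 (volume.restrict Ω) →
      Tendsto (fun n => ∫ x in Ω, G x * ((b n).normed volume
        ⋆[ContinuousLinearMap.lsmul ℝ ℝ, volume] Ω.indicator p) (l n • x)) atTop
        (𝓝 (∫ x in Ω, G x * p x)) := by
    intro p G hp hG
    have hG1 : Integrable (Ω.indicator G) volume :=
      (integrable_indicator_iff (measurableSet_cyl R a)).2 (hG.integrable (by norm_num))
    have := tendsto_integral_mollify hb hlt hl2 (memLp_indicator_cyl hp)
      (memLp_indicator_cyl hG) hG1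
    refine (this.congr fun n => ?_).trans_eq ?_
    · rw [← integral_indicator (measurableSet_cyl R a)]
      congr 1
      ext x
      by_cases hx : x ∈ cyl R a <;> simp [hx, hΩ]
    · rw [← integral_indicator (measurableSet_cyl R a)]
      congr 2
      ext x
      by_cases hx : x ∈ cyl R a <;> simp [hx]
  have ht : ∀ n, IsTest fun x => ((b n).normed volume
        ⋆[ContinuousLinearMap.lsmul ℝ ℝ, volume] Ω.indicator f) (l n • x) := by
    intro n
    have hbs := (b n).hasCompactSupport_normed (μ := (volume : Measure E3))
    have hl' : LocallyIntegrable (Ω.indicator f) volume :=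
      (memLp_indicator_cyl (hf 0).1).locallyIntegrable (by norm_num)
    constructor
    · exact (hbs.contDiff_convolution_left _ (b n).contDiff_normed hl').comp
        (contDiff_const_smul _)
    · exact (HasCompactSupport.convolution _ hbs (hasCompactSupport_indicator_cyl f)).comp_smul
        (by linarith [hl2 n])
  have hpd : ∀ n i, ∀ x ∈ Ω, pd i (fun x => ((b n).normed volume
        ⋆[ContinuousLinearMap.lsmul ℝ ℝ, volume] Ω.indicator f) (l n • x)) x =
      l n * ((b n).normed volume
        ⋆[ContinuousLinearMap.lsmul ℝ ℝ, volume] Ω.indicator (f' i)) (l n • x) := by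
    intro n i x hx
    rw [pd_comp_smul, pd_mollify (b n) (hf i)]
    exact closedBall_smul_subset_cyl hR ha (by linarith [hl2 n]) (hl1 n) le_rfl hx
  have hmol : ∀ n {p : E3 → ℝ}, MemLp p 2 (volume.restrict Ω) → MemLp (fun x => ((b n).normed volume
        ⋆[ContinuousLinearMap.lsmul ℝ ℝ, volume] Ω.indicator p) (l n • x)) 2
        (volume.restrict Ω) := fun n p hp =>
    (integral_sq_mollify_le (b n) (memLp_indicator_cyl hp) (hl2 n)).1.restrict _
  -- The chain rule puts a factor l_n in front of each gradient term, and l_n tends to 1.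
  have hlim2 := (hlim (hf 0).1 hF).add
    (tendsto_finsetSum Finset.univ fun i _ => hlt.mul (hlim (hf i).2.1 (hG i)))
  have hzero : ∀ n, (∫ x in Ω, F x * ((b n).normed volume
        ⋆[ContinuousLinearMap.lsmul ℝ ℝ, volume] Ω.indicator f) (l n • x)) +
      ∑ i, l n * ∫ x in Ω, G i x * ((b n).normed volume
        ⋆[ContinuousLinearMap.lsmul ℝ ℝ, volume] Ω.indicator (f' i)) (l n • x) = 0 := by
    intro n
    rw [← H _ (ht n), integral_add (integrable_mul_of_memLp hF (hmol n (hf 0).1))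
      (integrable_finsetSum _ fun i _ => integrable_mul_of_memLp (hG i) (((ht n).pd i).memLp R a)),
      integral_finsetSum _ fun i _ => integrable_mul_of_memLp (hG i) (((ht n).pd i).memLp R a)]
    congr 1
    refine Finset.sum_congr rfl fun i _ => ?_
    rw [← integral_const_mul]
    refine setIntegral_congr_fun (measurableSet_cyl R a) fun x hx => ?_
    simp only [hpd n i x hx]
    ring
  simp only [hzero, one_mul] at hlim2
  rw [integral_add (integrable_mul_of_memLp hF (hf 0).1)
      (integrable_finsetSum _ fun i _ => integrable_mul_of_memLp (hG i) (hf i).2.1),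
      integral_finsetSum _ fun i _ => integrable_mul_of_memLp (hG i) (hf i).2.1]
  exact (tendsto_nhds_unique hlim2 tendsto_const_nhds)

end

/-! ### Axial Poincaré inequality and the horizontal div-curl inequality -/

section

variable {R a : ℝ} {f : E3 → ℝ}

theorem pairing_eq_zero (hR : 0 < R) (ha : 0 < a) {f' : Fin 3 → E3 → ℝ}
    (hf : ∀ i, HasPd R a i f (f' i)) {F G₀ G₁ G₂ : E3 → ℝ}
    (hF : MemLp F 2 (volume.restrict (cyl R a))) (h0 : MemLp G₀ 2 (volume.restrict (cyl R a)))
    (h1 : MemLp G₁ 2 (volume.restrict (cyl R a))) (h2 : MemLp G₂ 2 (volume.restrict (cyl R a)))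
    (H : ∀ φ, IsTest φ →
      ∫ x in cyl R a, (F x * φ x + (G₀ x * pd 0 φ x + G₁ x * pd 1 φ x + G₂ x * pd 2 φ x)) = 0) :
    ∫ x in cyl R a, (F x * f x + (G₀ x * f' 0 x + G₁ x * f' 1 x + G₂ x * f' 2 x)) = 0 := by
  have := pairing_eq_zero_of_test hR ha hf (F := F) (G := ![G₀, G₁, G₂]) hF
    (by intro i; fin_cases i <;> assumption)
    (by intro φ hφ; simpa [Fin.sum_univ_three] using H φ hφ)
  simpa [Fin.sum_univ_three] using this

theorem memLp_continuous_mul (hf : MemLp f 2 (volume.restrict (cyl R a))) {m : E3 → ℝ}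
    (hm : Continuous m) : MemLp (fun x => m x * f x) 2 (volume.restrict (cyl R a)) := by
  obtain ⟨C, hC⟩ := (isCompact_closedBall (0 : E3) (R + a)).exists_bound_of_continuousOn
    hm.continuousOn
  refine memLp_bdd_mul hf hm.aestronglyMeasurable (C := C) ?_
  filter_upwards [ae_mem_cyl R a] with x hx
  exact hC x (cyl_subset_closedBall R a hx)

theorem memLp_zero : MemLp (fun _ : E3 => (0 : ℝ)) 2 (volume.restrict (cyl R a)) := by simp

/-- The Poincaré inequality in the axial direction. -/
theorem VanishesAtEnds.integral_sq_le (hR : 0 < R) (ha : 0 < a) {f' : Fin 3 → E3 → ℝ}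
    (h : VanishesAtEnds R a f (f' 2)) (hf : ∀ i, HasPd R a i f (f' i)) :
    ∫ x in cyl R a, f x ^ 2 ≤ 4 * a ^ 2 * ∫ x in cyl R a, f' 2 x ^ 2 := by
  -- This is the integral of ∂_z(z f²), which vanishes because f does at the ends; one factor f
  -- plays the role of the test function.
  have key := pairing_eq_zero hR ha hf (F := fun x => f x + x 2 * f' 2 x) (G₀ := fun _ => 0)
    (G₁ := fun _ => 0) (G₂ := fun x => x 2 * f x) (h.1.add (MemLp.coord_mul h.2.1 2)) memLp_zero
    memLp_zero (MemLp.coord_mul h.1 2) ?_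
  · have i1 := integrable_sq_of_memLp h.1
    have i2 := integrable_sq_of_memLp h.2.1
    have i3 := integrable_mul_of_memLp (h.1.add (MemLp.coord_mul h.2.1 2)) h.1
    have i4 := integrable_mul_of_memLp (MemLp.coord_mul h.1 2) h.2.1
    have i5 : Integrable (fun x => (f x + x 2 * f' 2 x) * f x +
        (0 * f' 0 x + 0 * f' 1 x + x 2 * f x * f' 2 x)) (volume.restrict (cyl R a)) := by
      exact (i3.add i4).congr (ae_of_all _ fun x => by simp only [Pi.add_apply]; ring)
    have hle : ∫ x in cyl R a, f x ^ 2 ≤ ∫ x in cyl R a, (2 * ((f x + x 2 * f' 2 x) * f x +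
        (0 * f' 0 x + 0 * f' 1 x + x 2 * f x * f' 2 x)) + 4 * a ^ 2 * f' 2 x ^ 2) := by
      apply integral_mono_ae i1 ((i5.const_mul 2).add (i2.const_mul _))
      filter_upwards [ae_mem_cyl R a] with x hx
      have hz := (mem_cyl_sq hx).2
      simp only [Pi.add_apply]
      -- The difference of the two sides is (f + 2z ∂_z f)² + 4(a² − z²)(∂_z f)².
      nlinarith [sq_nonneg (f x + 2 * x 2 * f' 2 x),
        mul_nonneg hz.le (sq_nonneg (f' 2 x))]
    rw [integral_add (i5.const_mul 2) (i2.const_mul _), integral_const_mul, key,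
      integral_const_mul] at hle
    linarith
  · intro φ hφ
    refine Eq.trans ?_ (h.2.2 _ (hφ.smooth_mul (contDiff_coord 2)))
    congr 1
    ext x
    rw [pd_mul (contDiff_coord 2) hφ.1, pd_coord]
    simp
    ring

/-- The cutoff is a nondecreasing function of −r², so its horizontal gradient points towards the
axis. The sign of κ replaces the sign of the lateral boundary term. -/
theorem pd_cutR_eq (R : ℝ) (n : ℕ) (x : E3) :
    ∃ κ : ℝ, 0 ≤ κ ∧ pd 0 (cutR R n) x = -κ * x 0 ∧ pd 1 (cutR R n) x = -κ * x 1 := by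
  set s : ℝ := n * (R ^ 2 - (x 0 ^ 2 + x 1 ^ 2)) - 1 with hs
  have hσ : HasDerivAt Real.smoothTransition (deriv Real.smoothTransition s) s :=
    ((Real.smoothTransition.contDiff (n := 1)).differentiable (by simp) s).hasDerivAt
  have hp : ∀ j : Fin 3, HasFDerivAt (fun y : E3 => y j)
      (EuclideanSpace.proj (𝕜 := ℝ) j : E3 →L[ℝ] ℝ) x := fun j =>
    (EuclideanSpace.proj (𝕜 := ℝ) j : E3 →L[ℝ] ℝ).hasFDerivAt
  have hq := (((((hp 0).pow 2).add ((hp 1).pow 2)).const_sub (R ^ 2)).const_mul (n : ℝ)).sub_const 1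
  have hc := HasDerivAt.comp_hasFDerivAt x (h₂ := Real.smoothTransition) (by exact hσ) hq
  have hc' : fderiv ℝ (cutR R n) x = _ := hc.fderiv
  refine ⟨deriv Real.smoothTransition s * n * 2, ?_, ?_, ?_⟩
  · have := Real.smoothTransition.monotone.deriv_nonneg (x := s)
    positivity
  · simp only [pd, hc']
    simp
    ring
  · simp only [pd, hc']
    simp
    ring

/-- The null Lagrangian of a pair that turns with nonnegative speed along the circles around the
axis has a nonnegative integral. -/
theorem integral_det_nonneg (hR : 0 < R) (ha : 0 < a) {α β : E3 → ℝ} {A B : Fin 3 → E3 → ℝ}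
    (hα : ∀ i, HasPd R a i α (A i)) (hβ : ∀ i, HasPd R a i β (B i)) {m : ℝ} (hm : 0 ≤ m)
    (hA : ∀ᵐ x ∂volume.restrict (cyl R a), x 0 * A 1 x - x 1 * A 0 x = -m * β x) :
    0 ≤ ∫ x in cyl R a, (A 0 x * B 1 x - A 1 x * B 0 x) := by
  have iD : Integrable (fun x => A 0 x * B 1 x - A 1 x * B 0 x) (volume.restrict (cyl R a)) :=
    (integrable_mul_of_memLp (hα 0).2.1 (hβ 1).2.1).sub
      (integrable_mul_of_memLp (hα 1).2.1 (hβ 0).2.1)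
  have hlim := tendsto_integral_mul_of_le_one (c := cutR R) (c' := fun _ => 1) iD
    (fun n => (contDiff_cutR R n).continuous.aestronglyMeasurable) (abs_cutR_le R)
    ((ae_mem_cyl R a).mono fun x hx => tendsto_cutR hx)
  simp only [one_mul] at hlim
  refine ge_of_tendsto' hlim fun n => ?_
  have hη := contDiff_cutR R n
  have mη : ∀ {p : E3 → ℝ}, MemLp p 2 (volume.restrict (cyl R a)) →
      MemLp (fun x => cutR R n x * p x) 2 (volume.restrict (cyl R a)) := fun hp =>
    memLp_continuous_mul hp hη.continuous
  have mη' : ∀ (i : Fin 3) {p : E3 → ℝ}, MemLp p 2 (volume.restrict (cyl R a)) →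
      MemLp (fun x => pd i (cutR R n) x * p x) 2 (volume.restrict (cyl R a)) := fun i _ hp =>
    memLp_continuous_mul hp (contDiff_pd hη i).continuous
  have m0 : MemLp (fun x => cutR R n x * B 1 x + pd 1 (cutR R n) x * β x) 2
      (volume.restrict (cyl R a)) := (mη (hβ 1).2.1).add (mη' 1 (hβ 1).1)
  have m1 : MemLp (fun x => -(cutR R n x * B 0 x + pd 0 (cutR R n) x * β x)) 2
      (volume.restrict (cyl R a)) := ((mη (hβ 0).2.1).add (mη' 0 (hβ 1).1)).neg
  -- With η = `cutR R n`, the rotated gradient (∂₁(ηβ), −∂₀(ηβ), 0) is divergence-free and has no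
  -- flux through the boundary, hence it is orthogonal to ∇α.
  have key := pairing_eq_zero hR ha hα (F := fun _ => 0)
    (G₀ := fun x => cutR R n x * B 1 x + pd 1 (cutR R n) x * β x)
    (G₁ := fun x => -(cutR R n x * B 0 x + pd 0 (cutR R n) x * β x))
    (G₂ := fun _ => 0) memLp_zero m0 m1 memLp_zero ?_
  · have i1 : Integrable (fun x => cutR R n x * (A 0 x * B 1 x - A 1 x * B 0 x))
        (volume.restrict (cyl R a)) := by
      have := (integrable_mul_of_memLp (mη (hα 0).2.1) (hβ 1).2.1).sub
        (integrable_mul_of_memLp (mη (hα 1).2.1) (hβ 0).2.1)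
      refine this.congr ?_
      filter_upwards with x
      simp only [Pi.sub_apply]
      ring
    have i2 : Integrable (fun x => (0 : ℝ) * α x +
        ((cutR R n x * B 1 x + pd 1 (cutR R n) x * β x) * A 0 x +
        -(cutR R n x * B 0 x + pd 0 (cutR R n) x * β x) * A 1 x + 0 * A 2 x))
        (volume.restrict (cyl R a)) := by
      have := (integrable_mul_of_memLp m0 (hα 0).2.1).add (integrable_mul_of_memLp m1 (hα 1).2.1)
      exact this.congr (ae_of_all _ fun x => by simp only [Pi.add_apply]; ring)
    have hs := integral_sub i1 i2
    rw [key, sub_zero] at hs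
    rw [← hs]
    apply integral_nonneg_of_ae
    filter_upwards [hA] with x hx
    -- The terms containing ∇η combine into κβ times the angular derivative of α with a minus sign,
    -- that is κmβ² ≥ 0.
    obtain ⟨κ, hκ, e0, e1⟩ := pd_cutR_eq R n x
    have : 0 ≤ κ * (m * β x ^ 2) := by positivity
    simp only [e0, e1, Pi.zero_apply]
    have h2 : κ * β x * (x 0 * A 1 x - x 1 * A 0 x) = κ * β x * (-m * β x) := by rw [hx]
    nlinarith
  · intro φ hφ
    have e0 := (hβ 1).integral_cutR hR ha (by decide) (hφ.pd 0) n
    have e1 := (hβ 0).integral_cutR hR ha (by decide) (hφ.pd 1) n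
    have t0 := (hφ.pd 0).smooth_mul hη
    have t1 := (hφ.pd 1).smooth_mul hη
    refine integral_eq_zero_of_ae_eq_sub
      (integrable_pairing (hβ 1).1 (hβ 1).2.1 (t0.pd 1) t0)
      (integrable_pairing (hβ 0).1 (hβ 0).2.1 (t1.pd 0) t1) e0 e1 ?_
    filter_upwards with x
    rw [pd_mul hη (contDiff_pd hφ.1 0), pd_mul hη (contDiff_pd hφ.1 1), pd_comm hφ.1 1 0]
    ring

/-- Pointwise, (divergence)² + (curl)² equals the sum of the four squares plus twice the Jacobian
determinant, whose integral is nonnegative. -/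
theorem integral_horizontal_gradient_le (hR : 0 < R) (ha : 0 < a) {α β : E3 → ℝ}
    {A B : Fin 3 → E3 → ℝ} (hα : ∀ i, HasPd R a i α (A i)) (hβ : ∀ i, HasPd R a i β (B i))
    {m : ℝ} (hm : 0 ≤ m)
    (hA : ∀ᵐ x ∂volume.restrict (cyl R a), x 0 * A 1 x - x 1 * A 0 x = -m * β x) :
    ∫ x in cyl R a, (A 0 x ^ 2 + A 1 x ^ 2 + B 0 x ^ 2 + B 1 x ^ 2) ≤
      ∫ x in cyl R a, ((A 0 x + B 1 x) ^ 2 + (B 0 x - A 1 x) ^ 2) := by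
  have h := integral_det_nonneg hR ha hα hβ hm hA
  have iD : Integrable (fun x => A 0 x * B 1 x - A 1 x * B 0 x) (volume.restrict (cyl R a)) :=
    (integrable_mul_of_memLp (hα 0).2.1 (hβ 1).2.1).sub
      (integrable_mul_of_memLp (hα 1).2.1 (hβ 0).2.1)
  have iS : Integrable (fun x => A 0 x ^ 2 + A 1 x ^ 2 + B 0 x ^ 2 + B 1 x ^ 2)
      (volume.restrict (cyl R a)) :=
    (((integrable_sq_of_memLp (hα 0).2.1).add (integrable_sq_of_memLp (hα 1).2.1)).add
      (integrable_sq_of_memLp (hβ 0).2.1)).add (integrable_sq_of_memLp (hβ 1).2.1)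
  have e : ∫ x in cyl R a, ((A 0 x + B 1 x) ^ 2 + (B 0 x - A 1 x) ^ 2) =
      (∫ x in cyl R a, (A 0 x ^ 2 + A 1 x ^ 2 + B 0 x ^ 2 + B 1 x ^ 2)) +
        2 * ∫ x in cyl R a, (A 0 x * B 1 x - A 1 x * B 0 x) := by
    rw [← integral_const_mul, ← integral_add iS (iD.const_mul 2)]
    congr 1
    ext x
    ring
  rw [e]
  linarith

end

/-- An axially symmetric, swirl-free, solenoidal field in `H²` that is tangential on the boundary
of the cylinder, with its Jacobian and its Hessian. -/
structure MeridionalField (R a : ℝ) (w : Fin 3 → E3 → ℝ) (J : Fin 3 → Fin 3 → E3 → ℝ)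
    (H : Fin 3 → Fin 3 → Fin 3 → E3 → ℝ) : Prop where
  jac : ∀ i j, HasPd R a j (w i) (J i j)
  hess : ∀ i j k, HasPd R a k (J i j) (H i j k)
  swirl_free : ∀ᵐ x ∂volume.restrict (cyl R a), x 0 * w 1 x = x 1 * w 0 x
  axial_sym : ∀ᵐ x ∂volume.restrict (cyl R a), x 0 * J 2 1 x = x 1 * J 2 0 x
  radial_sym : ∀ᵐ x ∂volume.restrict (cyl R a),
    x 0 * (w 1 x + x 0 * J 0 1 x + x 1 * J 1 1 x) = x 1 * (w 0 x + x 0 * J 0 0 x + x 1 * J 1 0 x)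
  div_free : ∀ᵐ x ∂volume.restrict (cyl R a), J 0 0 x + J 1 1 x + J 2 2 x = 0
  tangential : ∀ φ, IsTest φ →
    ∫ x in cyl R a, (w 0 x * pd 0 φ x + w 1 x * pd 1 φ x + w 2 x * pd 2 φ x) = 0

theorem ae_coord_ne_zero (i : Fin 3) : ∀ᵐ x : E3, x i ≠ 0 := by
  have h : (LinearMap.ker (EuclideanSpace.proj (𝕜 := ℝ) i : E3 →L[ℝ] ℝ).toLinearMap) ≠ ⊤ := by
    intro h
    have : EuclideanSpace.single i (1 : ℝ) ∈
        LinearMap.ker (EuclideanSpace.proj (𝕜 := ℝ) i : E3 →L[ℝ] ℝ).toLinearMap := by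
      rw [h]; trivial
    simp at this
  have h0 := Measure.addHaar_submodule (volume : Measure E3) _ h
  rw [ae_iff]
  convert! h0 using 2
  ext x
  simp

/-- The axial component of a solenoidal field that is tangential on the boundary vanishes at the
top and at the bottom. -/
theorem vanishesAtEnds_of_tangential {R a : ℝ} (hR : 0 < R) (ha : 0 < a) {w : Fin 3 → E3 → ℝ}
    {J : Fin 3 → Fin 3 → E3 → ℝ} (jac : ∀ i j, HasPd R a j (w i) (J i j))
    (div_free : ∀ᵐ x ∂volume.restrict (cyl R a), J 0 0 x + J 1 1 x + J 2 2 x = 0)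
    (tangential : ∀ φ, IsTest φ →
      ∫ x in cyl R a, (w 0 x * pd 0 φ x + w 1 x * pd 1 φ x + w 2 x * pd 2 φ x) = 0) :
    VanishesAtEnds R a (w 2) (J 2 2) := by
  refine ⟨(jac 2 2).1, (jac 2 2).2.1, fun φ hφ => ?_⟩
  refine integral_eq_zero_of_cutR
    (integrable_pairing (jac 2 2).1 (jac 2 2).2.1 (hφ.pd 2) hφ) fun n => ?_
  have hψ : IsTest fun y => cutR R n y * φ y := hφ.smooth_mul (contDiff_cutR R n)
  have e0 := (jac 0 0).integral_cutR hR ha (by decide) hφ n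
  have e1 := (jac 1 1).integral_cutR hR ha (by decide) hφ n
  have e2 := tangential _ hψ
  have i0 := integrable_pairing (jac 0 0).1 (jac 0 0).2.1 (hψ.pd 0) hψ
  have i1 := integrable_pairing (jac 1 1).1 (jac 1 1).2.1 (hψ.pd 1) hψ
  have i2 := (integrable_pairing (jac 0 0).1 (jac 1 1).1 (hψ.pd 0) (hψ.pd 1)).add
    (integrable_mul_of_memLp (jac 2 2).1 ((hψ.pd 2).memLp R a))
  have e3 := integral_add i0 i1
  rw [e0, e1, add_zero] at e3
  -- From the tangency relation the horizontal integrations by parts are subtracted; the remaining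
  -- −(∂₀w₀ + ∂₁w₁) is ∂_z w_z.
  refine integral_eq_zero_of_ae_eq_sub i2 (i0.add i1) e2 e3 ?_
  filter_upwards [div_free] with x hx
  simp only [Pi.add_apply]
  rw [pd_cutR_mul hφ.1 n x]
  linear_combination cutR R n x * φ x * hx

/-! ### Pointwise symmetries and the first-order estimate -/

namespace MeridionalField

variable {R a : ℝ} {w : Fin 3 → E3 → ℝ} {J : Fin 3 → Fin 3 → E3 → ℝ}
  {H : Fin 3 → Fin 3 → Fin 3 → E3 → ℝ} {g : E3 → ℝ} {g' : Fin 3 → E3 → ℝ}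

theorem hess_symm (h : MeridionalField R a w J H) (i j k : Fin 3) :
    ∀ᵐ x ∂volume.restrict (cyl R a), H i j k x = H i k j x :=
  ((h.jac i j).comm (h.jac i k) (h.hess i j k)).unique (h.hess i k j)

theorem swirl_free_deriv (h : MeridionalField R a w J H) :
    ∀ᵐ x ∂volume.restrict (cyl R a), w 1 x + x 0 * J 1 0 x = x 1 * J 0 0 x ∧
      x 0 * J 1 1 x = w 0 x + x 1 * J 0 1 x := by
  have e0 := ((h.jac 1 0).coord_mul 0).unique_of_ae_eq ((h.jac 0 0).coord_mul 1) h.swirl_free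
  have e1 := ((h.jac 1 1).coord_mul 0).unique_of_ae_eq ((h.jac 0 1).coord_mul 1) h.swirl_free
  filter_upwards [e0, e1] with x h0 h1
  simp at h0 h1
  constructor <;> linarith

/-- The vertical vorticity involves only the swirl and the angular derivative of the radial
component, and both vanish. After multiplication by r² this is a linear combination of the
derivatives of x₀w₁ = x₁w₀ and of `radial_sym`; division by r² is harmless off a null set. -/
theorem curl_free (h : MeridionalField R a w J H) :
    ∀ᵐ x ∂volume.restrict (cyl R a), J 1 0 x = J 0 1 x := by
  filter_upwards [h.swirl_free_deriv, h.radial_sym, ae_restrict_of_ae (ae_coord_ne_zero 0)]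
    with x ⟨h1, h2⟩ h3 h4
  have hr : 0 < x 0 ^ 2 + x 1 ^ 2 := by positivity
  have : (x 0 ^ 2 + x 1 ^ 2) * (J 1 0 x - J 0 1 x) = 0 := by
    linear_combination x 0 * h1 + x 1 * h2 - h3
  rcases mul_eq_zero.1 this with h | h
  · exact absurd h hr.ne'
  · linarith

/-- The angular derivatives of the horizontal components. -/
theorem angular (h : MeridionalField R a w J H) :
    ∀ᵐ x ∂volume.restrict (cyl R a), x 0 * J 0 1 x - x 1 * J 0 0 x = -w 1 x ∧
      x 0 * J 1 1 x - x 1 * J 1 0 x = w 0 x := by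
  filter_upwards [h.swirl_free_deriv, h.curl_free] with x ⟨h1, h2⟩ h3
  constructor
  · rw [← h3]; linarith
  · rw [h3]; linarith

theorem curl_free_deriv (h : MeridionalField R a w J H) (k : Fin 3) :
    ∀ᵐ x ∂volume.restrict (cyl R a), H 1 0 k x = H 0 1 k x :=
  (h.hess 1 0 k).unique_of_ae_eq (h.hess 0 1 k) h.curl_free

theorem div_free_deriv (h : MeridionalField R a w J H) (k : Fin 3) :
    ∀ᵐ x ∂volume.restrict (cyl R a), H 0 0 k x + H 1 1 k x + H 2 2 k x = 0 :=
  (((h.hess 0 0 k).add (h.hess 1 1 k)).add (h.hess 2 2 k)).unique_of_ae_eq HasPd.zero h.div_free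

theorem angular_deriv_zero (h : MeridionalField R a w J H) (k : Fin 3) :
    ∀ᵐ x ∂volume.restrict (cyl R a), x 0 * H 0 1 k x + (if 0 = k then 1 else 0) * J 0 1 x -
      (x 1 * H 0 0 k x + (if 1 = k then 1 else 0) * J 0 0 x) = -J 1 k x :=
  (((h.hess 0 1 k).coord_mul 0).sub ((h.hess 0 0 k).coord_mul 1)).unique_of_ae_eq (h.jac 1 k).neg
    (h.angular.mono fun _ hx => hx.1)

theorem angular_deriv_one (h : MeridionalField R a w J H) (k : Fin 3) :
    ∀ᵐ x ∂volume.restrict (cyl R a), x 0 * H 1 1 k x + (if 0 = k then 1 else 0) * J 1 1 x -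
      (x 1 * H 1 0 k x + (if 1 = k then 1 else 0) * J 1 0 x) = J 0 k x :=
  (((h.hess 1 1 k).coord_mul 0).sub ((h.hess 1 0 k).coord_mul 1)).unique_of_ae_eq (h.jac 0 k)
    (h.angular.mono fun _ hx => hx.2)

/-- The axial component vanishes at the top and at the bottom. -/
theorem vanishesAtEnds (hR : 0 < R) (ha : 0 < a) (h : MeridionalField R a w J H) :
    VanishesAtEnds R a (w 2) (J 2 2) :=
  vanishesAtEnds_of_tangential hR ha h.jac h.div_free h.tangential

theorem jac_vanishesAtEnds (hR : 0 < R) (ha : 0 < a) (h : MeridionalField R a w J H) {i : Fin 3}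
    (hi : i ≠ 2) : VanishesAtEnds R a (J 2 i) (H 2 2 i) :=
  (h.vanishesAtEnds hR ha).horizontal_deriv hR ha hi (h.jac 2 i) (h.hess 2 2 i)

/-- This is the orthogonality of ∂_z w and ∇w_z. Since ∇_h w_z vanishes at the ends, ∂_z can be
moved off w_h, which leaves −∫ w_h·∇_h ∂_z w_z. Tangency of w turns this into ∫ w_z ∂_z² w_z, and
w_z = 0 at the ends turns that into −∫ (∂_z w_z)². -/
theorem integral_cross (hR : 0 < R) (ha : 0 < a) (h : MeridionalField R a w J H) :
    ∫ x in cyl R a, (J 0 2 x * J 2 0 x + J 1 2 x * J 2 1 x + J 2 2 x ^ 2) = 0 := by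
  have hJ : ∀ i j, MemLp (J i j) 2 (volume.restrict (cyl R a)) := fun i j => (h.jac i j).2.1
  have hw : ∀ i, MemLp (w i) 2 (volume.restrict (cyl R a)) := fun i => (h.jac i 0).1
  have hH : ∀ i j k, MemLp (H i j k) 2 (volume.restrict (cyl R a)) := fun i j k =>
    (h.hess i j k).2.1
  have p : ∀ i, i ≠ 2 → ∫ x in cyl R a, (H 2 2 i x * w i x +
      (0 * J i 0 x + 0 * J i 1 x + J 2 i x * J i 2 x)) = 0 := by
    intro i hi
    refine pairing_eq_zero hR ha (h.jac i) (hH 2 2 i) memLp_zero memLp_zero (hJ 2 i)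
      fun φ hφ => ?_
    refine Eq.trans ?_ ((h.jac_vanishesAtEnds hR ha hi).2.2 φ hφ)
    congr 1
    ext x
    ring
  have q1 : ∫ x in cyl R a, (0 * J 2 2 x + (w 0 x * H 2 2 0 x + w 1 x * H 2 2 1 x +
      w 2 x * H 2 2 2 x)) = 0 := by
    refine pairing_eq_zero hR ha (h.hess 2 2) memLp_zero (hw 0) (hw 1) (hw 2) fun φ hφ => ?_
    refine Eq.trans ?_ (h.tangential φ hφ)
    congr 1
    ext x
    ring
  have q2 : ∫ x in cyl R a, (J 2 2 x * J 2 2 x + (0 * H 2 2 0 x + 0 * H 2 2 1 x +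
      w 2 x * H 2 2 2 x)) = 0 := by
    refine pairing_eq_zero hR ha (h.hess 2 2) (hJ 2 2) memLp_zero memLp_zero (hw 2) fun φ hφ => ?_
    refine Eq.trans ?_ ((h.vanishesAtEnds hR ha).2.2 φ hφ)
    congr 1
    ext x
    ring
  have I := fun {f g : E3 → ℝ} (hf : MemLp f 2 (volume.restrict (cyl R a)))
    (hg : MemLp g 2 (volume.restrict (cyl R a))) => integrable_mul_of_memLp hf hg
  have j0 := ((I (hH 2 2 0) (hw 0)).add (((I memLp_zero (hJ 0 0)).add
    (I memLp_zero (hJ 0 1))).add (I (hJ 2 0) (hJ 0 2))))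
  have j1 := ((I (hH 2 2 1) (hw 1)).add (((I memLp_zero (hJ 1 0)).add
    (I memLp_zero (hJ 1 1))).add (I (hJ 2 1) (hJ 1 2))))
  have j2 := (I memLp_zero (hJ 2 2)).add (((I (hw 0) (hH 2 2 0)).add (I (hw 1) (hH 2 2 1))).add
    (I (hw 2) (hH 2 2 2)))
  have j3 := (I (hJ 2 2) (hJ 2 2)).add (((I memLp_zero (hH 2 2 0)).add
    (I memLp_zero (hH 2 2 1))).add (I (hw 2) (hH 2 2 2)))
  have e1 := integral_add j0 j1
  have e2 := integral_sub j3 j2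
  refine integral_eq_zero_of_ae_eq_add (j0.add j1) (j3.sub j2) (e1.trans ?_) (e2.trans ?_) ?_
  · exact (congrArg₂ (· + ·) (p 0 (by decide)) (p 1 (by decide))).trans (add_zero 0)
  · exact (congrArg₂ (· - ·) q2 q1).trans (sub_zero 0)
  · filter_upwards with x
    simp only [Pi.add_apply, Pi.sub_apply]
    ring

/-- The energy identity, for the vorticity `x ↦ (-x₂ g, x₁ g, 0)`. -/
theorem integral_jac_sq_le (hR : 0 < R) (ha : 0 < a) (h : MeridionalField R a w J H)
    (hg : MemLp g 2 (volume.restrict (cyl R a)))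
    (h0 : ∀ᵐ x ∂volume.restrict (cyl R a), J 0 2 x - J 2 0 x = x 0 * g x)
    (h1 : ∀ᵐ x ∂volume.restrict (cyl R a), J 1 2 x - J 2 1 x = x 1 * g x) :
    ∫ x in cyl R a, ∑ i, ∑ j, J i j x ^ 2 ≤ R ^ 2 * ∫ x in cyl R a, g x ^ 2 := by
  have hJ : ∀ i j, MemLp (J i j) 2 (volume.restrict (cyl R a)) := fun i j => (h.jac i j).2.1
  have S : ∀ i j, Integrable (fun x => J i j x ^ 2) (volume.restrict (cyl R a)) := fun i j =>
    integrable_sq_of_memLp (hJ i j)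
  have hdet := integral_horizontal_gradient_le hR ha (h.jac 0) (h.jac 1) (m := 1) zero_le_one
    (by filter_upwards [h.angular] with x hx; linarith [hx.1])
  have hc := h.integral_cross hR ha
  have ic : Integrable (fun x => J 0 2 x * J 2 0 x + J 1 2 x * J 2 1 x + J 2 2 x ^ 2)
      (volume.restrict (cyl R a)) := ((integrable_mul_of_memLp (hJ 0 2) (hJ 2 0)).add
        (integrable_mul_of_memLp (hJ 1 2) (hJ 2 1))).add (S 2 2)
  have ih : Integrable (fun x => J 0 0 x ^ 2 + J 0 1 x ^ 2 + J 1 0 x ^ 2 + J 1 1 x ^ 2)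
      (volume.restrict (cyl R a)) := (((S 0 0).add (S 0 1)).add (S 1 0)).add (S 1 1)
  -- For w_h the horizontal curl vanishes and the horizontal divergence is −∂_z w_z.
  have hdet' : ∫ x in cyl R a, (J 0 0 x ^ 2 + J 0 1 x ^ 2 + J 1 0 x ^ 2 + J 1 1 x ^ 2) ≤
      ∫ x in cyl R a, J 2 2 x ^ 2 := by
    refine hdet.trans_eq (integral_congr_ae ?_)
    filter_upwards [h.div_free, h.curl_free] with x hx hx'
    have : J 0 0 x + J 1 1 x = -J 2 2 x := by linarith
    rw [this, hx']
    ring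
  have ir : Integrable (fun x => J 0 2 x ^ 2 + J 1 2 x ^ 2 + J 2 0 x ^ 2 + J 2 1 x ^ 2 +
      J 2 2 x ^ 2) (volume.restrict (cyl R a)) :=
    ((((S 0 2).add (S 1 2)).add (S 2 0)).add (S 2 1)).add (S 2 2)
  have e1 : ∫ x in cyl R a, ∑ i, ∑ j, J i j x ^ 2 =
      (∫ x in cyl R a, (J 0 0 x ^ 2 + J 0 1 x ^ 2 + J 1 0 x ^ 2 + J 1 1 x ^ 2)) +
      ∫ x in cyl R a, (J 0 2 x ^ 2 + J 1 2 x ^ 2 + J 2 0 x ^ 2 + J 2 1 x ^ 2 + J 2 2 x ^ 2) := by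
    rw [← integral_add ih ir]
    congr 1
    ext x
    simp only [Fin.sum_univ_three]
    ring
  have is : Integrable (fun x => J 2 2 x ^ 2 + (J 0 2 x ^ 2 + J 1 2 x ^ 2 + J 2 0 x ^ 2 +
      J 2 1 x ^ 2 + J 2 2 x ^ 2)) (volume.restrict (cyl R a)) := (S 2 2).add ir
  -- Subtracting twice the vanishing cross integral cancels both copies of (∂_z w_z)² and completes
  -- the squares (∂_z w_i − ∂_i w_z)², whose sum is r²g².
  have e2 : (∫ x in cyl R a, J 2 2 x ^ 2) + (∫ x in cyl R a,
      (J 0 2 x ^ 2 + J 1 2 x ^ 2 + J 2 0 x ^ 2 + J 2 1 x ^ 2 + J 2 2 x ^ 2)) - 2 * 0 ≤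
      R ^ 2 * ∫ x in cyl R a, g x ^ 2 := by
    rw [← hc, ← integral_const_mul, ← integral_const_mul, ← integral_add (S 2 2) ir,
      ← integral_sub is (ic.const_mul 2)]
    apply integral_mono_ae (is.sub (ic.const_mul 2))
      ((integrable_sq_of_memLp hg).const_mul _)
    filter_upwards [h0, h1, ae_mem_cyl R a] with x hx0 hx1 hx
    have hr := (mem_cyl_sq hx).1
    have e0 : (J 0 2 x - J 2 0 x) ^ 2 + (J 1 2 x - J 2 1 x) ^ 2 =
        (x 0 ^ 2 + x 1 ^ 2) * g x ^ 2 := by rw [hx0, hx1]; ring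
    simp only [Pi.sub_apply]
    nlinarith [mul_nonneg hr.le (sq_nonneg (g x))]
  rw [e1]
  linarith

/-- The horizontal components are angular derivatives of one another, so |w_h| ≤ r|∇_h w_h|
pointwise; only w_z needs the Poincaré inequality. -/
theorem integral_sq_le (hR : 0 < R) (ha : 0 < a) (h : MeridionalField R a w J H) :
    ∫ x in cyl R a, ∑ i, w i x ^ 2 ≤
      (R ^ 2 + 4 * a ^ 2) * ∫ x in cyl R a, ∑ i, ∑ j, J i j x ^ 2 := by
  have S : ∀ i j, Integrable (fun x => J i j x ^ 2) (volume.restrict (cyl R a)) := fun i j =>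
    integrable_sq_of_memLp (h.jac i j).2.1
  have W : ∀ i, Integrable (fun x => w i x ^ 2) (volume.restrict (cyl R a)) := fun i =>
    integrable_sq_of_memLp (h.jac i 0).1
  have iT : Integrable (fun x => ∑ i, ∑ j, J i j x ^ 2) (volume.restrict (cyl R a)) :=
    integrable_finsetSum _ fun i _ => integrable_finsetSum _ fun j _ => S i j
  have p := (h.vanishesAtEnds hR ha).integral_sq_le hR ha (h.jac 2)
  have p2 : ∫ x in cyl R a, J 2 2 x ^ 2 ≤ ∫ x in cyl R a, ∑ i, ∑ j, J i j x ^ 2 := by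
    apply integral_mono (S 2 2) iT
    intro x
    simp only [Fin.sum_univ_three]
    nlinarith [sq_nonneg (J 0 0 x), sq_nonneg (J 0 1 x), sq_nonneg (J 0 2 x), sq_nonneg (J 1 0 x),
      sq_nonneg (J 1 1 x), sq_nonneg (J 1 2 x), sq_nonneg (J 2 0 x), sq_nonneg (J 2 1 x)]
  have q : ∫ x in cyl R a, (w 0 x ^ 2 + w 1 x ^ 2) ≤
      ∫ x in cyl R a, R ^ 2 * ∑ i, ∑ j, J i j x ^ 2 := by
    apply integral_mono_ae ((W 0).add (W 1)) (iT.const_mul _)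
    filter_upwards [h.angular, ae_mem_cyl R a] with x ⟨h1, h2⟩ hx
    have hr := (mem_cyl_sq hx).1
    have h1' : w 1 x = x 1 * J 0 0 x - x 0 * J 0 1 x := by linarith
    have b0 : w 0 x ^ 2 ≤ (x 0 ^ 2 + x 1 ^ 2) * (J 1 1 x ^ 2 + J 1 0 x ^ 2) := by
      rw [← h2]; nlinarith [sq_nonneg (x 0 * J 1 0 x + x 1 * J 1 1 x)]
    have b1 : w 1 x ^ 2 ≤ (x 0 ^ 2 + x 1 ^ 2) * (J 0 1 x ^ 2 + J 0 0 x ^ 2) := by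
      rw [h1']; nlinarith [sq_nonneg (x 0 * J 0 0 x + x 1 * J 0 1 x)]
    have b2 : (x 0 ^ 2 + x 1 ^ 2) * (J 0 0 x ^ 2 + J 0 1 x ^ 2 + J 1 0 x ^ 2 + J 1 1 x ^ 2) ≤
        R ^ 2 * (J 0 0 x ^ 2 + J 0 1 x ^ 2 + J 1 0 x ^ 2 + J 1 1 x ^ 2) :=
      mul_le_mul_of_nonneg_right (by linarith) (by positivity)
    have b3 : 0 ≤ R ^ 2 * (J 0 2 x ^ 2 + J 1 2 x ^ 2 + J 2 0 x ^ 2 + J 2 1 x ^ 2 + J 2 2 x ^ 2) := by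
      positivity
    simp only [Fin.sum_univ_three, Pi.add_apply]
    nlinarith
  rw [integral_const_mul] at q
  have e : ∫ x in cyl R a, ∑ i, w i x ^ 2 =
      (∫ x in cyl R a, (w 0 x ^ 2 + w 1 x ^ 2)) + ∫ x in cyl R a, w 2 x ^ 2 := by
    have i01 : Integrable (fun x => w 0 x ^ 2 + w 1 x ^ 2) (volume.restrict (cyl R a)) :=
      (W 0).add (W 1)
    rw [← integral_add i01 (W 2)]
    simp only [Fin.sum_univ_three]
  rw [e]
  nlinarith [mul_le_mul_of_nonneg_left p2 (show 0 ≤ 4 * a ^ 2 by positivity)]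

end MeridionalField

/-! ### Removing a horizontal coordinate factor from a condition at the ends -/

section

variable {R a : ℝ} {f f' : E3 → ℝ}

/-- A horizontal multiplier that is the bounded pointwise limit of smooth ones. -/
theorem VanishesAtEnds.of_coord_mul
    (h0 : VanishesAtEnds R a (fun x => x 0 * f x) (fun x => x 0 * f' x))
    (h1 : VanishesAtEnds R a (fun x => x 1 * f x) (fun x => x 1 * f' x))
    (hf : MemLp f 2 (volume.restrict (cyl R a))) (hf' : MemLp f' 2 (volume.restrict (cyl R a))) :
    VanishesAtEnds R a f f' := by
  refine ⟨hf, hf', fun φ hφ => ?_⟩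
  have hpos : ∀ (n : ℕ) (x : E3), 0 < x 0 ^ 2 + x 1 ^ 2 + 1 / ((n : ℝ) + 1) := fun n x => by
    positivity
  -- Testing the relation for x_i f with x_i φ/(r² + 1/(n+1)) and adding over i = 0, 1 produces the
  -- factor `c n`, which lies in [0, 1] and tends to 1 off the axis.
  set c : ℕ → E3 → ℝ := fun n x => (x 0 ^ 2 + x 1 ^ 2) / (x 0 ^ 2 + x 1 ^ 2 + 1 / ((n : ℝ) + 1))
    with hc
  have hm : ∀ (n : ℕ) (i : Fin 3),
      ContDiff ℝ ∞ fun x : E3 => x i / (x 0 ^ 2 + x 1 ^ 2 + 1 / ((n : ℝ) + 1)) := fun n i =>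
    (contDiff_coord i).div (by fun_prop) fun x => (hpos n x).ne'
  have hm2 : ∀ (n : ℕ) (i : Fin 3), i ≠ 2 → ∀ x : E3,
      pd 2 (fun x : E3 => x i / (x 0 ^ 2 + x 1 ^ 2 + 1 / ((n : ℝ) + 1))) x = 0 := by
    intro n i hi
    refine pd_eq_zero_of_update 2 fun x t => ?_
    simp [hi]
  have hlim := tendsto_integral_mul_of_le_one (c := c) (c' := fun _ => 1)
    (integrable_pairing hf hf' (hφ.pd 2) hφ) (fun n => ?_) (fun n x => ?_) ?_
  · have hz : ∀ n, ∫ x in cyl R a, c n x * (f x * pd 2 φ x + f' x * φ x) = 0 := by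
      intro n
      have t0 := hφ.smooth_mul (hm n 0)
      have t1 := hφ.smooth_mul (hm n 1)
      refine integral_eq_zero_of_ae_eq_add (integrable_pairing h0.1 h0.2.1 (t0.pd 2) t0)
        (integrable_pairing h1.1 h1.2.1 (t1.pd 2) t1) (h0.2.2 _ t0) (h1.2.2 _ t1) ?_
      filter_upwards with x
      rw [pd_mul (hm n 0) hφ.1, pd_mul (hm n 1) hφ.1, hm2 n 0 (by decide), hm2 n 1 (by decide)]
      simp only [hc]
      ring
    simp only [hz, one_mul] at hlim
    exact tendsto_nhds_unique hlim tendsto_const_nhds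
  · have : Continuous (c n) := by
      simp only [hc]
      exact Continuous.div (by fun_prop) (by fun_prop) fun x => (hpos n x).ne'
    exact this.aestronglyMeasurable
  · have : 0 < 1 / ((n : ℝ) + 1) := by positivity
    simp only [hc]
    rw [abs_of_nonneg (div_nonneg (by positivity) (hpos n x).le), div_le_one (hpos n x)]
    linarith
  · filter_upwards [ae_restrict_of_ae (ae_coord_ne_zero 0)] with x hx
    have hr : x 0 ^ 2 + x 1 ^ 2 ≠ 0 := by positivity
    have h := (tendsto_one_div_add_atTop_nhds_zero_nat (𝕜 := ℝ)).const_add (x 0 ^ 2 + x 1 ^ 2)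
    rw [add_zero] at h
    have := (tendsto_const_nhds (x := x 0 ^ 2 + x 1 ^ 2)).div h hr
    rwa [div_self hr] at this

end

/-! ### Second-order estimate: the gradient of ∂_z w_z -/

namespace MeridionalField

variable {R a : ℝ} {w : Fin 3 → E3 → ℝ} {J : Fin 3 → Fin 3 → E3 → ℝ}
  {H : Fin 3 → Fin 3 → Fin 3 → E3 → ℝ} {g : E3 → ℝ} {g' : Fin 3 → E3 → ℝ}

theorem vort_deriv (h : MeridionalField R a w J H) (hg : ∀ i, HasPd R a i g (g' i)) {i : Fin 3}
    (hi : ∀ᵐ x ∂volume.restrict (cyl R a), J i 2 x - J 2 i x = x i * g x) (k : Fin 3) :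
    ∀ᵐ x ∂volume.restrict (cyl R a),
      H i 2 k x - H 2 i k x = x i * g' k x + (if i = k then 1 else 0) * g x :=
  ((h.hess i 2 k).sub (h.hess 2 i k)).unique_of_ae_eq ((hg k).coord_mul i) hi

/-- At the ends ∂_z w_i = 0 by the slip condition and ∂_i w_z = 0 because w_z vanishes there. Hence
x_i g vanishes for both horizontal i, and so does g. -/
theorem vort_vanishesAtEnds (hR : 0 < R) (ha : 0 < a) (h : MeridionalField R a w J H)
    (hg : ∀ i, HasPd R a i g (g' i))
    (slip : ∀ i : Fin 3, i ≠ 2 → VanishesAtEnds R a (J i 2) (H i 2 2))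
    (h0 : ∀ᵐ x ∂volume.restrict (cyl R a), J 0 2 x - J 2 0 x = x 0 * g x)
    (h1 : ∀ᵐ x ∂volume.restrict (cyl R a), J 1 2 x - J 2 1 x = x 1 * g x) :
    VanishesAtEnds R a g (g' 2) := by
  refine VanishesAtEnds.of_coord_mul ?_ ?_ (hg 2).1 (hg 2).2.1
  · refine ((slip 0 (by decide)).sub (h.jac_vanishesAtEnds hR ha (by decide))).congr h0 ?_
    filter_upwards [h.vort_deriv hg h0 2, h.hess_symm 2 0 2] with x hx hx'
    rw [← hx', hx]
    simp
  · refine ((slip 1 (by decide)).sub (h.jac_vanishesAtEnds hR ha (by decide))).congr h1 ?_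
    filter_upwards [h.vort_deriv hg h1 2, h.hess_symm 2 1 2] with x hx hx'
    rw [← hx', hx]
    simp

/-- The axial derivative of the field is tangential on the lateral boundary. -/
theorem tangential_deriv (hR : 0 < R) (ha : 0 < a) (h : MeridionalField R a w J H)
    {θ : E3 → ℝ} (hθ : IsTest θ) :
    ∫ x in cyl R a, (J 0 2 x * pd 0 θ x + J 1 2 x * pd 1 θ x - H 2 2 2 x * θ x) = 0 := by
  have hJ : ∀ i j, MemLp (J i j) 2 (volume.restrict (cyl R a)) := fun i j => (h.jac i j).2.1
  have hw : ∀ i, MemLp (w i) 2 (volume.restrict (cyl R a)) := fun i => (h.jac i 0).1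
  have hH : MemLp (H 2 2 2) 2 (volume.restrict (cyl R a)) := (h.hess 2 2 2).2.1
  refine integral_eq_zero_of_cutZ ((integrable_pairing (hJ 0 2) (hJ 1 2) (hθ.pd 0) (hθ.pd 1)).sub
    (integrable_mul_of_memLp hH (hθ.memLp R a))) fun n => ?_
  have hψ : IsTest fun y => cutZ a n y * θ y := hθ.smooth_mul (contDiff_cutZ a n)
  have ψ0 := (hθ.pd 0).smooth_mul (contDiff_cutZ a n)
  have ψ1 := (hθ.pd 1).smooth_mul (contDiff_cutZ a n)
  have e0 := (h.jac 0 2).integral_cutZ hR ha (hθ.pd 0) n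
  have e1 := (h.jac 1 2).integral_cutZ hR ha (hθ.pd 1) n
  have e2 := (h.hess 2 2 2).integral_cutZ hR ha hθ n
  -- Tangency of w is used with the test function ∂_z(ηθ), η = `cutZ a n`; its axial term is
  -- rewritten by w_z = 0 at the ends, and ∂_z is moved onto the other factors.
  have e3 := (h.vanishesAtEnds hR ha).2.2 _ (hψ.pd 2)
  have e4 := h.tangential _ (hψ.pd 2)
  have i0 := integrable_pairing (hw 0) (hJ 0 2) (ψ0.pd 2) ψ0
  have i1 := integrable_pairing (hw 1) (hJ 1 2) (ψ1.pd 2) ψ1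
  have i2 := integrable_pairing (hJ 2 2) hH (hψ.pd 2) hψ
  have i3 := integrable_pairing (hw 2) (hJ 2 2) ((hψ.pd 2).pd 2) (hψ.pd 2)
  have i4 := (integrable_pairing (hw 0) (hw 1) ((hψ.pd 2).pd 0) ((hψ.pd 2).pd 1)).add
    (integrable_mul_of_memLp (hw 2) (((hψ.pd 2).pd 2).memLp R a))
  have e01 := integral_add i0 i1
  rw [e0, e1, add_zero] at e01
  have e34 := integral_sub i3 i4
  have e4' := (congrArg₂ (· - ·) e3 e4)
  have e34' := e34.trans (e4'.trans (sub_zero 0))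
  have e012 := integral_sub (i0.add i1) i2
  have e012' := e012.trans ((congrArg₂ (· - ·) e01 e2).trans (sub_zero 0))
  refine integral_eq_zero_of_ae_eq_add ((i0.add i1).sub i2) (i3.sub i4) e012' e34' ?_
  filter_upwards with x
  have c0 : pd 0 (fun y => cutZ a n y * θ y) = fun y => cutZ a n y * pd 0 θ y :=
    funext fun y => pd_cutZ_mul hθ.1 (by decide) n y
  have c1 : pd 1 (fun y => cutZ a n y * θ y) = fun y => cutZ a n y * pd 1 θ y :=
    funext fun y => pd_cutZ_mul hθ.1 (by decide) n y
  simp only [Pi.add_apply, Pi.sub_apply, pd_comm hψ.1 0 2 x, pd_comm hψ.1 1 2 x, c0, c1]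
  ring

/-- The field ∂_z²w is solenoidal and tangential: on S₁ the radial component stays zero under ∂_z,
and at the ends ∂_z²w_z = −div_h ∂_z w_h = 0 by the slip condition. It is therefore orthogonal to
∇∂_z w_z, and ∂_z²w_i = ∂_i∂_z w_z + x_i ∂_z g turns this into the estimate. -/
theorem integral_hess_axial_sq_le (hR : 0 < R) (ha : 0 < a) (h : MeridionalField R a w J H)
    (hg : ∀ i, HasPd R a i g (g' i))
    (slip : ∀ i : Fin 3, i ≠ 2 → VanishesAtEnds R a (J i 2) (H i 2 2))
    (h0 : ∀ᵐ x ∂volume.restrict (cyl R a), J 0 2 x - J 2 0 x = x 0 * g x)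
    (h1 : ∀ᵐ x ∂volume.restrict (cyl R a), J 1 2 x - J 2 1 x = x 1 * g x) :
    ∫ x in cyl R a, (H 2 2 0 x ^ 2 + H 2 2 1 x ^ 2 + H 2 2 2 x ^ 2) ≤
      R ^ 2 * ∫ x in cyl R a, g' 2 x ^ 2 := by
  have hJ : ∀ i j, MemLp (J i j) 2 (volume.restrict (cyl R a)) := fun i j => (h.jac i j).2.1
  have hH : ∀ i j k, MemLp (H i j k) 2 (volume.restrict (cyl R a)) := fun i j k =>
    (h.hess i j k).2.1
  have key := pairing_eq_zero hR ha (h.hess 2 2) (F := fun _ => 0) (G₀ := H 0 2 2) (G₁ := H 1 2 2)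
    (G₂ := H 2 2 2) memLp_zero (hH 0 2 2) (hH 1 2 2) (hH 2 2 2) ?_
  · have ik : Integrable (fun x => 0 * J 2 2 x + (H 0 2 2 x * H 2 2 0 x + H 1 2 2 x * H 2 2 1 x +
        H 2 2 2 x * H 2 2 2 x)) (volume.restrict (cyl R a)) :=
      (integrable_mul_of_memLp memLp_zero (hJ 2 2)).add (((integrable_mul_of_memLp (hH 0 2 2)
        (hH 2 2 0)).add (integrable_mul_of_memLp (hH 1 2 2) (hH 2 2 1))).add
        (integrable_mul_of_memLp (hH 2 2 2) (hH 2 2 2)))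
    have iS : Integrable (fun x => H 2 2 0 x ^ 2 + H 2 2 1 x ^ 2 + H 2 2 2 x ^ 2)
        (volume.restrict (cyl R a)) :=
      ((integrable_sq_of_memLp (hH 2 2 0)).add (integrable_sq_of_memLp (hH 2 2 1))).add
        (integrable_sq_of_memLp (hH 2 2 2))
    have ig : Integrable (fun x => g' 2 x ^ 2) (volume.restrict (cyl R a)) :=
      integrable_sq_of_memLp (hg 2).2.1
    have hle : ∫ x in cyl R a, (H 2 2 0 x ^ 2 + H 2 2 1 x ^ 2 + H 2 2 2 x ^ 2) ≤
        ∫ x in cyl R a, (2 * (0 * J 2 2 x + (H 0 2 2 x * H 2 2 0 x + H 1 2 2 x * H 2 2 1 x +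
        H 2 2 2 x * H 2 2 2 x)) + R ^ 2 * g' 2 x ^ 2) := by
      apply integral_mono_ae iS ((ik.const_mul 2).add (ig.const_mul _))
      filter_upwards [h.vort_deriv hg h0 2, h.vort_deriv hg h1 2, h.hess_symm 2 0 2,
        h.hess_symm 2 1 2, ae_mem_cyl R a] with x e0 e1 s0 s1 hx
      simp only [Fin.reduceEq, if_false, zero_mul, add_zero] at e0 e1
      have hr := (mem_cyl_sq hx).1
      have e0' : H 0 2 2 x = H 2 2 0 x + x 0 * g' 2 x := by linarith
      have e1' : H 1 2 2 x = H 2 2 1 x + x 1 * g' 2 x := by linarith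
      simp only [Pi.add_apply, e0', e1']
      -- For X = ∂_i∂_z w_z and Y = x_i ∂_z g the inequality is X² ≤ 2X(X + Y) + Y² = X² + (X + Y)².
      nlinarith [mul_nonneg hr.le (sq_nonneg (g' 2 x)), sq_nonneg (H 2 2 0 x + x 0 * g' 2 x),
        sq_nonneg (H 2 2 1 x + x 1 * g' 2 x), sq_nonneg (H 2 2 2 x)]
    rw [integral_add (ik.const_mul 2) (ig.const_mul _), integral_const_mul, key,
      integral_const_mul] at hle
    linarith
  · intro φ hφ
    have e0 := (slip 0 (by decide)).2.2 _ (hφ.pd 0)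
    have e1 := (slip 1 (by decide)).2.2 _ (hφ.pd 1)
    have e2 := h.tangential_deriv hR ha (hφ.pd 2)
    have i0 := integrable_pairing (hJ 0 2) (hH 0 2 2) ((hφ.pd 0).pd 2) (hφ.pd 0)
    have i1 := integrable_pairing (hJ 1 2) (hH 1 2 2) ((hφ.pd 1).pd 2) (hφ.pd 1)
    have i2 := (integrable_pairing (hJ 0 2) (hJ 1 2) ((hφ.pd 2).pd 0) ((hφ.pd 2).pd 1)).sub
      (integrable_mul_of_memLp (hH 2 2 2) ((hφ.pd 2).memLp R a))
    have e01 := integral_add i0 i1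
    rw [e0, e1, add_zero] at e01
    refine integral_eq_zero_of_ae_eq_sub (i0.add i1) i2 e01 e2 ?_
    filter_upwards with x
    simp only [Pi.add_apply, Pi.sub_apply, pd_comm hφ.1 2 0, pd_comm hφ.1 2 1]
    ring

end MeridionalField

/-! ### Second-order estimate: mixed and horizontal derivatives -/

namespace MeridionalField

variable {R a : ℝ} {w : Fin 3 → E3 → ℝ} {J : Fin 3 → Fin 3 → E3 → ℝ}
  {H : Fin 3 → Fin 3 → Fin 3 → E3 → ℝ} {g : E3 → ℝ} {g' : Fin 3 → E3 → ℝ}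

/-- The pair ∂_z w_h again turns with unit speed about the axis; its horizontal curl is zero and its
divergence is −∂_z²w_z. -/
theorem integral_hess_mixed_le (hR : 0 < R) (ha : 0 < a) (h : MeridionalField R a w J H) :
    ∫ x in cyl R a, (H 0 2 0 x ^ 2 + H 0 2 1 x ^ 2 + H 1 2 0 x ^ 2 + H 1 2 1 x ^ 2) ≤
      ∫ x in cyl R a, H 2 2 2 x ^ 2 := by
  refine (integral_horizontal_gradient_le hR ha (h.hess 0 2) (h.hess 1 2) (m := 1) zero_le_one
    ?_).trans_eq (integral_congr_ae ?_)
  · filter_upwards [h.angular_deriv_zero 2, h.hess_symm 0 1 2, h.hess_symm 0 0 2] with x e s1 s0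
    simp at e
    rw [← s1, ← s0]
    linarith
  · filter_upwards [h.div_free_deriv 2, h.curl_free_deriv 2, h.hess_symm 0 0 2, h.hess_symm 1 1 2,
      h.hess_symm 1 0 2, h.hess_symm 0 1 2] with x d c s0 s1 s2 s3
    have e1 : H 0 2 0 x + H 1 2 1 x = -H 2 2 2 x := by linarith
    have e2 : H 1 2 0 x - H 0 2 1 x = 0 := by linarith
    rw [e1, e2]
    ring

/-- The trace-free horizontal strain ((∂₀w₀ − ∂₁w₁)/2, ∂₀w₁) turns with double speed, hence m = 2.
Its horizontal divergence and curl are −½∂₀∂_z w_z and −½∂₁∂_z w_z, already estimated. -/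
theorem integral_hess_horizontal_le (hR : 0 < R) (ha : 0 < a) (h : MeridionalField R a w J H) :
    ∫ x in cyl R a, ((1 / 2 * (H 0 0 0 x - H 1 1 0 x)) ^ 2 +
        (1 / 2 * (H 0 0 1 x - H 1 1 1 x)) ^ 2 + H 1 0 0 x ^ 2 + H 1 0 1 x ^ 2) ≤
      ∫ x in cyl R a, (H 2 2 0 x ^ 2 + H 2 2 1 x ^ 2 + H 2 2 2 x ^ 2) := by
  have hH : ∀ i j k, Integrable (fun x => H i j k x ^ 2) (volume.restrict (cyl R a)) :=
    fun i j k => integrable_sq_of_memLp (h.hess i j k).2.1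
  have key := integral_horizontal_gradient_le hR ha
    (fun i => ((h.hess 0 0 i).sub (h.hess 1 1 i)).const_mul (1 / 2)) (h.hess 1 0) (m := 2)
    zero_le_two ?_
  · refine key.trans ?_
    have e : ∫ x in cyl R a, ((1 / 2 * (H 0 0 0 x - H 1 1 0 x) + H 1 0 1 x) ^ 2 +
        (H 1 0 0 x - 1 / 2 * (H 0 0 1 x - H 1 1 1 x)) ^ 2) =
        ∫ x in cyl R a, (1 / 4 * (H 2 2 0 x ^ 2 + H 2 2 1 x ^ 2)) := by
      refine integral_congr_ae ?_
      filter_upwards [h.div_free_deriv 0, h.div_free_deriv 1, h.curl_free_deriv 0,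
        h.hess_symm 1 1 0, h.hess_symm 0 1 0] with x d0 d1 c0 s1 s0
      have e1 : 1 / 2 * (H 0 0 0 x - H 1 1 0 x) + H 1 0 1 x = -(1 / 2 * H 2 2 0 x) := by linarith
      have e2 : H 1 0 0 x - 1 / 2 * (H 0 0 1 x - H 1 1 1 x) = -(1 / 2 * H 2 2 1 x) := by linarith
      rw [e1, e2]
      ring
    rw [e]
    apply integral_mono (((hH 2 2 0).add (hH 2 2 1)).const_mul _)
      (((hH 2 2 0).add (hH 2 2 1)).add (hH 2 2 2))
    intro x
    simp only [Pi.add_apply]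
    nlinarith [sq_nonneg (H 2 2 0 x), sq_nonneg (H 2 2 1 x), sq_nonneg (H 2 2 2 x)]
  · filter_upwards [h.angular_deriv_zero 0, h.angular_deriv_one 1, h.hess_symm 0 1 0,
      h.hess_symm 1 1 0, h.curl_free] with x z0 o1 s0 s1 c
    simp at z0 o1
    rw [s0] at z0
    linear_combination 1 / 2 * z0 - 1 / 2 * o1 + 1 / 2 * x 1 * s1 + c

/-- The horizontal Hessian of w_h is recovered from the trace, equal to −∇_h ∂_z w_z, and the
trace-free part. The horizontal Hessian of w_z and the derivatives ∂_z²w_h come from the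
differentiated vorticity relation. The constants are not sharp. -/
theorem ae_hess_sq_le (h : MeridionalField R a w J H) (hg : ∀ i, HasPd R a i g (g' i))
    (h0 : ∀ᵐ x ∂volume.restrict (cyl R a), J 0 2 x - J 2 0 x = x 0 * g x)
    (h1 : ∀ᵐ x ∂volume.restrict (cyl R a), J 1 2 x - J 2 1 x = x 1 * g x) :
    ∀ᵐ x ∂volume.restrict (cyl R a), ∑ i, ∑ j, ∑ k, H i j k x ^ 2 ≤
      5 * (H 2 2 0 x ^ 2 + H 2 2 1 x ^ 2 + H 2 2 2 x ^ 2) +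
      6 * (H 0 2 0 x ^ 2 + H 0 2 1 x ^ 2 + H 1 2 0 x ^ 2 + H 1 2 1 x ^ 2) +
      4 * ((1 / 2 * (H 0 0 0 x - H 1 1 0 x)) ^ 2 +
        (1 / 2 * (H 0 0 1 x - H 1 1 1 x)) ^ 2 + H 1 0 0 x ^ 2 + H 1 0 1 x ^ 2) +
      6 * g x ^ 2 + 5 * (R ^ 2 * ∑ i, g' i x ^ 2) := by
  filter_upwards [ae_all_iff.2 fun i => ae_all_iff.2 fun j => ae_all_iff.2 fun k =>
    h.hess_symm i j k, ae_all_iff.2 (h.vort_deriv hg h0), ae_all_iff.2 (h.vort_deriv hg h1),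
    ae_all_iff.2 h.div_free_deriv, ae_all_iff.2 h.curl_free_deriv, ae_mem_cyl R a]
    with x s v0 v1 d c hx
  have hr := (mem_cyl_sq hx).1
  have hor : H 0 0 0 x ^ 2 + H 0 0 1 x ^ 2 + H 0 1 0 x ^ 2 + H 0 1 1 x ^ 2 + H 1 0 0 x ^ 2 +
      H 1 0 1 x ^ 2 + H 1 1 0 x ^ 2 + H 1 1 1 x ^ 2 ≤ (H 2 2 0 x ^ 2 + H 2 2 1 x ^ 2 + H 2 2 2 x ^ 2) + 2 * ((1 / 2 * (H 0 0 0 x - H 1 1 0 x)) ^ 2 +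
        (1 / 2 * (H 0 0 1 x - H 1 1 1 x)) ^ 2 + H 1 0 0 x ^ 2 + H 1 0 1 x ^ 2) := by
    have e0 : H 2 2 0 x = -(H 0 0 0 x + H 1 1 0 x) := by linarith [d 0]
    have e1 : H 2 2 1 x = -(H 0 0 1 x + H 1 1 1 x) := by linarith [d 1]
    have e2 : H 0 1 0 x = H 1 0 0 x := (c 0).symm
    have e3 : H 0 1 1 x = H 1 0 1 x := (c 1).symm
    have e4 : 0 ≤ H 2 2 2 x ^ 2 := sq_nonneg _
    simp only [e0, e1, e2, e3]
    nlinarith [sq_nonneg (H 0 0 0 x + H 1 1 0 x), sq_nonneg (H 0 0 1 x + H 1 1 1 x)]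
  have mix : H 0 0 2 x ^ 2 + H 0 2 0 x ^ 2 + H 0 1 2 x ^ 2 + H 0 2 1 x ^ 2 + H 1 0 2 x ^ 2 +
      H 1 2 0 x ^ 2 + H 1 1 2 x ^ 2 + H 1 2 1 x ^ 2 = 2 * (H 0 2 0 x ^ 2 + H 0 2 1 x ^ 2 + H 1 2 0 x ^ 2 + H 1 2 1 x ^ 2) := by
    rw [s 0 0 2, s 0 1 2, s 1 0 2, s 1 1 2]
    ring
  have three : ∀ X Y Z : ℝ, (X - Y - Z) ^ 2 ≤ 3 * X ^ 2 + 3 * Y ^ 2 + 3 * Z ^ 2 := fun X Y Z => by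
    nlinarith [sq_nonneg (X + Y), sq_nonneg (X + Z), sq_nonneg (Y - Z)]
  have two : ∀ X Y : ℝ, (X + Y) ^ 2 ≤ 2 * X ^ 2 + 2 * Y ^ 2 := fun X Y => by
    nlinarith [sq_nonneg (X - Y)]
  have q00 : H 2 0 0 x ^ 2 ≤ 3 * H 0 2 0 x ^ 2 + 3 * (x 0 * g' 0 x) ^ 2 + 3 * g x ^ 2 := by
    have e := v0 0
    simp only [if_true, one_mul] at e
    rw [show H 2 0 0 x = H 0 2 0 x - x 0 * g' 0 x - g x by linarith]
    exact three _ _ _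
  have q01 : H 2 0 1 x ^ 2 ≤ 3 * H 0 2 1 x ^ 2 + 3 * (x 0 * g' 1 x) ^ 2 + 3 * 0 ^ 2 := by
    have e := v0 1
    simp only [Fin.reduceEq, if_false, zero_mul] at e
    rw [show H 2 0 1 x = H 0 2 1 x - x 0 * g' 1 x - 0 by linarith]
    exact three _ _ _
  have q10 : H 2 1 0 x ^ 2 ≤ 3 * H 1 2 0 x ^ 2 + 3 * (x 1 * g' 0 x) ^ 2 + 3 * 0 ^ 2 := by
    have e := v1 0
    simp only [Fin.reduceEq, if_false, zero_mul] at e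
    rw [show H 2 1 0 x = H 1 2 0 x - x 1 * g' 0 x - 0 by linarith]
    exact three _ _ _
  have q11 : H 2 1 1 x ^ 2 ≤ 3 * H 1 2 1 x ^ 2 + 3 * (x 1 * g' 1 x) ^ 2 + 3 * g x ^ 2 := by
    have e := v1 1
    simp only [if_true, one_mul] at e
    rw [show H 2 1 1 x = H 1 2 1 x - x 1 * g' 1 x - g x by linarith]
    exact three _ _ _
  have q0 : H 0 2 2 x ^ 2 ≤ 2 * H 2 2 0 x ^ 2 + 2 * (x 0 * g' 2 x) ^ 2 := by
    have e := v0 2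
    simp only [Fin.reduceEq, if_false, zero_mul] at e
    rw [show H 0 2 2 x = H 2 2 0 x + x 0 * g' 2 x by linarith [s 2 0 2]]
    exact two _ _
  have q1 : H 1 2 2 x ^ 2 ≤ 2 * H 2 2 1 x ^ 2 + 2 * (x 1 * g' 2 x) ^ 2 := by
    have e := v1 2
    simp only [Fin.reduceEq, if_false, zero_mul] at e
    rw [show H 1 2 2 x = H 2 2 1 x + x 1 * g' 2 x by linarith [s 2 1 2]]
    exact two _ _
  have rg : ∀ k, (x 0 * g' k x) ^ 2 + (x 1 * g' k x) ^ 2 ≤ R ^ 2 * g' k x ^ 2 := fun k => by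
    have := mul_nonneg hr.le (sq_nonneg (g' k x))
    linarith
  have p0 := sq_nonneg (H 2 2 2 x)
  have p1 : 0 ≤ ((1 / 2 * (H 0 0 0 x - H 1 1 0 x)) ^ 2 +
        (1 / 2 * (H 0 0 1 x - H 1 1 1 x)) ^ 2 + H 1 0 0 x ^ 2 + H 1 0 1 x ^ 2) := by positivity
  have p2 : 0 ≤ R ^ 2 * g' 0 x ^ 2 := by positivity
  have p3 : 0 ≤ R ^ 2 * g' 1 x ^ 2 := by positivity
  have p4 : 0 ≤ R ^ 2 * g' 2 x ^ 2 := by positivity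
  have p5 := sq_nonneg (H 2 2 0 x)
  have p6 := sq_nonneg (H 2 2 1 x)
  have p9 : 0 ≤ (H 0 2 0 x ^ 2 + H 0 2 1 x ^ 2 + H 1 2 0 x ^ 2 + H 1 2 1 x ^ 2) := by positivity
  simp only [Fin.sum_univ_three, s 2 0 2, s 2 1 2]
  linarith [rg 0, rg 1, rg 2]

/-- The integrals of S1, S2, S3 are each at most R²∫(∂_z g)², and ∫g² ≤ 4a²∫(∂_z g)² since g
vanishes at the ends; so 20 = 5 + 6 + 4 + 5 and 24 = 6·4. -/
theorem integral_hess_sq_le (hR : 0 < R) (ha : 0 < a) (h : MeridionalField R a w J H)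
    (hg : ∀ i, HasPd R a i g (g' i))
    (slip : ∀ i : Fin 3, i ≠ 2 → VanishesAtEnds R a (J i 2) (H i 2 2))
    (h0 : ∀ᵐ x ∂volume.restrict (cyl R a), J 0 2 x - J 2 0 x = x 0 * g x)
    (h1 : ∀ᵐ x ∂volume.restrict (cyl R a), J 1 2 x - J 2 1 x = x 1 * g x) :
    ∫ x in cyl R a, ∑ i, ∑ j, ∑ k, H i j k x ^ 2 ≤
      (20 * R ^ 2 + 24 * a ^ 2) * ∫ x in cyl R a, ∑ i, g' i x ^ 2 := by
  have hH : ∀ i j k, Integrable (fun x => H i j k x ^ 2) (volume.restrict (cyl R a)) :=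
    fun i j k => integrable_sq_of_memLp (h.hess i j k).2.1
  have hG : ∀ i, Integrable (fun x => g' i x ^ 2) (volume.restrict (cyl R a)) := fun i =>
    integrable_sq_of_memLp (hg i).2.1
  have hg2 : Integrable (fun x => g x ^ 2) (volume.restrict (cyl R a)) :=
    integrable_sq_of_memLp (hg 0).1
  have iD : Integrable (fun x => ∑ i, g' i x ^ 2) (volume.restrict (cyl R a)) :=
    integrable_finsetSum _ fun i _ => hG i
  have iT : Integrable (fun x => ∑ i, ∑ j, ∑ k, H i j k x ^ 2) (volume.restrict (cyl R a)) :=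
    integrable_finsetSum _ fun i _ => integrable_finsetSum _ fun j _ =>
      integrable_finsetSum _ fun k _ => hH i j k
  set S1 : E3 → ℝ := fun x => H 2 2 0 x ^ 2 + H 2 2 1 x ^ 2 + H 2 2 2 x ^ 2 with hS1
  set S2 : E3 → ℝ := fun x => H 0 2 0 x ^ 2 + H 0 2 1 x ^ 2 + H 1 2 0 x ^ 2 + H 1 2 1 x ^ 2
    with hS2
  set S3 : E3 → ℝ := fun x => (1 / 2 * (H 0 0 0 x - H 1 1 0 x)) ^ 2 +
        (1 / 2 * (H 0 0 1 x - H 1 1 1 x)) ^ 2 + H 1 0 0 x ^ 2 + H 1 0 1 x ^ 2 with hS3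
  have i1 : Integrable S1 (volume.restrict (cyl R a)) := ((hH 2 2 0).add (hH 2 2 1)).add (hH 2 2 2)
  have i2 : Integrable S2 (volume.restrict (cyl R a)) :=
    (((hH 0 2 0).add (hH 0 2 1)).add (hH 1 2 0)).add (hH 1 2 1)
  have i3 : Integrable S3 (volume.restrict (cyl R a)) :=
    (((integrable_sq_of_memLp (((h.hess 0 0 0).sub (h.hess 1 1 0)).const_mul (1 / 2)).2.1).add
    (integrable_sq_of_memLp (((h.hess 0 0 1).sub (h.hess 1 1 1)).const_mul (1 / 2)).2.1)).add
    (hH 1 0 0)).add (hH 1 0 1)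
  have b1 : ∫ x in cyl R a, S1 x ≤ R ^ 2 * ∫ x in cyl R a, g' 2 x ^ 2 :=
    h.integral_hess_axial_sq_le hR ha hg slip h0 h1
  have b2 : ∫ x in cyl R a, S2 x ≤ ∫ x in cyl R a, S1 x := by
    refine (h.integral_hess_mixed_le hR ha).trans (integral_mono (hH 2 2 2) i1 fun x => ?_)
    simp only [hS1]
    nlinarith [sq_nonneg (H 2 2 0 x), sq_nonneg (H 2 2 1 x)]
  have b3 : ∫ x in cyl R a, S3 x ≤ ∫ x in cyl R a, S1 x := h.integral_hess_horizontal_le hR ha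
  have b4 := (h.vort_vanishesAtEnds hR ha hg slip h0 h1).integral_sq_le hR ha hg
  have b5 : ∫ x in cyl R a, g' 2 x ^ 2 ≤ ∫ x in cyl R a, ∑ i, g' i x ^ 2 := by
    refine integral_mono (hG 2) iD fun x => ?_
    simp only [Fin.sum_univ_three]
    nlinarith [sq_nonneg (g' 0 x), sq_nonneg (g' 1 x)]
  have main : ∫ x in cyl R a, ∑ i, ∑ j, ∑ k, H i j k x ^ 2 ≤
      ∫ x in cyl R a, (5 * S1 x + 6 * S2 x + 4 * S3 x + 6 * g x ^ 2 +
        5 * (R ^ 2 * ∑ i, g' i x ^ 2)) := by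
    apply integral_mono_ae iT (((((i1.const_mul 5).add (i2.const_mul 6)).add (i3.const_mul 4)).add
      (hg2.const_mul 6)).add ((iD.const_mul _).const_mul 5))
    exact h.ae_hess_sq_le hg h0 h1
  have e : ∫ x in cyl R a, (5 * S1 x + 6 * S2 x + 4 * S3 x + 6 * g x ^ 2 +
        5 * (R ^ 2 * ∑ i, g' i x ^ 2)) = 5 * (∫ x in cyl R a, S1 x) + 6 * (∫ x in cyl R a, S2 x) +
        4 * (∫ x in cyl R a, S3 x) + 6 * (∫ x in cyl R a, g x ^ 2) +
        5 * (R ^ 2 * ∫ x in cyl R a, ∑ i, g' i x ^ 2) := by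
    have i12 : Integrable (fun x => 5 * S1 x + 6 * S2 x) (volume.restrict (cyl R a)) :=
      (i1.const_mul 5).add (i2.const_mul 6)
    have i123 : Integrable (fun x => 5 * S1 x + 6 * S2 x + 4 * S3 x) (volume.restrict (cyl R a)) :=
      i12.add (i3.const_mul 4)
    have i4 : Integrable (fun x => 5 * S1 x + 6 * S2 x + 4 * S3 x + 6 * g x ^ 2)
        (volume.restrict (cyl R a)) := i123.add (hg2.const_mul 6)
    rw [integral_add i4 ((iD.const_mul _).const_mul 5), integral_add i123 (hg2.const_mul 6),
      integral_add i12 (i3.const_mul 4), integral_add (i1.const_mul 5) (i2.const_mul 6)]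
    simp only [integral_const_mul]
  rw [e] at main
  have c1 := mul_le_mul_of_nonneg_left b5 (sq_nonneg R)
  have c2 := mul_le_mul_of_nonneg_left b5 (sq_nonneg a)
  linarith

end MeridionalField

/-! ### Weak derivatives in the sense of distributions -/

section

variable {R a : ℝ} {i : Fin 3} {f g f' g' : E3 → ℝ}

theorem multiDeriv_single (i : Fin 3) (φ : E3 → ℝ) : multiDeriv (Pi.single i 1) φ = pd i φ := by
  fin_cases i <;> simp [multiDeriv]

theorem multiDeriv_zero (φ : E3 → ℝ) : multiDeriv 0 φ = φ := by simp [multiDeriv]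

theorem multiDeriv_single_add_single {φ : E3 → ℝ} (hφ : ContDiff ℝ ∞ φ) (i j : Fin 3) :
    multiDeriv (Pi.single i 1 + Pi.single j 1) φ = pd i (pd j φ) := by
  have c10 : pd 1 (pd 0 φ) = pd 0 (pd 1 φ) := funext fun x => pd_comm hφ 1 0 x
  have c20 : pd 2 (pd 0 φ) = pd 0 (pd 2 φ) := funext fun x => pd_comm hφ 2 0 x
  have c21 : pd 2 (pd 1 φ) = pd 1 (pd 2 φ) := funext fun x => pd_comm hφ 2 1 x
  fin_cases i <;> fin_cases j <;> simp [multiDeriv, c10, c20, c21]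

theorem sum_single (i : Fin 3) : ∑ j, (Pi.single i 1 : Fin 3 → ℕ) j = 1 := by simp

theorem ae_eq_zero_of_locallyIntegrableOn {h : E3 → ℝ} (hh : LocallyIntegrableOn h (cyl R a) volume)
    (H : ∀ φ : E3 → ℝ, IsTest φ → tsupport φ ⊆ cyl R a → ∫ x in cyl R a, h x * φ x = 0) :
    ∀ᵐ x ∂volume.restrict (cyl R a), h x = 0 := by
  rw [ae_restrict_iff' (measurableSet_cyl R a)]
  refine (isOpen_cyl R a).ae_eq_zero_of_integral_contDiff_smul_eq_zero hh fun φ h1 h2 h3 => ?_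
  rw [← H φ ⟨h1, h2⟩ h3, ← integral_indicator (measurableSet_cyl R a)]
  congr 1
  ext x
  by_cases hx : x ∈ cyl R a
  · simp [hx, mul_comm]
  · have : φ x = 0 := by
      by_contra hne
      exact hx (h3 (subset_tsupport _ hne))
    simp [hx, this]

theorem LocallyIntegrableOn.integrable_mul_test (hf : LocallyIntegrableOn f (cyl R a) volume)
    {φ : E3 → ℝ} (hφ : IsTest φ) (hs : tsupport φ ⊆ cyl R a) :
    Integrable (fun x => f x * φ x) (volume.restrict (cyl R a)) := by
  have h1 : IntegrableOn f (tsupport φ) volume := hf.integrableOn_compact_subset hs hφ.2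
  have h2 : IntegrableOn (fun x => f x * φ x) (tsupport φ) volume :=
    h1.mul_continuousOn hφ.1.continuous.continuousOn hφ.2
  have h3 : Integrable (fun x => f x * φ x) volume := by
    refine (integrableOn_iff_integrable_of_support_subset ?_).1 h2
    intro x hx
    apply subset_tsupport
    intro h
    exact hx (by simp [h])
  exact h3.restrict

theorem IsWeakDeriv.unique {α : Fin 3 → ℕ} (h : IsWeakDeriv (cyl R a) α f g)
    (h' : IsWeakDeriv (cyl R a) α f' g')
    (hff : ∀ᵐ x ∂volume.restrict (cyl R a), f x = f' x) :
    ∀ᵐ x ∂volume.restrict (cyl R a), g x = g' x := by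
  have := ae_eq_zero_of_locallyIntegrableOn (h := fun x => g x - g' x) (h.2.1.sub h'.2.1) ?_
  · filter_upwards [this] with x hx using sub_eq_zero.1 hx
  · intro φ hφ hs
    have e1 := h.2.2 φ hφ.1 hφ.2 hs
    have e2 := h'.2.2 φ hφ.1 hφ.2 hs
    have e3 : ∫ x in cyl R a, f x * multiDeriv α φ x = ∫ x in cyl R a, f' x * multiDeriv α φ x := by
      apply integral_congr_ae
      filter_upwards [hff] with x hx
      rw [hx]
    rw [e3, e2] at e1
    have e4 := mul_left_cancel₀ (pow_ne_zero _ (by norm_num)) e1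
    simp only [sub_mul]
    rw [integral_sub (LocallyIntegrableOn.integrable_mul_test h.2.1 hφ hs)
      (LocallyIntegrableOn.integrable_mul_test h'.2.1 hφ hs), e4, sub_self]

theorem isWeakDeriv_zero (hf : LocallyIntegrableOn f (cyl R a) volume) :
    IsWeakDeriv (cyl R a) 0 f f := by
  refine ⟨hf, hf, fun φ _ _ _ => ?_⟩
  simp [multiDeriv_zero]

theorem IsWeakDeriv.ae_eq (h : IsWeakDeriv (cyl R a) 0 f g) :
    ∀ᵐ x ∂volume.restrict (cyl R a), f x = g x :=
  (isWeakDeriv_zero h.1).unique h (by simp)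

theorem locallyIntegrableOn_of_memLp (hf : MemLp f 2 (volume.restrict (cyl R a))) :
    LocallyIntegrableOn f (cyl R a) volume := by
  have hint : IntegrableOn f (cyl R a) := hf.integrable (by norm_num)
  exact hint.locallyIntegrableOn

theorem HasPd.isWeakPartial (h : HasPd R a i f g) : IsWeakPartial (cyl R a) i f g := by
  refine ⟨locallyIntegrableOn_of_memLp h.1, locallyIntegrableOn_of_memLp h.2.1, fun φ h1 h2 hs => ?_⟩
  have hφ : IsTest φ := ⟨h1, h2⟩
  have := h.2.2 φ hφ hs
  rw [integral_add (integrable_mul_of_memLp h.1 ((hφ.pd i).memLp R a))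
    (integrable_mul_of_memLp h.2.1 (hφ.memLp R a))] at this
  rw [multiDeriv_single, sum_single]
  linarith

theorem IsWeakPartial.hasPd (h : IsWeakPartial (cyl R a) i f g)
    (hf : MemLp f 2 (volume.restrict (cyl R a))) (hg : MemLp g 2 (volume.restrict (cyl R a))) :
    HasPd R a i f g := by
  refine ⟨hf, hg, fun φ hφ hs => ?_⟩
  have := h.2.2 φ hφ.1 hφ.2 hs
  rw [multiDeriv_single, sum_single] at this
  rw [integral_add (integrable_mul_of_memLp hf ((hφ.pd i).memLp R a))
    (integrable_mul_of_memLp hg (hφ.memLp R a)), this]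
  ring

theorem memLp_of_lintegral (hf : AEStronglyMeasurable f (volume.restrict (cyl R a)))
    (h : ∫⁻ x in cyl R a, ‖f x‖ₑ ^ 2 < ⊤) : MemLp f 2 (volume.restrict (cyl R a)) := by
  refine ⟨hf, ?_⟩
  rw [eLpNorm_lt_top_iff_lintegral_rpow_enorm_lt_top (by norm_num) (by norm_num)]
  simpa using h

theorem lintegral_enorm_sq (hf : MemLp f 2 (volume.restrict (cyl R a))) :
    ∫⁻ x in cyl R a, ‖f x‖ₑ ^ 2 = ENNReal.ofReal (∫ x in cyl R a, f x ^ 2) := by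
  rw [ofReal_integral_eq_lintegral_ofReal hf.integrable_sq (ae_of_all _ fun x => sq_nonneg _)]
  congr 1
  ext x
  rw [← ofReal_norm, ← ENNReal.ofReal_pow (norm_nonneg _), Real.norm_eq_abs, sq_abs]

theorem hNormSq_lt_top {k : ℕ} (h : hNormSq k (cyl R a) f < ⊤) :
    ∃ D : (Fin 3 → ℕ) → E3 → ℝ, ∀ α ∈ multiIndices k,
      IsWeakDeriv (cyl R a) α f (D α) ∧ MemLp (D α) 2 (volume.restrict (cyl R a)) := by
  unfold hNormSq at h
  simp only [iInf_lt_iff] at h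
  obtain ⟨D, hD, hlt⟩ := h
  refine ⟨D, fun α hα => ⟨hD α hα, ?_⟩⟩
  exact memLp_of_lintegral (hD α hα).2.1.aestronglyMeasurable
    (ENNReal.sum_lt_top.1 hlt α hα)

theorem zero_mem_multiIndices (k : ℕ) : (0 : Fin 3 → ℕ) ∈ multiIndices k := by
  simp [multiIndices]

theorem single_mem_multiIndices (k : ℕ) (i : Fin 3) :
    (Pi.single i 1 : Fin 3 → ℕ) ∈ multiIndices (k + 1) := by
  simp only [multiIndices, Finset.mem_filter, Fintype.mem_piFinset, Finset.mem_range, sum_single]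
  refine ⟨fun j => ?_, by omega⟩
  by_cases h : j = i
  · subst h; simp
  · simp [h]

theorem single_add_single_mem_multiIndices (i j : Fin 3) :
    (Pi.single i 1 + Pi.single j 1 : Fin 3 → ℕ) ∈ multiIndices 2 := by
  revert i j
  decide

theorem memLp_of_hNormSq {k : ℕ} (h : hNormSq k (cyl R a) f < ⊤) :
    MemLp f 2 (volume.restrict (cyl R a)) := by
  obtain ⟨D, hD⟩ := hNormSq_lt_top h
  have h0 := hD 0 (zero_mem_multiIndices k)
  exact (memLp_congr_ae h0.1.ae_eq).2 h0.2

/-- The norm supplies derivatives of f indexed by multi-indices. Testing the first-order relation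
with ∂_kφ identifies the derivative of index e_j + e_k as the weak ∂_k of the one of index e_j. -/
theorem exists_hasPd_of_hNormSq_two (h : hNormSq 2 (cyl R a) f < ⊤) :
    ∃ (J : Fin 3 → E3 → ℝ) (H : Fin 3 → Fin 3 → E3 → ℝ),
      (∀ j, HasPd R a j f (J j)) ∧ ∀ j k, HasPd R a k (J j) (H j k) := by
  obtain ⟨D, hD⟩ := hNormSq_lt_top h
  have hf := memLp_of_hNormSq h
  have hJ : ∀ j, HasPd R a j f (D (Pi.single j 1)) := fun j =>
    IsWeakPartial.hasPd (hD _ (single_mem_multiIndices 1 j)).1 hf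
      (hD _ (single_mem_multiIndices 1 j)).2
  refine ⟨fun j => D (Pi.single j 1), fun j k => D (Pi.single j 1 + Pi.single k 1), hJ,
    fun j k => ?_⟩
  obtain ⟨w1, w2⟩ := hD _ (single_add_single_mem_multiIndices j k)
  refine ⟨(hJ j).2.1, w2, fun φ hφ hs => ?_⟩
  have e1 := (hJ j).2.2 _ (hφ.pd k) ((tsupport_pd_subset φ k).trans hs)
  have e2 := w1.2.2 φ hφ.1 hφ.2 hs
  rw [multiDeriv_single_add_single hφ.1] at e2
  have e3 : ∑ l, (Pi.single j 1 + Pi.single k 1 : Fin 3 → ℕ) l = 2 := by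
    simp only [Pi.add_apply, Finset.sum_add_distrib, sum_single]
  rw [e3] at e2
  rw [integral_add (integrable_mul_of_memLp hf (((hφ.pd k).pd j).memLp R a))
    (integrable_mul_of_memLp (hJ j).2.1 ((hφ.pd k).memLp R a))] at e1
  rw [integral_add (integrable_mul_of_memLp (hJ j).2.1 ((hφ.pd k).memLp R a))
    (integrable_mul_of_memLp w2 (hφ.memLp R a))]
  linarith

end

/-! ### Rotations about the axis and the reflection in a meridional plane -/

theorem norm_eq_of_sq {x y : E3} (h : y 0 ^ 2 + y 1 ^ 2 + y 2 ^ 2 = x 0 ^ 2 + x 1 ^ 2 + x 2 ^ 2) :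
    ‖y‖ = ‖x‖ := by
  rw [EuclideanSpace.norm_eq, EuclideanSpace.norm_eq, Fin.sum_univ_three, Fin.sum_univ_three]
  simp only [Real.norm_eq_abs, sq_abs, h]

theorem rotZ_zero_coord (θ : ℝ) (x : E3) : rotZ θ x 0 = Real.cos θ * x 0 - Real.sin θ * x 1 := rfl
theorem rotZ_one_coord (θ : ℝ) (x : E3) : rotZ θ x 1 = Real.sin θ * x 0 + Real.cos θ * x 1 := rfl
theorem rotZ_two_coord (θ : ℝ) (x : E3) : rotZ θ x 2 = x 2 := rfl

/-- The rotation `rotZ θ` as a linear isometry. -/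
noncomputable def rotZIsometry (θ : ℝ) : E3 →ₗᵢ[ℝ] E3 where
  toFun := rotZ θ
  map_add' x y := by
    ext i
    fin_cases i <;> simp [rotZ] <;> ring
  map_smul' c x := by
    ext i
    fin_cases i <;> simp [rotZ] <;> ring
  norm_map' x := by
    apply norm_eq_of_sq
    simp only [LinearMap.coe_mk, AddHom.coe_mk, rotZ_zero_coord, rotZ_one_coord, rotZ_two_coord]
    linear_combination (x 0 ^ 2 + x 1 ^ 2) * Real.sin_sq_add_cos_sq θ

/-- The reflection `(x₁, x₂, x₃) ↦ (x₁, -x₂, x₃)`. -/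
noncomputable def refl₂ (x : E3) : E3 := !₂[x 0, -x 1, x 2]

theorem refl₂_zero_coord (x : E3) : refl₂ x 0 = x 0 := rfl
theorem refl₂_one_coord (x : E3) : refl₂ x 1 = -x 1 := rfl
theorem refl₂_two_coord (x : E3) : refl₂ x 2 = x 2 := rfl

theorem refl₂_refl₂ (x : E3) : refl₂ (refl₂ x) = x := by
  ext i
  fin_cases i <;> simp [refl₂]

/-- The reflection `refl₂` as a linear isometry. -/
noncomputable def reflIsometry : E3 →ₗᵢ[ℝ] E3 where
  toFun := refl₂
  map_add' x y := by
    ext i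
    fin_cases i <;> simp [refl₂]
    ring
  map_smul' c x := by
    ext i
    fin_cases i <;> simp [refl₂]
  norm_map' x := by
    apply norm_eq_of_sq
    simp only [LinearMap.coe_mk, AddHom.coe_mk, refl₂_zero_coord, refl₂_one_coord, refl₂_two_coord]
    ring

theorem cylR_rotZ (θ : ℝ) (x : E3) : cylR (rotZ θ x) = cylR x := by
  unfold cylR
  congr 1
  rw [rotZ_zero_coord, rotZ_one_coord]
  linear_combination (x 0 ^ 2 + x 1 ^ 2) * Real.sin_sq_add_cos_sq θ

theorem cylR_refl₂ (x : E3) : cylR (refl₂ x) = cylR x := by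
  unfold cylR
  rw [refl₂_zero_coord, refl₂_one_coord, neg_sq]

theorem measurePreserving_isometry (L : E3 →ₗᵢ[ℝ] E3) :
    MeasurePreserving L (volume : Measure E3) volume :=
  (L.toLinearIsometryEquiv rfl).measurePreserving

section

variable {R a : ℝ}

theorem measurePreserving_rotZ (θ : ℝ) :
    MeasurePreserving (rotZ θ) (volume.restrict (cyl R a)) (volume.restrict (cyl R a)) := by
  have h := (measurePreserving_isometry (rotZIsometry θ)).restrict_preimage
    (measurableSet_cyl R a)
  have e : (rotZIsometry θ) ⁻¹' cyl R a = cyl R a := by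
    ext x
    change cylR (rotZ θ x) < R ∧ |rotZ θ x 2| < a ↔ _
    rw [cylR_rotZ, rotZ_two_coord]
    rfl
  rw [e] at h
  exact h

theorem measurePreserving_refl₂ :
    MeasurePreserving refl₂ (volume.restrict (cyl R a)) (volume.restrict (cyl R a)) := by
  have h := (measurePreserving_isometry reflIsometry).restrict_preimage
    (measurableSet_cyl R a)
  have e : reflIsometry ⁻¹' cyl R a = cyl R a := by
    ext x
    change cylR (refl₂ x) < R ∧ |refl₂ x 2| < a ↔ _
    rw [cylR_refl₂, refl₂_two_coord]
    rfl
  rw [e] at h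
  exact h

theorem contDiff_refl₂ : ContDiff ℝ ∞ refl₂ := reflIsometry.contDiff

theorem continuous_refl₂ : Continuous refl₂ := contDiff_refl₂.continuous

theorem continuous_rotZ : Continuous fun p : E3 × ℝ => rotZ p.2 p.1 := by
  unfold rotZ
  refine (PiLp.continuous_toLp 2 _).comp (continuous_pi fun i => ?_)
  fin_cases i <;> simp <;> fun_prop

theorem measurableEmbedding_refl₂ : MeasurableEmbedding refl₂ :=
  (Homeomorph.mk ⟨refl₂, refl₂, refl₂_refl₂, refl₂_refl₂⟩ continuous_refl₂
    continuous_refl₂).measurableEmbedding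

theorem integral_comp_refl₂ (F : E3 → ℝ) :
    ∫ x in cyl R a, F (refl₂ x) = ∫ x in cyl R a, F x :=
  measurePreserving_refl₂.integral_comp measurableEmbedding_refl₂ F

/-- A point at polar angle φ goes to −φ under rotation by −2φ, which is the argument of z = (x₀ − i
x₁)². -/
theorem exists_rotZ_eq_refl₂ {x : E3} (hx : x 0 ≠ 0) : ∃ c, rotZ c x = refl₂ x := by
  have hr : 0 < x 0 ^ 2 + x 1 ^ 2 := by positivity
  set z : ℂ := ⟨(x 0 ^ 2 - x 1 ^ 2), -2 * x 0 * x 1⟩ with hz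
  have hn : ‖z‖ = x 0 ^ 2 + x 1 ^ 2 := by
    rw [Complex.norm_def, Real.sqrt_eq_iff_mul_self_eq (Complex.normSq_nonneg _) hr.le,
      Complex.normSq_apply]
    simp only [hz]
    ring
  have hz0 : z ≠ 0 := norm_pos_iff.1 (hn ▸ hr)
  have hc : Real.cos z.arg = (x 0 ^ 2 - x 1 ^ 2) / (x 0 ^ 2 + x 1 ^ 2) := by
    rw [Complex.cos_arg hz0, hn]
  have hs : Real.sin z.arg = (-2 * x 0 * x 1) / (x 0 ^ 2 + x 1 ^ 2) := by
    rw [Complex.sin_arg, hn]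
  refine ⟨z.arg, ?_⟩
  ext i
  fin_cases i
  · change rotZ z.arg x 0 = refl₂ x 0
    rw [rotZ_zero_coord, refl₂_zero_coord, hc, hs]
    field_simp
    ring
  · change rotZ z.arg x 1 = refl₂ x 1
    rw [rotZ_one_coord, refl₂_one_coord, hc, hs]
    field_simp
    ring
  · rfl

theorem rotZ_rotZ (θ c : ℝ) (x : E3) : rotZ θ (rotZ c x) = rotZ (θ + c) x := by
  ext i
  fin_cases i <;> simp [rotZ, Real.cos_add, Real.sin_add] <;> ring

/-- A rotation invariant function is reflection invariant. -/
theorem ae_comp_refl₂_eq {f : E3 → ℝ} (hf : AEStronglyMeasurable f (volume.restrict (cyl R a)))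
    (h : ∀ θ : ℝ, ∀ᵐ x ∂volume.restrict (cyl R a), f (rotZ θ x) = f x) :
    ∀ᵐ x ∂volume.restrict (cyl R a), f (refl₂ x) = f x := by
  set F := hf.mk f with hF
  have hFm : Measurable F := hf.stronglyMeasurable_mk.measurable
  have hfF : ∀ᵐ x ∂volume.restrict (cyl R a), f x = F x := hf.ae_eq_mk
  have h1 : ∀ θ : ℝ, ∀ᵐ x ∂volume.restrict (cyl R a), F (rotZ θ x) = F x := by
    intro θ
    filter_upwards [h θ, hfF, (measurePreserving_rotZ θ).quasiMeasurePreserving.ae hfF]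
      with x e1 e2 e3
    rw [← e3, e1, e2]
  have hms : MeasurableSet {p : E3 × ℝ | F (rotZ p.2 p.1) = F p.1} :=
    measurableSet_eq_fun (hFm.comp continuous_rotZ.measurable) (hFm.comp measurable_fst)
  -- The rotation that realizes the reflection depends on x, so invariance for each fixed θ cannot
  -- be applied directly. Fubini gives, for almost every x, invariance for almost every θ; a
  -- measurable representative is needed for this.
  have h2 : ∀ᵐ x ∂volume.restrict (cyl R a), ∀ᵐ θ : ℝ, F (rotZ θ x) = F x :=
    (Measure.ae_ae_comm hms).2 (ae_of_all _ h1)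
  have h3 := measurePreserving_refl₂.quasiMeasurePreserving.ae h2
  filter_upwards [h2, h3, hfF, measurePreserving_refl₂.quasiMeasurePreserving.ae hfF,
    ae_restrict_of_ae (ae_coord_ne_zero 0)] with x e1 e2 e3 e4 hx
  obtain ⟨c, hc⟩ := exists_rotZ_eq_refl₂ hx
  have e1' : ∀ᵐ θ : ℝ, F (rotZ (θ + c) x) = F x :=
    (measurePreserving_add_right volume c).quasiMeasurePreserving.ae e1
  -- Almost every θ is good both for the reflected point and, shifted by c, for x itself; one common
  -- θ links the two values.
  obtain ⟨θ, t1, t2⟩ := (e1'.and e2).exists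
  rw [e3, e4, ← t2, ← hc, rotZ_rotZ, t1]

/-- The sign of the `i`-th coordinate under the reflection. -/
def reflSign (i : Fin 3) : ℝ := if i = 1 then -1 else 1

theorem reflSign_mul_self (i : Fin 3) : reflSign i * reflSign i = 1 := by
  unfold reflSign; split_ifs <;> norm_num

theorem refl₂_single (i : Fin 3) :
    refl₂ (EuclideanSpace.single i 1) = reflSign i • EuclideanSpace.single i (1 : ℝ) := by
  ext j
  fin_cases i <;> fin_cases j <;> simp [refl₂, reflSign]

theorem pd_comp_refl₂ {φ : E3 → ℝ} (hφ : ContDiff ℝ ∞ φ) (i : Fin 3) (x : E3) :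
    pd i (fun y => φ (refl₂ y)) x = reflSign i * pd i φ (refl₂ x) := by
  have h1 : HasFDerivAt φ (fderiv ℝ φ (refl₂ x)) (refl₂ x) :=
    (hφ.differentiable (by simp) _).hasFDerivAt
  have h2 : HasFDerivAt refl₂ reflIsometry.toContinuousLinearMap x :=
    reflIsometry.toContinuousLinearMap.hasFDerivAt
  have h3 : fderiv ℝ (fun y => φ (refl₂ y)) x = _ := (h1.comp x h2).fderiv
  unfold pd
  rw [h3]
  change fderiv ℝ φ (refl₂ x) (refl₂ (EuclideanSpace.single i 1)) = _
  rw [refl₂_single, map_smul, smul_eq_mul]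

theorem IsTest.comp_refl₂ {φ : E3 → ℝ} (hφ : IsTest φ) : IsTest fun x => φ (refl₂ x) :=
  ⟨hφ.1.comp contDiff_refl₂, hφ.2.comp_homeomorph
    (Homeomorph.mk ⟨refl₂, refl₂, refl₂_refl₂, refl₂_refl₂⟩ continuous_refl₂ continuous_refl₂)⟩

theorem memLp_comp_refl₂ {f : E3 → ℝ} (hf : MemLp f 2 (volume.restrict (cyl R a))) :
    MemLp (fun x => f (refl₂ x)) 2 (volume.restrict (cyl R a)) :=
  hf.comp_measurePreserving measurePreserving_refl₂

theorem integral_pairing_refl₂ {f g φ : E3 → ℝ} (hφ : ContDiff ℝ ∞ φ) (i : Fin 3) :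
    ∫ x in cyl R a, (f (refl₂ x) * pd i φ x + reflSign i * g (refl₂ x) * φ x) =
      reflSign i * ∫ x in cyl R a, (f x * pd i (fun y => φ (refl₂ y)) x +
        g x * φ (refl₂ x)) := by
  rw [← integral_comp_refl₂, ← integral_const_mul]
  congr 1
  ext x
  rw [refl₂_refl₂, pd_comp_refl₂ hφ]
  linear_combination -f x * pd i φ (refl₂ x) * reflSign_mul_self i

theorem HasPd.comp_refl₂ {i : Fin 3} {f g : E3 → ℝ} (h : HasPd R a i f g) :
    HasPd R a i (fun x => f (refl₂ x)) (fun x => reflSign i * g (refl₂ x)) := by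
  refine ⟨memLp_comp_refl₂ h.1, (memLp_comp_refl₂ h.2.1).const_mul _, fun φ hφ hs => ?_⟩
  rw [integral_pairing_refl₂ hφ.1, h.2.2 _ hφ.comp_refl₂, mul_zero]
  have hcl : IsClosed (refl₂ ⁻¹' tsupport φ) := (isClosed_tsupport φ).preimage continuous_refl₂
  have hsub : Function.support (fun y => φ (refl₂ y)) ⊆ refl₂ ⁻¹' tsupport φ :=
    fun x hx => subset_tsupport φ hx
  refine (closure_minimal hsub hcl).trans fun x hx => ?_
  obtain ⟨h1, h2⟩ := hs hx
  rw [cylR_refl₂] at h1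
  exact ⟨h1, h2⟩

theorem VanishesAtEnds.comp_refl₂ {f g : E3 → ℝ} (h : VanishesAtEnds R a f g) :
    VanishesAtEnds R a (fun x => f (refl₂ x)) (fun x => g (refl₂ x)) := by
  refine ⟨memLp_comp_refl₂ h.1, memLp_comp_refl₂ h.2.1, fun φ hφ => ?_⟩
  have := integral_pairing_refl₂ (R := R) (a := a) (f := f) (g := g) hφ.1 2
  rw [h.2.2 _ hφ.comp_refl₂] at this
  simpa [reflSign] using this

theorem rotZ_zero (x : E3) : rotZ 0 x = x := by
  ext i
  fin_cases i <;> simp [rotZ]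

theorem measurableEmbedding_rotZ (θ : ℝ) : MeasurableEmbedding (rotZ θ) :=
  (rotZIsometry θ).isometry.isClosedEmbedding.measurableEmbedding

theorem hasDerivAt_rotZ (x : E3) (θ : ℝ) : HasDerivAt (fun t => rotZ t x)
    (-rotZ θ x 1 • EuclideanSpace.single 0 1 + rotZ θ x 0 • EuclideanSpace.single 1 1) θ := by
  have e2 : (fun t => rotZ t x) = fun t => Real.cos t • (!₂[x 0, x 1, 0] : E3) +
      Real.sin t • (!₂[-x 1, x 0, 0] : E3) + (!₂[0, 0, x 2] : E3) := by
    ext t i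
    fin_cases i <;> simp [rotZ] <;> ring
  rw [e2]
  convert! (((Real.hasDerivAt_cos θ).smul_const (!₂[x 0, x 1, 0] : E3)).add
    ((Real.hasDerivAt_sin θ).smul_const (!₂[-x 1, x 0, 0] : E3))).add_const
    (!₂[0, 0, x 2] : E3) using 1
  ext i
  fin_cases i <;> simp [rotZ] <;> ring

theorem hasDerivAt_comp_rotZ {φ : E3 → ℝ} (hφ : ContDiff ℝ ∞ φ) (x : E3) (θ : ℝ) :
    HasDerivAt (fun t => φ (rotZ t x))
      (rotZ θ x 0 * pd 1 φ (rotZ θ x) - rotZ θ x 1 * pd 0 φ (rotZ θ x)) θ := by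
  have e3 : HasFDerivAt φ (fderiv ℝ φ (rotZ θ x)) (rotZ θ x) :=
    (hφ.differentiable (by simp) _).hasFDerivAt
  refine (e3.comp_hasDerivAt θ (hasDerivAt_rotZ x θ)).congr_deriv ?_
  simp only [map_add, map_smul, smul_eq_mul, pd]
  ring

theorem integral_mul_comp_rotZ {f : E3 → ℝ} (φ : E3 → ℝ)
    (h : ∀ θ : ℝ, ∀ᵐ x ∂volume.restrict (cyl R a), f (rotZ θ x) = f x) (θ : ℝ) :
    ∫ x in cyl R a, f x * φ (rotZ θ x) = ∫ x in cyl R a, f x * φ x := by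
  rw [← (measurePreserving_rotZ θ).integral_comp (measurableEmbedding_rotZ θ)
    (fun x => f x * φ x)]
  apply integral_congr_ae
  filter_upwards [h θ] with x hx
  rw [hx]

theorem IsTest.angular {φ : E3 → ℝ} (hφ : IsTest φ) :
    IsTest fun x => x 0 * _root_.pd 1 φ x - x 1 * _root_.pd 0 φ x := by
  have := ((hφ.pd 1).smooth_mul (contDiff_coord 0)).add
    ((hφ.pd 0).smooth_mul (contDiff_coord 1).neg)
  simpa [sub_eq_add_neg] using this

/-- By invariance of f and of the measure, ∫ f·(φ ∘ rotation by θ) does not depend on θ;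
differentiating under the integral at θ = 0 gives the claim. -/
theorem integral_eq_zero_of_hasDerivAt_rotZ {f φ ψ : E3 → ℝ} {C : ℝ}
    (hf : MemLp f 2 (volume.restrict (cyl R a)))
    (h : ∀ θ : ℝ, ∀ᵐ x ∂volume.restrict (cyl R a), f (rotZ θ x) = f x)
    (hφc : Continuous φ) (hφ : MemLp φ 2 (volume.restrict (cyl R a)))
    (hψ : Continuous ψ) (hC : ∀ x, ‖ψ x‖ ≤ C)
    (hd : ∀ x θ, HasDerivAt (fun t => φ (rotZ t x)) (ψ (rotZ θ x)) θ) :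
    ∫ x in cyl R a, f x * ψ x = 0 := by
  have hc : ∀ t, Continuous (rotZ t) := fun t => (rotZIsometry t).continuous
  have m1 : ∀ t, AEStronglyMeasurable (fun x => f x * φ (rotZ t x)) (volume.restrict (cyl R a)) :=
    fun t => hf.1.mul (hφc.comp (hc t)).aestronglyMeasurable
  have m2 : Integrable (fun x => f x * φ (rotZ 0 x)) (volume.restrict (cyl R a)) := by
    simpa only [rotZ_zero] using integrable_mul_of_memLp hf hφ
  have m3 : AEStronglyMeasurable (fun x => f x * ψ (rotZ 0 x)) (volume.restrict (cyl R a)) :=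
    hf.1.mul (hψ.comp (hc 0)).aestronglyMeasurable
  have m4 : ∀ x, ∀ t ∈ (univ : Set ℝ), ‖f x * ψ (rotZ t x)‖ ≤ |f x| * C := fun x t _ => by
    rw [norm_mul, Real.norm_eq_abs]
    exact mul_le_mul_of_nonneg_left (hC (rotZ t x)) (abs_nonneg _)
  have m5 : Integrable (fun x => |f x| * C) (volume.restrict (cyl R a)) :=
    (hf.integrable (by norm_num)).abs.mul_const C
  have m6 : ∀ x, ∀ t ∈ (univ : Set ℝ), HasDerivAt (fun t => f x * φ (rotZ t x))
      (f x * ψ (rotZ t x)) t :=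
    fun x t _ => (hd x t).const_mul (f x)
  have key := (hasDerivAt_integral_of_dominated_loc_of_deriv_le
    (μ := volume.restrict (cyl R a)) (F := fun t x => f x * φ (rotZ t x))
    (F' := fun θ x => f x * ψ (rotZ θ x))
    (x₀ := (0 : ℝ)) (s := univ) (bound := fun x => |f x| * C) univ_mem
    (Eventually.of_forall m1) m2 m3 (ae_of_all _ m4) m5 (ae_of_all _ m6)).2
  rw [show (fun t => ∫ x in cyl R a, f x * φ (rotZ t x)) = fun _ => ∫ x in cyl R a, f x * φ x
    from funext fun t => integral_mul_comp_rotZ φ h t, integral_mul_comp_rotZ ψ h 0] at key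
  exact key.unique (hasDerivAt_const _ _)

theorem integral_angular_eq_zero {f : E3 → ℝ} (hf : MemLp f 2 (volume.restrict (cyl R a)))
    (h : ∀ θ : ℝ, ∀ᵐ x ∂volume.restrict (cyl R a), f (rotZ θ x) = f x) {φ : E3 → ℝ}
    (hφ : IsTest φ) :
    ∫ x in cyl R a, f x * (x 0 * pd 1 φ x - x 1 * pd 0 φ x) = 0 := by
  obtain ⟨C, hC⟩ := hφ.angular.2.exists_bound_of_continuous hφ.angular.1.continuous
  exact integral_eq_zero_of_hasDerivAt_rotZ hf h hφ.1.continuous (hφ.memLp R a)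
    hφ.angular.1.continuous hC (hasDerivAt_comp_rotZ hφ.1)

/-- The weak angular derivative of a rotation invariant function vanishes. -/
theorem angular_deriv_eq_zero {f f₀ f₁ : E3 → ℝ} (h0 : HasPd R a 0 f f₀) (h1 : HasPd R a 1 f f₁)
    (h : ∀ θ : ℝ, ∀ᵐ x ∂volume.restrict (cyl R a), f (rotZ θ x) = f x) :
    ∀ᵐ x ∂volume.restrict (cyl R a), x 0 * f₁ x = x 1 * f₀ x := by
  have hz := ae_eq_zero_of_integral_test (R := R) (a := a) (h := fun x => x 0 * f₁ x - x 1 * f₀ x)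
    ((MemLp.coord_mul h1.2.1 0).sub (MemLp.coord_mul h0.2.1 1)) ?_
  · filter_upwards [hz] with x hx using sub_eq_zero.1 hx
  · intro φ hφ hs
    have t0 := hφ.smooth_mul (contDiff_coord 0)
    have t1 := hφ.smooth_mul (contDiff_coord 1)
    have e1 := h1.2.2 _ t0 (tsupport_mul_subset_right.trans hs)
    have e0 := h0.2.2 _ t1 (tsupport_mul_subset_right.trans hs)
    have i1 := integrable_pairing h1.1 h1.2.1 (t0.pd 1) t0
    have i0 := integrable_pairing h0.1 h0.2.1 (t1.pd 0) t1
    have e2 := (integral_sub i1 i0).trans ((congrArg₂ (· - ·) e1 e0).trans (sub_zero 0))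
    have i2 : Integrable (fun x => f x * (x 0 * pd 1 φ x - x 1 * pd 0 φ x))
        (volume.restrict (cyl R a)) := by
      refine ((integrable_mul_of_memLp h1.1 (((hφ.pd 1).smooth_mul (contDiff_coord 0)).memLp R a)).sub
        (integrable_mul_of_memLp h1.1
          (((hφ.pd 0).smooth_mul (contDiff_coord 1)).memLp R a))).congr ?_
      filter_upwards with x
      simp only [Pi.sub_apply]
      ring
    refine integral_eq_zero_of_ae_eq_sub (i1.sub i0) i2 e2 (integral_angular_eq_zero h0.1 h hφ) ?_
    filter_upwards with x
    simp only [Pi.sub_apply]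
    rw [pd_mul (contDiff_coord 0) hφ.1, pd_mul (contDiff_coord 1) hφ.1, pd_coord, pd_coord]
    simp
    ring

end

/-! ### Multiplication by the components of e_r -/

section

variable {R a : ℝ} {f f' : E3 → ℝ}

theorem measurable_cylR : Measurable cylR := continuous_cylR.measurable

theorem abs_coord_le_cylR {k : Fin 3} (hk : k ≠ 2) (x : E3) : |x k| ≤ cylR x := by
  fin_cases k
  · exact abs_coord_zero_le x
  · exact abs_coord_one_le x
  · exact absurd rfl hk

theorem ae_cylR_pos : ∀ᵐ x : E3, 0 < cylR x := by
  filter_upwards [ae_coord_ne_zero 0] with x hx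
  exact Real.sqrt_pos.2 (by positivity)

theorem abs_coord_div_cylR_le {k : Fin 3} (hk : k ≠ 2) (x : E3) : |x k / cylR x| ≤ 1 := by
  rw [abs_div, abs_of_nonneg (cylR_nonneg x)]
  exact div_le_one_of_le₀ (abs_coord_le_cylR hk x) (cylR_nonneg x)

theorem MemLp.coord_div_cylR_mul (hf : MemLp f 2 (volume.restrict (cyl R a))) {k : Fin 3}
    (hk : k ≠ 2) : MemLp (fun x => x k / cylR x * f x) 2 (volume.restrict (cyl R a)) :=
  memLp_bdd_mul hf ((continuous_coord k).measurable.div measurable_cylR).aestronglyMeasurable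
    (ae_of_all _ (abs_coord_div_cylR_le hk))

/-- The components of `e_r` do not depend on `x₃`. -/
theorem HasPd.coord_div_cylR_mul (h : HasPd R a 2 f f') {k : Fin 3} (hk : k ≠ 2) :
    HasPd R a 2 (fun x => x k / cylR x * f x) (fun x => x k / cylR x * f' x) := by
  refine ⟨MemLp.coord_div_cylR_mul h.1 hk, MemLp.coord_div_cylR_mul h.2.1 hk, fun φ hφ hs => ?_⟩
  have hpos : ∀ (n : ℕ) (x : E3), 0 < x 0 ^ 2 + x 1 ^ 2 + 1 / ((n : ℝ) + 1) := fun n x => by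
    positivity
  -- The component x_k/r is not smooth on the axis. These smooth multipliers are independent of the
  -- axial variable, bounded by 1, and converge to it off the axis.
  set c : ℕ → E3 → ℝ := fun n x => x k / Real.sqrt (x 0 ^ 2 + x 1 ^ 2 + 1 / ((n : ℝ) + 1))
    with hc
  have hm : ∀ n : ℕ, ContDiff ℝ ∞ (c n) := fun n =>
    (contDiff_coord k).div (ContDiff.sqrt (by fun_prop) fun x => (hpos n x).ne')
      fun x => (Real.sqrt_pos.2 (hpos n x)).ne'
  have hm2 : ∀ (n : ℕ) (x : E3), pd 2 (c n) x = 0 := by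
    intro n
    refine pd_eq_zero_of_update 2 fun x t => ?_
    simp [hc, hk]
  have hlim := tendsto_integral_mul_of_le_one (c := c) (c' := fun x => x k / cylR x)
    (integrable_pairing h.1 h.2.1 (hφ.pd 2) hφ)
    (fun n => (hm n).continuous.aestronglyMeasurable) (fun n x => ?_) ?_
  · have hz : ∀ n, ∫ x in cyl R a, c n x * (f x * pd 2 φ x + f' x * φ x) = 0 := by
      intro n
      rw [← h.2.2 _ (hφ.smooth_mul (hm n)) ((tsupport_mul_subset_right).trans hs)]
      congr 1
      ext x
      rw [pd_mul (hm n) hφ.1, hm2]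
      ring
    simp only [hz] at hlim
    rw [← tendsto_nhds_unique hlim tendsto_const_nhds]
    congr 1
    ext x
    ring
  · simp only [hc]
    rw [abs_div, abs_of_nonneg (Real.sqrt_nonneg _)]
    refine div_le_one_of_le₀ ((abs_coord_le_cylR hk x).trans (Real.sqrt_le_sqrt ?_))
      (Real.sqrt_nonneg _)
    have : 0 < 1 / ((n : ℝ) + 1) := by positivity
    linarith
  · filter_upwards [ae_restrict_of_ae ae_cylR_pos] with x hx
    have h := (tendsto_one_div_add_atTop_nhds_zero_nat (𝕜 := ℝ)).const_add (x 0 ^ 2 + x 1 ^ 2)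
    rw [add_zero] at h
    exact tendsto_const_nhds.div (Real.continuous_sqrt.continuousAt.tendsto.comp h) hx.ne'

end

/-! ### Slip velocities -/

/-- A solenoidal field in `H²` that is tangential on the boundary and whose horizontal components
satisfy a Neumann condition at the top and at the bottom, with its Jacobian and its Hessian. -/
structure SlipField (R a : ℝ) (u : Fin 3 → E3 → ℝ) (J : Fin 3 → Fin 3 → E3 → ℝ)
    (H : Fin 3 → Fin 3 → Fin 3 → E3 → ℝ) : Prop where
  jac : ∀ i j, HasPd R a j (u i) (J i j)
  hess : ∀ i j k, HasPd R a k (J i j) (H i j k)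
  div_free : ∀ᵐ x ∂volume.restrict (cyl R a), J 0 0 x + J 1 1 x + J 2 2 x = 0
  tangential : ∀ φ, IsTest φ →
    ∫ x in cyl R a, (u 0 x * pd 0 φ x + u 1 x * pd 1 φ x + u 2 x * pd 2 φ x) = 0
  slip : ∀ i : Fin 3, i ≠ 2 → VanishesAtEnds R a (J i 2) (H i 2 2)

section

variable {R a : ℝ} {u : E3 → E3} {J : Fin 3 → Fin 3 → E3 → ℝ}
  {H : Fin 3 → Fin 3 → Fin 3 → E3 → ℝ}

theorem IsWeakJacobian.ae_eq {J' : Fin 3 → Fin 3 → E3 → ℝ} (h : IsWeakJacobian (cyl R a) u J')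
    (jac : ∀ i j, HasPd R a j (fun x => u x i) (J i j)) (i j : Fin 3) :
    ∀ᵐ x ∂volume.restrict (cyl R a), J' i j x = J i j x :=
  (h i j).unique (jac i j).isWeakPartial (by simp)

theorem IsDivFree.ae_eq_zero (h : IsDivFree (cyl R a) u)
    (jac : ∀ i j, HasPd R a j (fun x => u x i) (J i j)) :
    ∀ᵐ x ∂volume.restrict (cyl R a), J 0 0 x + J 1 1 x + J 2 2 x = 0 := by
  obtain ⟨J', hJ', hdiv⟩ := h
  filter_upwards [hdiv, hJ'.ae_eq jac 0 0, hJ'.ae_eq jac 1 1, hJ'.ae_eq jac 2 2] with x h h0 h1 h2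
  rw [← h0, ← h1, ← h2, ← h, Fin.sum_univ_three]

theorem IsImpermeable.integral_eq_zero (h : IsImpermeable (cyl R a) u)
    (jac : ∀ i j, HasPd R a j (fun x => u x i) (J i j))
    (hdiv : ∀ᵐ x ∂volume.restrict (cyl R a), J 0 0 x + J 1 1 x + J 2 2 x = 0) {φ : E3 → ℝ}
    (hφ : IsTest φ) :
    ∫ x in cyl R a, (u x 0 * pd 0 φ x + u x 1 * pd 1 φ x + u x 2 * pd 2 φ x) = 0 := by
  obtain ⟨J', hJ', himp⟩ := h
  rw [← himp φ hφ.1 hφ.2]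
  apply integral_congr_ae
  filter_upwards [hdiv, hJ'.ae_eq jac 0 0, hJ'.ae_eq jac 1 1, hJ'.ae_eq jac 2 2] with x h h0 h1 h2
  rw [Fin.sum_univ_three, h0, h1, h2]
  linear_combination -φ x * h

theorem cutR_eq_zero {R : ℝ} {x : E3} (hx : cylR x = R) (n : ℕ) : cutR R n x = 0 := by
  have : R ^ 2 - (x 0 ^ 2 + x 1 ^ 2) = 0 := by rw [← cylR_sq, hx, sub_self]
  unfold cutR
  rw [this]
  exact Real.smoothTransition.zero_of_nonpos (by simp)

/-- The slip condition tested with horizontal fields. -/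
theorem IsSlip.vanishesAtEnds (hR : 0 < R) (ha : 0 < a) (h : IsSlip R a u)
    (jac : ∀ i j, HasPd R a j (fun x => u x i) (J i j))
    (hess : ∀ i j k, HasPd R a k (J i j) (H i j k)) {i : Fin 3} (hi : i ≠ 2) :
    VanishesAtEnds R a (fun x => J i 2 x + J 2 i x) (fun x => H i 2 2 x + H 2 i 2 x) := by
  obtain ⟨J', K, hJ', hK, hslip⟩ := h
  have hD : ∀ j, HasPd R a j (fun x => J i j x + J j i x) (fun x => H i j j x + H j i j x) :=
    fun j => (hess i j j).add (hess j i j)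
  have hJe : ∀ j, ∀ᵐ x ∂volume.restrict (cyl R a), J' i j x + J' j i x = J i j x + J j i x :=
    fun j => by
      filter_upwards [hJ'.ae_eq jac i j, hJ'.ae_eq jac j i] with x h1 h2
      rw [h1, h2]
  have hKe : ∀ j, ∀ᵐ x ∂volume.restrict (cyl R a), K i j x = H i j j x + H j i j x := fun j =>
    (hK i j).unique (hD j).isWeakPartial (hJe j)
  refine ⟨(hD 2).1, (hD 2).2.1, fun φ hφ => ?_⟩
  refine integral_eq_zero_of_cutR (integrable_pairing (hD 2).1 (hD 2).2.1 (hφ.pd 2) hφ)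
    fun n => ?_
  have hψ : IsTest fun y => cutR R n y * φ y := hφ.smooth_mul (contDiff_cutR R n)
  -- The test field points in a fixed horizontal direction and its cutoff vanishes on S₁, so it is
  -- tangential on both parts of the boundary and detects the stress at the ends only.
  have key := hslip (fun y => (cutR R n y * φ y) • EuclideanSpace.single i (1 : ℝ))
    (hψ.1.smul contDiff_const) hψ.2.smul_right ⟨fun x hx => ?_, fun x _ => ?_⟩
  · have e0 := (hD 0).integral_cutR hR ha (by decide) hφ n
    have e1 := (hD 1).integral_cutR hR ha (by decide) hφ n
    have i0 := integrable_pairing (hD 0).1 (hD 0).2.1 (hψ.pd 0) hψ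
    have i1 := integrable_pairing (hD 1).1 (hD 1).2.1 (hψ.pd 1) hψ
    have i2 := integrable_pairing (hD 2).1 (hD 2).2.1 (hψ.pd 2) hψ
    have e3 := integral_add i0 i1
    rw [e0, e1, add_zero] at e3
    refine integral_eq_zero_of_ae_eq_sub ((i0.add i1).add i2) (i0.add i1)
      (Eq.trans (integral_congr_ae ?_) key) e3 ?_
    · filter_upwards [hJe 0, hJe 1, hJe 2, hKe 0, hKe 1, hKe 2] with x j0 j1 j2 k0 k1 k2
      rw [Finset.sum_eq_single i]
      · simp only [Pi.add_apply, Fin.sum_univ_three, PiLp.smul_apply, smul_eq_mul,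
          PiLp.single_apply, if_true, mul_one]
        rw [j0, j1, j2, k0, k1, k2]
      · intro l _ hl
        have hz : ∀ j, pd j (fun _ : E3 => (0 : ℝ)) x = 0 := fun j => by simp [pd]
        simp [hl, hz]
      · simp
    · filter_upwards with x
      simp only [Pi.add_apply]
      rw [pd_cutR_mul hφ.1 n x]
      ring
  · simp [compR, cutR_eq_zero hx.1 n]
  · fin_cases i
    · simp [compZ, eZ, real_inner_smul_left, EuclideanSpace.inner_single_left]
    · simp [compZ, eZ, real_inner_smul_left, EuclideanSpace.inner_single_left]
    · exact absurd rfl hi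

/-- The axial component vanishes at the ends, hence so do its horizontal derivatives; subtracting
them from the tangential stress ∂_z u_i + ∂_i u_z leaves the Neumann condition on u_i. -/
theorem IsSlipVelocity.exists_slipField (hR : 0 < R) (ha : 0 < a) (h : IsSlipVelocity R a u) :
    ∃ J H, SlipField R a (fun i x => u x i) J H := by
  choose J H jac hess using fun i => exists_hasPd_of_hNormSq_two (h.memH2 i)
  have hdiv := h.divFree.ae_eq_zero jac
  have htan := fun φ (hφ : IsTest φ) => h.impermeable.integral_eq_zero jac hdiv hφ
  refine ⟨J, H, jac, hess, hdiv, htan, fun i hi => ?_⟩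
  have hv := (vanishesAtEnds_of_tangential hR ha jac hdiv htan).horizontal_deriv hR ha hi (jac 2 i)
    (hess 2 2 i)
  have hs := (h.slip.vanishesAtEnds hR ha jac hess hi).sub hv
  refine hs.congr (ae_of_all _ fun x => by ring) ?_
  filter_upwards [((jac 2 i).comm (jac 2 2) (hess 2 i 2)).unique (hess 2 2 i)] with x hx
  rw [hx]
  ring

end

/-! ### Mirror images, averages and meridional symmetry -/

section

variable {R a : ℝ} {u : Fin 3 → E3 → ℝ} {J : Fin 3 → Fin 3 → E3 → ℝ}
  {H : Fin 3 → Fin 3 → Fin 3 → E3 → ℝ}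

@[simp] theorem reflSign_zero : reflSign 0 = 1 := rfl
@[simp] theorem reflSign_one : reflSign 1 = -1 := rfl
@[simp] theorem reflSign_two : reflSign 2 = 1 := rfl

theorem ae_refl₂ {p : E3 → Prop} (h : ∀ᵐ x ∂volume.restrict (cyl R a), p x) :
    ∀ᵐ x ∂volume.restrict (cyl R a), p (refl₂ x) :=
  measurePreserving_refl₂.quasiMeasurePreserving.ae h

/-- The mirror image is S u(S x) with S the reflection; each further derivative in direction j
contributes the sign of j. -/
theorem SlipField.reflect (h : SlipField R a u J H) :
    SlipField R a (fun i x => reflSign i * u i (refl₂ x))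
      (fun i j x => reflSign i * (reflSign j * J i j (refl₂ x)))
      (fun i j k x => reflSign i * (reflSign j * (reflSign k * H i j k (refl₂ x)))) where
  jac i j := (h.jac i j).comp_refl₂.const_mul _
  hess i j k := (((h.hess i j k).comp_refl₂).const_mul _).const_mul _
  div_free := by
    filter_upwards [ae_refl₂ h.div_free] with x hx
    simpa using hx
  tangential φ hφ := by
    have e := h.tangential _ hφ.comp_refl₂
    rw [← integral_comp_refl₂] at e
    rw [← e]
    congr 1
    ext x
    simp only [pd_comp_refl₂ hφ.1, refl₂_refl₂, reflSign_zero, reflSign_one, reflSign_two]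
    ring
  slip i hi := by
    simpa using ((h.slip i hi).comp_refl₂).const_mul (reflSign i)

theorem SlipField.midpoint {u' : Fin 3 → E3 → ℝ} {J' : Fin 3 → Fin 3 → E3 → ℝ}
    {H' : Fin 3 → Fin 3 → Fin 3 → E3 → ℝ} (h : SlipField R a u J H) (h' : SlipField R a u' J' H') :
    SlipField R a (fun i x => 2⁻¹ * (u i x + u' i x)) (fun i j x => 2⁻¹ * (J i j x + J' i j x))
      (fun i j k x => 2⁻¹ * (H i j k x + H' i j k x)) where
  jac i j := ((h.jac i j).add (h'.jac i j)).const_mul _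
  hess i j k := ((h.hess i j k).add (h'.hess i j k)).const_mul _
  div_free := by
    filter_upwards [h.div_free, h'.div_free] with x h1 h2
    linear_combination 2⁻¹ * (h1 + h2)
  tangential φ hφ := by
    have i0 : ∀ {u J H}, SlipField R a u J H → Integrable (fun x => u 0 x * pd 0 φ x +
        u 1 x * pd 1 φ x + u 2 x * pd 2 φ x) (volume.restrict (cyl R a)) := fun h =>
      (integrable_pairing (h.jac 0 0).1 (h.jac 1 0).1 (hφ.pd 0) (hφ.pd 1)).add
        (integrable_mul_of_memLp (h.jac 2 0).1 ((hφ.pd 2).memLp R a))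
    have e := integral_eq_zero_of_ae_eq_add (i0 h) (i0 h') (h.tangential φ hφ)
      (h'.tangential φ hφ) (ae_of_all _ fun _ => rfl)
    rw [← mul_zero (2⁻¹ : ℝ), ← e, ← integral_const_mul]
    congr 1
    ext x
    ring
  slip i hi := ((h.slip i hi).add (h'.slip i hi)).const_mul _

/-- A slip field with meridional values is a meridional field. -/
theorem SlipField.meridionalField (h : SlipField R a u J H) {p : E3 → ℝ}
    (hp : ∀ θ : ℝ, ∀ᵐ x ∂volume.restrict (cyl R a), p (rotZ θ x) = p x)
    (hq : ∀ θ : ℝ, ∀ᵐ x ∂volume.restrict (cyl R a), u 2 (rotZ θ x) = u 2 x)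
    (h0 : ∀ᵐ x ∂volume.restrict (cyl R a), u 0 x = x 0 / cylR x * p x)
    (h1 : ∀ᵐ x ∂volume.restrict (cyl R a), u 1 x = x 1 / cylR x * p x) :
    MeridionalField R a u J H where
  jac := h.jac
  hess := h.hess
  div_free := h.div_free
  tangential := h.tangential
  swirl_free := by
    filter_upwards [h0, h1] with x e0 e1
    rw [e0, e1]
    ring
  axial_sym := angular_deriv_eq_zero (h.jac 2 0) (h.jac 2 1) hq
  -- The combination x₀u₀ + x₁u₁ = r·p is rotation invariant and has weak derivatives in L² by the
  -- product rule, so p itself need not be differentiated at the axis.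
  radial_sym := by
    have hS : ∀ᵐ x ∂volume.restrict (cyl R a), x 0 * u 0 x + x 1 * u 1 x = cylR x * p x := by
      filter_upwards [h0, h1, ae_restrict_of_ae ae_cylR_pos] with x e0 e1 hx
      rw [e0, e1]
      field_simp
      rw [cylR_sq]
      ring
    have := angular_deriv_eq_zero (((h.jac 0 0).coord_mul 0).add ((h.jac 1 0).coord_mul 1))
      (((h.jac 0 1).coord_mul 0).add ((h.jac 1 1).coord_mul 1)) fun θ => ?_
    · filter_upwards [this] with x hx
      simp only [Fin.isValue, if_true, zero_ne_one, one_ne_zero, if_false] at hx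
      linear_combination hx
    · filter_upwards [hS, (measurePreserving_rotZ θ).quasiMeasurePreserving.ae hS, hp θ]
        with x e1 e2 e3
      rw [e1, e2, e3, cylR_rotZ]

end

/-! ### Cylindrical components and the meridional part -/

section

variable {R a : ℝ} {u : E3 → E3}

theorem compR_eq (u : E3 → E3) (x : E3) :
    compR u x = x 0 / cylR x * u x 0 + x 1 / cylR x * u x 1 := by
  simp [compR, eR, PiLp.inner_apply, Fin.sum_univ_three]

theorem compPhi_eq (u : E3 → E3) (x : E3) :
    compPhi u x = -(x 1 / cylR x * u x 0) + x 0 / cylR x * u x 1 := by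
  simp [compPhi, ePhi, PiLp.inner_apply, Fin.sum_univ_three]
  ring

theorem compZ_eq (u : E3 → E3) (x : E3) : compZ u x = u x 2 := by
  simp [compZ, eZ, PiLp.inner_apply, Fin.sum_univ_three]

theorem meridional_zero (u : E3 → E3) (x : E3) :
    meridional u x 0 = x 0 / cylR x * compR u x := by
  simp [meridional, eR, eZ]; ring

theorem meridional_one (u : E3 → E3) (x : E3) :
    meridional u x 1 = x 1 / cylR x * compR u x := by
  simp [meridional, eR, eZ]; ring

theorem meridional_two (u : E3 → E3) (x : E3) : meridional u x 2 = u x 2 := by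
  simp [meridional, eR, eZ, compZ_eq]

/-- The average of an axially symmetric field and of its reflection in a meridional plane is the
meridional part of the field. -/
theorem IsAxisymmetric.meridional_eq (h : IsAxisymmetric (cyl R a) u)
    (hu : ∀ i, MemLp (fun x => u x i) 2 (volume.restrict (cyl R a))) (i : Fin 3) :
    ∀ᵐ x ∂volume.restrict (cyl R a),
      2⁻¹ * (u x i + reflSign i * u (refl₂ x) i) = meridional u x i := by
  have hR : AEStronglyMeasurable (compR u) (volume.restrict (cyl R a)) := by
    rw [funext (compR_eq u)]
    exact (MemLp.coord_div_cylR_mul (hu 0) (by decide)).1.add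
      (MemLp.coord_div_cylR_mul (hu 1) (by decide)).1
  have hP : AEStronglyMeasurable (compPhi u) (volume.restrict (cyl R a)) := by
    rw [funext (compPhi_eq u)]
    exact (MemLp.coord_div_cylR_mul (hu 0) (by decide)).1.neg.add
      (MemLp.coord_div_cylR_mul (hu 1) (by decide)).1
  have hZ : AEStronglyMeasurable (compZ u) (volume.restrict (cyl R a)) := by
    rw [funext (compZ_eq u)]
    exact (hu 2).1
  -- The reflection S takes e_r and e_z at x to those at S x, but e_φ to its negative. Invariance of
  -- the three components thus makes the swirl of the mirror image opposite to that of u, and it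
  -- cancels in the average.
  filter_upwards [ae_comp_refl₂_eq hR fun θ => (h θ).mono fun _ hx => hx.1,
    ae_comp_refl₂_eq hP fun θ => (h θ).mono fun _ hx => hx.2.1,
    ae_comp_refl₂_eq hZ fun θ => (h θ).mono fun _ hx => hx.2.2,
    ae_restrict_of_ae ae_cylR_pos] with x e1 e2 e3 hx
  have hr := cylR_sq x
  rw [compR_eq, compR_eq, cylR_refl₂, refl₂_zero_coord, refl₂_one_coord] at e1
  rw [compPhi_eq, compPhi_eq, cylR_refl₂, refl₂_zero_coord, refl₂_one_coord] at e2
  rw [compZ_eq, compZ_eq] at e3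
  field_simp at e1 e2
  have hr2 : cylR x ^ 2 ≠ 0 := by positivity
  fin_cases i
  · change 2⁻¹ * (u x 0 + 1 * u (refl₂ x) 0) = meridional u x 0
    rw [meridional_zero, compR_eq]
    field_simp
    rw [hr]
    linear_combination x 0 * e1 + x 1 * e2
  · change 2⁻¹ * (u x 1 + -1 * u (refl₂ x) 1) = meridional u x 1
    rw [meridional_one, compR_eq]
    field_simp
    rw [hr]
    linear_combination x 1 * e1 - x 0 * e2
  · change 2⁻¹ * (u x 2 + 1 * u (refl₂ x) 2) = meridional u x 2
    rw [meridional_two, e3]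
    ring

/-- The meridional part of a slip velocity, with its Jacobian and its Hessian. -/
theorem IsSlipVelocity.exists_meridionalField (hR : 0 < R) (ha : 0 < a)
    (h : IsSlipVelocity R a u) :
    ∃ w J H, MeridionalField R a w J H ∧
      (∀ i : Fin 3, i ≠ 2 → VanishesAtEnds R a (J i 2) (H i 2 2)) ∧
      ∀ i, ∀ᵐ x ∂volume.restrict (cyl R a), w i x = meridional u x i := by
  obtain ⟨J, H, hu⟩ := h.exists_slipField hR ha
  have hm := h.axisymmetric.meridional_eq fun i => (hu.jac i 0).1
  have hs := hu.midpoint hu.reflect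
  refine ⟨_, _, _, hs.meridionalField (p := compR u)
    (fun θ => (h.axisymmetric θ).mono fun _ hx => hx.1) (fun θ => ?_) ?_ ?_, hs.slip, hm⟩
  · filter_upwards [hm 2, (measurePreserving_rotZ θ).quasiMeasurePreserving.ae (hm 2),
      h.axisymmetric θ] with x e1 e2 e3
    have e4 := e3.2.2
    rw [compZ_eq, compZ_eq] at e4
    rw [e1, e2, meridional_two, meridional_two, e4]
  · filter_upwards [hm 0] with x e
    rw [e, meridional_zero]
  · filter_upwards [hm 1] with x e
    rw [e, meridional_one]

/-- By axial symmetry the vector (∂_z w₀ − ∂₀w_z, ∂_z w₁ − ∂₁w_z) is parallel to (x₀, x₁). Its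
component along e_r is χ, because e_r does not depend on z and weak derivatives are unique. -/
theorem IsAngularVorticity.ae_eq {χ : E3 → ℝ} (h : IsAngularVorticity (cyl R a) u χ)
    {w : Fin 3 → E3 → ℝ} {J : Fin 3 → Fin 3 → E3 → ℝ} {H : Fin 3 → Fin 3 → Fin 3 → E3 → ℝ}
    (hw : MeridionalField R a w J H)
    (hm : ∀ i, ∀ᵐ x ∂volume.restrict (cyl R a), w i x = meridional u x i) :
    (∀ᵐ x ∂volume.restrict (cyl R a), J 0 2 x - J 2 0 x = x 0 * (χ x / cylR x)) ∧
      ∀ᵐ x ∂volume.restrict (cyl R a), J 1 2 x - J 2 1 x = x 1 * (χ x / cylR x) := by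
  obtain ⟨A, G, hA, hG, hχ⟩ := h
  have hGe : ∀ i, ∀ᵐ x ∂volume.restrict (cyl R a), G i x = J 2 i x := fun i => by
    refine (hG i).unique (hw.jac 2 i).isWeakPartial ?_
    filter_upwards [hm 2] with x e
    rw [e, meridional_two, compZ_eq]
  have hAe : ∀ᵐ x ∂volume.restrict (cyl R a),
      A x = x 0 / cylR x * J 0 2 x + x 1 / cylR x * J 1 2 x := by
    refine hA.unique (((hw.jac 0 2).coord_div_cylR_mul (by decide)).add
      ((hw.jac 1 2).coord_div_cylR_mul (by decide))).isWeakPartial ?_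
    filter_upwards [hm 0, hm 1, ae_restrict_of_ae ae_cylR_pos] with x e0 e1 hx
    rw [e0, e1, meridional_zero, meridional_one]
    field_simp
    rw [← cylR_sq]
  have hS := ((hw.jac 1 2).coord_mul 0).unique_of_ae_eq ((hw.jac 0 2).coord_mul 1) hw.swirl_free
  have key : ∀ᵐ x ∂volume.restrict (cyl R a), 0 < cylR x ∧ x 0 * J 1 2 x = x 1 * J 0 2 x ∧
      x 0 * J 2 1 x = x 1 * J 2 0 x ∧ (x 0 ^ 2 + x 1 ^ 2) * (χ x / cylR x) =
        x 0 * (J 0 2 x - J 2 0 x) + x 1 * (J 1 2 x - J 2 1 x) := by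
    filter_upwards [hχ, hAe, hGe 0, hGe 1, hS, hw.axial_sym, ae_restrict_of_ae ae_cylR_pos]
      with x e1 e2 e3 e4 e5 e6 hx
    refine ⟨hx, by simpa using e5, e6, ?_⟩
    rw [e1, e2, Fin.sum_univ_three, e3, e4, ← cylR_sq]
    simp only [eR]
    simp
    field_simp
    ring
  constructor
  · filter_upwards [key] with x ⟨hx, e1, e2, e3⟩
    have hr : x 0 ^ 2 + x 1 ^ 2 ≠ 0 := by rw [← cylR_sq]; positivity
    apply mul_left_cancel₀ hr
    linear_combination -x 0 * e3 - x 1 * e1 + x 1 * e2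
  · filter_upwards [key] with x ⟨hx, e1, e2, e3⟩
    have hr : x 0 ^ 2 + x 1 ^ 2 ≠ 0 := by rw [← cylR_sq]; positivity
    apply mul_left_cancel₀ hr
    linear_combination -x 1 * e3 + x 0 * e1 - x 0 * e2

end

/-! ### Sobolev norms of meridional fields -/

section

variable {R a : ℝ} {f f' g : E3 → ℝ}

theorem multiIndices_zero : multiIndices 0 = {0} := by decide

theorem multiIndices_one :
    multiIndices 1 = {0, Pi.single 0 1, Pi.single 1 1, Pi.single 2 1} := by decide

theorem lintegral_le_hNormSq_zero (f : E3 → ℝ) :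
    ∫⁻ x in cyl R a, ‖f x‖ₑ ^ 2 ≤ hNormSq 0 (cyl R a) f := by
  refine le_iInf₂ fun D hD => ?_
  rw [multiIndices_zero, Finset.sum_singleton]
  apply le_of_eq
  apply lintegral_congr_ae
  filter_upwards [(hD 0 (zero_mem_multiIndices 0)).ae_eq] with x hx
  rw [hx]

theorem ofReal_integral_sq_le_hNormSq_zero (hf : MemLp f 2 (volume.restrict (cyl R a))) :
    ENNReal.ofReal (∫ x in cyl R a, f x ^ 2) ≤ hNormSq 0 (cyl R a) f := by
  rw [← lintegral_enorm_sq hf]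
  exact lintegral_le_hNormSq_zero f

theorem hNormSq_one_le {J : Fin 3 → E3 → ℝ} (h : ∀ j, HasPd R a j f (J j))
    (hf : ∀ᵐ x ∂volume.restrict (cyl R a), f x = f' x) :
    hNormSq 1 (cyl R a) f' ≤
      ENNReal.ofReal ((∫ x in cyl R a, f x ^ 2) + ∑ j, ∫ x in cyl R a, J j x ^ 2) := by
  have h' : ∀ j, HasPd R a j f' (J j) := fun j => (h j).congr hf (by simp)
  -- An explicit competitor in the infimum; only its values at the four multi-indices of order at
  -- most one matter.
  set D : (Fin 3 → ℕ) → E3 → ℝ := fun α => if α = 0 then f' else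
    if α = Pi.single 0 1 then J 0 else if α = Pi.single 1 1 then J 1 else J 2 with hDdef
  have d0 : D 0 = f' := if_pos rfl
  have d1 : D (Pi.single 0 1) = J 0 := by
    simp only [hDdef]
    rw [if_neg (by decide)]
    exact if_pos trivial
  have d2 : D (Pi.single 1 1) = J 1 := by
    simp only [hDdef]
    rw [if_neg (by decide), if_neg (by decide)]
    exact if_pos trivial
  have d3 : D (Pi.single 2 1) = J 2 := by
    simp only [hDdef]
    rw [if_neg (by decide), if_neg (by decide), if_neg (by decide)]
  have hD : ∀ α ∈ multiIndices 1, IsWeakDeriv (cyl R a) α f' (D α) := by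
    intro α hα
    rw [multiIndices_one] at hα
    simp only [Finset.mem_insert, Finset.mem_singleton] at hα
    rcases hα with rfl | rfl | rfl | rfl
    · rw [d0]; exact isWeakDeriv_zero (locallyIntegrableOn_of_memLp (h' 0).1)
    · rw [d1]; exact (h' 0).isWeakPartial
    · rw [d2]; exact (h' 1).isWeakPartial
    · rw [d3]; exact (h' 2).isWeakPartial
  refine (iInf₂_le D hD).trans (le_of_eq ?_)
  have hff : ∫ x in cyl R a, f x ^ 2 = ∫ x in cyl R a, f' x ^ 2 := by
    apply integral_congr_ae
    filter_upwards [hf] with x hx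
    rw [hx]
  have nn : ∀ p : E3 → ℝ, 0 ≤ ∫ x in cyl R a, p x ^ 2 := fun p =>
    integral_nonneg fun x => sq_nonneg _
  rw [multiIndices_one, Finset.sum_insert (by decide), Finset.sum_insert (by decide),
    Finset.sum_insert (by decide), Finset.sum_singleton, d0, d1, d2, d3, hff,
    ENNReal.ofReal_add (nn _) (Finset.sum_nonneg fun j _ => nn _),
    ENNReal.ofReal_sum_of_nonneg fun j _ => nn _, Fin.sum_univ_three,
    lintegral_enorm_sq (h' 0).1, lintegral_enorm_sq (h' 0).2.1, lintegral_enorm_sq (h' 1).2.1,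
    lintegral_enorm_sq (h' 2).2.1, add_assoc]

theorem gradHNormSq_one_le {J : Fin 3 → E3 → ℝ} {H : Fin 3 → Fin 3 → E3 → ℝ}
    (h : ∀ j, HasPd R a j f (J j)) (hJ : ∀ j k, HasPd R a k (J j) (H j k))
    (hf : ∀ᵐ x ∂volume.restrict (cyl R a), f x = f' x) :
    gradHNormSq 1 (cyl R a) f' ≤ ENNReal.ofReal
      (∑ j, ((∫ x in cyl R a, J j x ^ 2) + ∑ k, ∫ x in cyl R a, H j k x ^ 2)) := by
  have h' : ∀ j, HasPd R a j f' (J j) := fun j => (h j).congr hf (by simp)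
  refine (iInf₂_le J fun i => (h' i).isWeakPartial).trans ?_
  rw [ENNReal.ofReal_sum_of_nonneg]
  · exact Finset.sum_le_sum fun j _ => hNormSq_one_le (hJ j) (by simp)
  · exact fun j _ => add_nonneg (integral_nonneg fun x => sq_nonneg _)
      (Finset.sum_nonneg fun k _ => integral_nonneg fun x => sq_nonneg _)

end

/-! ### Sobolev estimates at fixed time -/

namespace MeridionalField

variable {R a : ℝ} {w m : Fin 3 → E3 → ℝ} {J : Fin 3 → Fin 3 → E3 → ℝ}
  {H : Fin 3 → Fin 3 → Fin 3 → E3 → ℝ} {g : E3 → ℝ} {g' : Fin 3 → E3 → ℝ}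

theorem integral_sum_sq (h : MeridionalField R a w J H) :
    ∫ x in cyl R a, ∑ i, w i x ^ 2 = ∑ i, ∫ x in cyl R a, w i x ^ 2 :=
  integral_finsetSum _ fun i _ => (h.jac i 0).1.integrable_sq

theorem integral_sum_jac_sq (h : MeridionalField R a w J H) :
    ∫ x in cyl R a, ∑ i, ∑ j, J i j x ^ 2 = ∑ i, ∑ j, ∫ x in cyl R a, J i j x ^ 2 := by
  have S : ∀ i j, Integrable (fun x => J i j x ^ 2) (volume.restrict (cyl R a)) := fun i j =>
    (h.jac i j).2.1.integrable_sq
  rw [integral_finsetSum _ fun i _ => integrable_finsetSum _ fun j _ => S i j]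
  exact Finset.sum_congr rfl fun i _ => integral_finsetSum _ fun j _ => S i j

theorem integral_sum_hess_sq (h : MeridionalField R a w J H) :
    ∫ x in cyl R a, ∑ i, ∑ j, ∑ k, H i j k x ^ 2 =
      ∑ i, ∑ j, ∑ k, ∫ x in cyl R a, H i j k x ^ 2 := by
  have S : ∀ i j k, Integrable (fun x => H i j k x ^ 2) (volume.restrict (cyl R a)) :=
    fun i j k => (h.hess i j k).2.1.integrable_sq
  rw [integral_finsetSum _ fun i _ => integrable_finsetSum _ fun j _ =>
    integrable_finsetSum _ fun k _ => S i j k]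
  refine Finset.sum_congr rfl fun i _ => ?_
  rw [integral_finsetSum _ fun j _ => integrable_finsetSum _ fun k _ => S i j k]
  exact Finset.sum_congr rfl fun j _ => integral_finsetSum _ fun k _ => S i j k

/-- The `H¹` norm of a meridional field is controlled by the `L²` norm of its vorticity divided by
the distance to the axis. -/
theorem sum_hNormSq_one_le (hR : 0 < R) (ha : 0 < a) (h : MeridionalField R a w J H)
    (hm : ∀ i, ∀ᵐ x ∂volume.restrict (cyl R a), w i x = m i x)
    (hg : MemLp g 2 (volume.restrict (cyl R a)))
    (h0 : ∀ᵐ x ∂volume.restrict (cyl R a), J 0 2 x - J 2 0 x = x 0 * g x)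
    (h1 : ∀ᵐ x ∂volume.restrict (cyl R a), J 1 2 x - J 2 1 x = x 1 * g x) :
    ∑ i, hNormSq 1 (cyl R a) (m i) ≤
      ENNReal.ofReal ((R ^ 2 + 4 * a ^ 2 + 1) * R ^ 2) * hNormSq 0 (cyl R a) g := by
  have nn : ∀ p : E3 → ℝ, 0 ≤ ∫ x in cyl R a, p x ^ 2 := fun p =>
    integral_nonneg fun x => sq_nonneg _
  calc ∑ i, hNormSq 1 (cyl R a) (m i)
      ≤ ∑ i, ENNReal.ofReal ((∫ x in cyl R a, w i x ^ 2) + ∑ j, ∫ x in cyl R a, J i j x ^ 2) :=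
        Finset.sum_le_sum fun i _ => hNormSq_one_le (h.jac i) (hm i)
    _ = ENNReal.ofReal (∑ i, ((∫ x in cyl R a, w i x ^ 2) + ∑ j, ∫ x in cyl R a, J i j x ^ 2)) :=
        (ENNReal.ofReal_sum_of_nonneg fun i _ =>
          add_nonneg (nn _) (Finset.sum_nonneg fun j _ => nn _)).symm
    _ ≤ ENNReal.ofReal ((R ^ 2 + 4 * a ^ 2 + 1) * R ^ 2 * ∫ x in cyl R a, g x ^ 2) := by
        apply ENNReal.ofReal_le_ofReal
        rw [Finset.sum_add_distrib, ← h.integral_sum_sq, ← h.integral_sum_jac_sq]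
        have e1 := h.integral_sq_le hR ha
        have e2 := mul_le_mul_of_nonneg_left (h.integral_jac_sq_le hR ha hg h0 h1)
          (by positivity : (0 : ℝ) ≤ R ^ 2 + 4 * a ^ 2 + 1)
        linarith
    _ = ENNReal.ofReal ((R ^ 2 + 4 * a ^ 2 + 1) * R ^ 2) *
          ENNReal.ofReal (∫ x in cyl R a, g x ^ 2) := ENNReal.ofReal_mul (by positivity)
    _ ≤ _ := mul_le_mul_right (ofReal_integral_sq_le_hNormSq_zero hg) _

/-- The `H¹` norm of the gradient of a meridional field is controlled by the `L²` norm of the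
gradient of its vorticity divided by the distance to the axis. -/
theorem sum_gradHNormSq_one_le (hR : 0 < R) (ha : 0 < a) (h : MeridionalField R a w J H)
    (hm : ∀ i, ∀ᵐ x ∂volume.restrict (cyl R a), w i x = m i x)
    (slip : ∀ i : Fin 3, i ≠ 2 → VanishesAtEnds R a (J i 2) (H i 2 2))
    (hg : MemLp g 2 (volume.restrict (cyl R a)))
    (h0 : ∀ᵐ x ∂volume.restrict (cyl R a), J 0 2 x - J 2 0 x = x 0 * g x)
    (h1 : ∀ᵐ x ∂volume.restrict (cyl R a), J 1 2 x - J 2 1 x = x 1 * g x) :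
    ∑ i, gradHNormSq 1 (cyl R a) (m i) ≤
      ENNReal.ofReal (4 * a ^ 2 * R ^ 2 + 20 * R ^ 2 + 24 * a ^ 2) *
        gradHNormSq 0 (cyl R a) g := by
  have nn : ∀ p : E3 → ℝ, 0 ≤ ∫ x in cyl R a, p x ^ 2 := fun p =>
    integral_nonneg fun x => sq_nonneg _
  -- Positivity of the constant gives C · ⊤ = ⊤, which settles the cases where a norm of g is
  -- infinite, and lets C pass through the infimum below.
  have hC : ENNReal.ofReal (4 * a ^ 2 * R ^ 2 + 20 * R ^ 2 + 24 * a ^ 2) ≠ 0 := by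
    rw [Ne, ENNReal.ofReal_eq_zero, not_le]
    positivity
  by_cases htop : gradHNormSq 0 (cyl R a) g = ⊤
  · rw [htop, ENNReal.mul_top hC]
    exact le_top
  -- The right-hand side is an infimum, so the estimate is proved for every admissible weak gradient
  -- of g.
  have hlower : ∀ G : Fin 3 → E3 → ℝ, (∀ i, IsWeakPartial (cyl R a) i g (G i)) →
      ∑ i, gradHNormSq 1 (cyl R a) (m i) ≤
        ENNReal.ofReal (4 * a ^ 2 * R ^ 2 + 20 * R ^ 2 + 24 * a ^ 2) *
          ∑ i, hNormSq 0 (cyl R a) (G i) := by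
    intro G hG
    by_cases hGt : ∑ i, hNormSq 0 (cyl R a) (G i) = ⊤
    · rw [hGt, ENNReal.mul_top hC]
      exact le_top
    have hGm : ∀ i, MemLp (G i) 2 (volume.restrict (cyl R a)) := fun i =>
      memLp_of_hNormSq (ENNReal.sum_lt_top.1 (lt_top_iff_ne_top.2 hGt) i (Finset.mem_univ i))
    have hGp : ∀ i, HasPd R a i g (G i) := fun i => (hG i).hasPd hg (hGm i)
    have hGs : ∫ x in cyl R a, ∑ i, G i x ^ 2 = ∑ i, ∫ x in cyl R a, G i x ^ 2 :=
      integral_finsetSum _ fun i _ => (hGm i).integrable_sq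
    calc ∑ i, gradHNormSq 1 (cyl R a) (m i)
        ≤ ∑ i, ENNReal.ofReal
            (∑ j, ((∫ x in cyl R a, J i j x ^ 2) + ∑ k, ∫ x in cyl R a, H i j k x ^ 2)) :=
          Finset.sum_le_sum fun i _ => gradHNormSq_one_le (h.jac i) (h.hess i) (hm i)
      _ = ENNReal.ofReal
            (∑ i, ∑ j, ((∫ x in cyl R a, J i j x ^ 2) + ∑ k, ∫ x in cyl R a, H i j k x ^ 2)) :=
          (ENNReal.ofReal_sum_of_nonneg fun i _ => Finset.sum_nonneg fun j _ =>
            add_nonneg (nn _) (Finset.sum_nonneg fun j _ => nn _)).symm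
      _ ≤ ENNReal.ofReal ((4 * a ^ 2 * R ^ 2 + 20 * R ^ 2 + 24 * a ^ 2) *
            ∑ i, ∫ x in cyl R a, G i x ^ 2) := by
          apply ENNReal.ofReal_le_ofReal
          simp only [Finset.sum_add_distrib]
          rw [← h.integral_sum_jac_sq, ← h.integral_sum_hess_sq, ← hGs]
          have e1 := h.integral_jac_sq_le hR ha hg h0 h1
          have e2 := (h.vort_vanishesAtEnds hR ha hGp slip h0 h1).integral_sq_le hR ha hGp
          have e3 := h.integral_hess_sq_le hR ha hGp slip h0 h1
          have e4 : ∫ x in cyl R a, G 2 x ^ 2 ≤ ∫ x in cyl R a, ∑ i, G i x ^ 2 := by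
            rw [hGs]
            exact Finset.single_le_sum (f := fun i => ∫ x in cyl R a, G i x ^ 2)
              (fun i _ => nn _) (Finset.mem_univ 2)
          have e5 := mul_le_mul_of_nonneg_left e2 (sq_nonneg R)
          have e6 := mul_le_mul_of_nonneg_left e4 (by positivity : 0 ≤ 4 * a ^ 2 * R ^ 2)
          linarith
      _ = ENNReal.ofReal (4 * a ^ 2 * R ^ 2 + 20 * R ^ 2 + 24 * a ^ 2) *
            ∑ i, ENNReal.ofReal (∫ x in cyl R a, G i x ^ 2) := by
          rw [ENNReal.ofReal_mul (by positivity), ENNReal.ofReal_sum_of_nonneg fun i _ => nn _]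
      _ ≤ _ := mul_le_mul_right
          (Finset.sum_le_sum fun i _ => ofReal_integral_sq_le_hNormSq_zero (hGm i)) _
  conv_rhs => unfold gradHNormSq
  rw [ENNReal.mul_iInf_of_ne hC ENNReal.ofReal_ne_top]
  refine le_iInf fun G => ?_
  rw [ENNReal.mul_iInf_of_ne hC ENNReal.ofReal_ne_top]
  exact le_iInf fun hG => hlower G hG

end MeridionalField

/-! ### Time dependent fields -/

/-- Monotonicity and extraction of a finite constant hold for the essential supremum and the lower
integral of arbitrary functions, so measurability in t of the spatial norms is not needed. -/
theorem vNorm_le_of_ae {ι κ : Type} [Fintype ι] [Fintype κ] {k l : ℕ} {Ω : Set E3} {T : ℝ}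
    {u : ι → ℝ → E3 → ℝ} {v : κ → ℝ → E3 → ℝ} {C : ℝ≥0∞} (hC : C ≠ ⊤)
    (h : ∀ᵐ t ∂volume.restrict (Ioo 0 T),
      ∑ j, hNormSq k Ω (u j t) ≤ C * ∑ j, hNormSq l Ω (v j t))
    (h' : ∀ᵐ t ∂volume.restrict (Ioo 0 T),
      ∑ j, gradHNormSq k Ω (u j t) ≤ C * ∑ j, gradHNormSq l Ω (v j t)) :
    vNorm k Ω T u ≤ C ^ (1 / 2 : ℝ) * vNorm l Ω T v := by
  unfold vNorm
  rw [mul_add]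
  refine add_le_add ?_ ?_
  · rw [← ENNReal.essSup_const_mul]
    refine essSup_mono_ae ?_
    filter_upwards [h] with t ht
    rw [← ENNReal.mul_rpow_of_nonneg _ _ (by norm_num)]
    exact ENNReal.rpow_le_rpow ht (by norm_num)
  · rw [← ENNReal.mul_rpow_of_nonneg _ _ (by norm_num), ← lintegral_const_mul' _ _ hC]
    exact ENNReal.rpow_le_rpow (lintegral_mono_ae h') (by norm_num)

theorem ae_sum_hNormSq_lt_top {ι : Type} [Fintype ι] {k : ℕ} {Ω : Set E3} {T : ℝ}
    {u : ι → ℝ → E3 → ℝ} (h : vNorm k Ω T u < ⊤) :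
    ∀ᵐ t ∂volume.restrict (Ioo 0 T), ∑ j, hNormSq k Ω (u j t) < ⊤ := by
  filter_upwards [ENNReal.ae_le_essSup (μ := volume.restrict (Ioo 0 T))
    fun t => (∑ j, hNormSq k Ω (u j t)) ^ (1 / 2 : ℝ)] with t ht
  exact (ENNReal.rpow_lt_top_iff_of_pos (by norm_num)).1
    (ht.trans_lt ((le_add_right le_rfl).trans_lt h))

theorem measOn_meridional {Ω : Set E3} {T : ℝ} {v : ℝ → E3 → E3}
    (hv : ∀ i, MeasOn Ω T (fun t x => v t x i)) (i : Fin 3) :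
    MeasOn Ω T (fun t x => meridional (v t) x i) := by
  have he : ∀ k : Fin 3, MeasOn Ω T (fun _ x => x k / cylR x) := fun k =>
    (((continuous_coord k).measurable.div measurable_cylR).comp measurable_snd).aestronglyMeasurable
  have hc : MeasOn Ω T (fun t x => compR (v t) x) := by
    simp only [compR_eq]
    exact ((he 0).mul (hv 0)).add ((he 1).mul (hv 1))
  fin_cases i
  · change MeasOn Ω T (fun t x => meridional (v t) x 0)
    simp only [meridional_zero]
    exact (he 0).mul hc
  · change MeasOn Ω T (fun t x => meridional (v t) x 1)
    simp only [meridional_one]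
    exact (he 1).mul hc
  · change MeasOn Ω T (fun t x => meridional (v t) x 2)
    simp only [meridional_two]
    exact hv 2

theorem lemma6p5 (R a : ℝ) (hR : 0 < R) (ha : 0 < a) :
    ∃ c : ℝ≥0, ∀ (T : ℝ) (_ : 0 < T) (v : ℝ → E3 → E3) (χ : ℝ → E3 → ℝ),
      (∀ i, MeasOn (cyl R a) T (fun t x => v t x i)) →
      (∀ᵐ t ∂(volume.restrict (Ioo 0 T)), IsSlipVelocity R a (v t)) →
      (∀ᵐ t ∂(volume.restrict (Ioo 0 T)), IsAngularVorticity (cyl R a) (v t) (χ t)) →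
      MemV 0 (cyl R a) T (fun (_ : Unit) t x => χ t x / cylR x) →
      MemV 1 (cyl R a) T (fun (i : Fin 3) t x => meridional (v t) x i) ∧
      vNorm 1 (cyl R a) T (fun (i : Fin 3) t x => meridional (v t) x i) ≤
        c * vNorm 0 (cyl R a) T (fun (_ : Unit) t x => χ t x / cylR x) := by
  -- The sum of the constants for the H¹ norm and for its gradient counterpart, so that one constant
  -- serves both parts. These bound squared norms, hence the square root in the witness.
  set C : ℝ := (R ^ 2 + 4 * a ^ 2 + 1) * R ^ 2 + (4 * a ^ 2 * R ^ 2 + 20 * R ^ 2 + 24 * a ^ 2)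
    with hC
  refine ⟨C.toNNReal ^ (1 / 2 : ℝ), fun T _ v χ hv hslip hvort hχ => ?_⟩
  have key : ∀ᵐ t ∂volume.restrict (Ioo 0 T),
      ∑ i, hNormSq 1 (cyl R a) (fun x => meridional (v t) x i) ≤ ENNReal.ofReal C *
        ∑ _ : Unit, hNormSq 0 (cyl R a) (fun x => χ t x / cylR x) ∧
      ∑ i, gradHNormSq 1 (cyl R a) (fun x => meridional (v t) x i) ≤ ENNReal.ofReal C *
        ∑ _ : Unit, gradHNormSq 0 (cyl R a) (fun x => χ t x / cylR x) := by
    filter_upwards [hslip, hvort, ae_sum_hNormSq_lt_top hχ.2] with t h1 h2 h3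
    simp only [Finset.univ_unique, Finset.sum_singleton] at h3 ⊢
    obtain ⟨w, J, H, hw, hs, hm⟩ := h1.exists_meridionalField hR ha
    obtain ⟨g0, g1⟩ := h2.ae_eq hw hm
    have hg := memLp_of_hNormSq h3
    refine ⟨(hw.sum_hNormSq_one_le hR ha hm hg g0 g1).trans ?_,
      (hw.sum_gradHNormSq_one_le hR ha hm hs hg g0 g1).trans ?_⟩
    · refine mul_le_mul_left (ENNReal.ofReal_le_ofReal ?_) _
      rw [hC]
      exact le_add_of_nonneg_right (by positivity)
    · refine mul_le_mul_left (ENNReal.ofReal_le_ofReal ?_) _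
      rw [hC]
      exact le_add_of_nonneg_left (by positivity)
  have hle : vNorm 1 (cyl R a) T (fun (i : Fin 3) t x => meridional (v t) x i) ≤
      (C.toNNReal ^ (1 / 2 : ℝ) : ℝ≥0) *
        vNorm 0 (cyl R a) T (fun (_ : Unit) t x => χ t x / cylR x) := by
    rw [ENNReal.coe_rpow_of_nonneg _ (by norm_num)]
    exact vNorm_le_of_ae ENNReal.ofReal_ne_top (key.mono fun _ h => h.1)
      (key.mono fun _ h => h.2)
  exact ⟨⟨measOn_meridional hv, hle.trans_lt (ENNReal.mul_lt_top ENNReal.coe_lt_top hχ.2)⟩, hle⟩
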